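/- **Setting.** Let $n\ge 2$ workers and integers $m,d,D\ge 1$. Worker $i$ holds differentiable functions $f_{i,j}:\mathbb R^d\to\mathbb R$ ($1\le j\le m$), each $L_i$-smooth and $\mu_i$-strongly convex with $\mu_i>0$. Put $f_i=\frac1m\sum_j f_{i,j}$, $F(\Theta)=\sum_i f_i(\theta_i)$ for $\Theta=(\theta_1,\dots,\theta_n)\in\mathbb R^{d\times n}$, $\mu_{\min}=\min_i\mu_i$, $L_{\max}=\max_i L_i$, $\kappa_{\max}=\max_i L_i/\mu_i$, $\kappa_F=L_{\max}/\mu_{\min}$. Let $W\in\mathbb R^{n\times n}$ be symmetric, with $W_{ij}\ne0$ for $i\neq j$ exactly when $(i,j)$ is an edge of the network, such that $U=I-W$ is positive semidefinite with null space $\mathrm{span}\{\mathbf 1\}$. For a symmetric $M$ let $\sigma_1(M)\ge\dots\ge\sigma_n(M)$ be its eigenvalues and $\zeta(M)=\sigma_{n-1}(M)/\sigma_1(M)$. The dual problem is $\min_\xi G(\xi)$, $G(\xi)=F^*(\xi\sqrt U)$, $\xi\in\mathbb R^{d\times n}$. **Gossip matrix.** With $K=\lfloor 1/\sqrt{\zeta(U)}\rfloor$,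 $c_2=\frac{1+\zeta(U)}{1-\zeta(U)}$, $c_3=\frac{2}{(1+\zeta(U))\sigma_1(U)}$ and the Chebyshev polynomial $T_K$, let $P=P_K(U)=I-\frac{T_K(c_2(I-c_3U))}{T_K(c_2)}$ (if $\zeta(U)=1$, then $K=1$ and this is read as its limit $c_3U$). **Parameters.** With $\|\cdot\|$ the Frobenius norm of matrices, $\alpha'=\sigma_{n-1}(P)/L_{\max}$, $\beta'=\sigma_1(P)/\mu_{\min}$, $\kappa'=\kappa_F/\zeta(P)$, take $$\gamma=\frac{\alpha'\beta'\mu_{\min}^2}{288D\|\sqrt P\|^4}e^{-2D/\sqrt{\kappa_F}},\quad c=\frac{\alpha'\beta'\mu_{\min}^2}{1200D\|\sqrt P\|^4}e^{-2(D+1)/\sqrt{\kappa_F}},\quad \eta=\frac{2}{15\beta'},\quad s=10.$$ **MDLAG.** Start from $x^0=y^0=0$, $\hat\theta_i^0=\theta^0_i=\nabla f_i^*(0)$ (this one exact computation is not counted), ages $d_i^0=0$. For $k\ge0$, $$y^{k+1}=x^k-\eta\hat\Theta^kP,\qquad x^{k+1}=y^{k+1}+\tfrac{\sqrt{s\kappa'}-1}{\sqrt{s\kappa'}+1}(y^{k+1}-y^k).$$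 For $k\ge1$ each worker $i$ obtains $\theta_i^k$ by running $S$ epochs of Katyusha, warm started at $\theta_i^{k-1}$, on $\min_\theta \frac1m\sum_j f_{i,j}(\theta)-\langle\theta,x_i^k\rangle$. If the lazy condition $$\|\hat\theta_i^{k-1}-\theta_i^k\|^2\le\frac{3}{\mu_{\min}^2}\Big(\sum_{j=0}^{k-D-1}c^{k-D-j}\delta_j+\sum_{j=0}^{k-1}c^{k-j}\delta_j+\sum_{j=k-D}^{k-1}(c+\gamma)\delta_j\Big),\quad \delta_j=\|x_i^j-x_i^{j+1}\|^2$$ (terms with $j<0$ omitted) holds and $d_i^{k-1}\ne D$, then $\hat\theta_i^k=\hat\theta_i^{k-1}$ and $d_i^k=d_i^{k-1}+1$; otherwise $\hat\theta_i^k=\theta_i^k$ and $d_i^k=0$. **Katyusha** for $\min_\theta\frac1m\sum_jf_j(\theta)-\langle\theta,p\rangle$ with $L$-smooth $\mu$-strongly convex $f_j$ means the following. Put $h_j=f_j-\frac\mu2\|\cdot\|^2$, $\tau=\min\{\sqrt{2m\mu/(3L)},\frac12\}$, $a=\frac1{3\tau L}$; start with $w=y=z$ at the warm start. One epoch computes $v=\frac1m\sum_j\nabla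 h_j(w)$, then for $j=0,\dots,2m-1$, with $i$ sampled uniformly from $\{1,\dots,m\}$ (all samples of the whole run independent), sets $x=\tau z+\frac12w+(\frac12-\tau)y$, $g=v+\nabla h_i(x)-\nabla h_i(w)$, $z^+=\frac{z-a(g-p)}{1+a\mu}$, $y_{j+1}=x+\tau(z^+-z)$, $z\leftarrow z^+$, $y\leftarrow y_{j+1}$, and finally replaces $w$ by the average of $y_1,\dots,y_{2m}$ with weights proportional to $(1+a\mu)^j$ on $y_{j+1}$. The output is $w$. One epoch is charged $5m$ stochastic gradient evaluations ($m$ for $v$, two per inner step). **Theorem.** There are absolute constants $A,C>0$ such that in every such setting, with $S=\lceil A(1+\sqrt{\kappa_{\max}/m})\log(2\kappa_{\max}/c)\rceil$ and $B=(m+\sqrt{m\kappa_{\max}})\log(2\kappa_{\max}/c)$: 1. $\zeta(P_K(U))\ge\frac14$ and $0<c<1$. 2. Each iteration uses at most $C\,n\,B$ stochastic gradient evaluations in total over the workers. 3. $G$ has a minimizer $\xi^\star$, and there are (random) $\lambda^k\in\mathbb R^{d\times n}$ with $y^k=\lambda^k\sqrt U$ and $G(\lambda^k)$ integrable, such that for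 every $\varepsilon>0$ there is an integer $$N\le C\sqrt{\kappa_F}\,\log\Big(2+\frac{G(0)-G(\xi^\star)}{\varepsilon}\Big)$$ with $\mathbb E[G(\lambda^k)]-G(\xi^\star)\le\varepsilon$ for all $k\ge N$, and the first $N$ iterations use at most $$C\,n\,B\,\sqrt{\kappa_F}\,\log\Big(2+\frac{G(0)-G(\xi^\star)}{\varepsilon}\Big)$$ stochastic gradient evaluations. Thus MDLAG has iteration complexity $O(\sqrt{\kappa_F}\log\frac1\varepsilon)$ in expectation and stochastic gradient complexity $O(n(m+\sqrt{m\kappa_{\max}})\sqrt{\kappa_F}\log\frac1\varepsilon)$, where the second $O$ hides the factor $\log(2\kappa_{\max}/c)$, which does not depend on $\varepsilon$. -/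

import Mathlib

namespace MDLAG

open MeasureTheory ProbabilityTheory

/-- `ℝ^d` with the Euclidean norm. -/
abbrev Vec (d : ℕ) : Type := EuclideanSpace ℝ (Fin d)

/-- A matrix in `ℝ^{d×n}`, given by its `n` columns `(θ_1, …, θ_n)`. -/
abbrev Cols (n d : ℕ) : Type := Fin n → Vec d

/-! ### Functions -/

/-- `φ` is differentiable and `L`-smooth. -/
def IsLSmooth {d : ℕ} (φ : Vec d → ℝ) (L : ℝ) : Prop :=
  Differentiable ℝ φ ∧
    ∀ x y : Vec d, φ y ≤ φ x + inner ℝ (gradient φ x) (y - x) + L / 2 * ‖y - x‖ ^ 2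

/-- First-order `μ`-strong convexity (used together with differentiability). -/
def IsStronglyConvex {d : ℕ} (φ : Vec d → ℝ) (μ : ℝ) : Prop :=
  ∀ x y : Vec d, φ x + inner ℝ (gradient φ x) (y - x) + μ / 2 * ‖y - x‖ ^ 2 ≤ φ y

/-- Convex conjugate of a function on `ℝ^d`. -/
noncomputable def conj {d : ℕ} (φ : Vec d → ℝ) (y : Vec d) : ℝ :=
  ⨆ x : Vec d, (inner ℝ y x - φ x)

/-- Convex conjugate of a function on `ℝ^{d×n}`, for the inner product
`⟨Y, X⟩ = ∑ i ⟨Y_i, X_i⟩` (sum of the entrywise products). -/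
noncomputable def conjCols {n d : ℕ} (Φ : Cols n d → ℝ) (Y : Cols n d) : ℝ :=
  ⨆ X : Cols n d, ((∑ i, inner ℝ (Y i) (X i)) - Φ X)

/-! ### Matrices -/

/-- The product `Θ A` of `Θ ∈ ℝ^{d×n}` with `A ∈ ℝ^{n×n}`, by columns. -/
noncomputable def rmul {n d : ℕ} (Θ : Cols n d) (A : Matrix (Fin n) (Fin n) ℝ) : Cols n d :=
  fun i => ∑ j, A j i • Θ j

/-- `σ_k(M)`: the `k`-th largest eigenvalue (`k = 1, …, n`, with multiplicity) of a symmetric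
matrix `M`. -/
noncomputable def sigma {n : ℕ} (M : Matrix (Fin n) (Fin n) ℝ) (k : ℕ) : ℝ :=
  open Classical in
  if h : M.IsHermitian then
    if hk : k - 1 < Fintype.card (Fin n) then h.eigenvalues₀ ⟨k - 1, hk⟩ else 0
  else 0

/-- Normalized eigengap `ζ(M) = σ_{n-1}(M) / σ_1(M)`. -/
noncomputable def zeta {n : ℕ} (M : Matrix (Fin n) (Fin n) ℝ) : ℝ :=
  sigma M (n - 1) / sigma M 1

/-- The square root of a symmetric positive semidefinite matrix: the square root function is applied
to the eigenvalues in the eigendecomposition. -/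
noncomputable def msqrt {n : ℕ} (M : Matrix (Fin n) (Fin n) ℝ) : Matrix (Fin n) (Fin n) ℝ :=
  cfc Real.sqrt M

/-- Frobenius norm. -/
noncomputable def frobNorm {n : ℕ} (M : Matrix (Fin n) (Fin n) ℝ) : ℝ :=
  Real.sqrt (∑ i, ∑ j, M i j ^ 2)

/-- `W` is a weight matrix on the network `G`, with gossip matrix `U = I - W`. -/
structure IsGossip {n : ℕ} (G : SimpleGraph (Fin n)) (W : Matrix (Fin n) (Fin n) ℝ) : Prop where
  symm : W.IsSymm
  posSemidef : (1 - W).PosSemidef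
  support : ∀ i j, i ≠ j → (W i j ≠ 0 ↔ G.Adj i j)
  null : ∀ v : Fin n → ℝ, (1 - W).mulVec v = 0 ↔ ∃ a : ℝ, v = fun _ => a

/-- The degree `K = ⌊1/√ζ(U)⌋`. -/
noncomputable def chebDegree {n : ℕ} (U : Matrix (Fin n) (Fin n) ℝ) : ℕ :=
  ⌊1 / Real.sqrt (zeta U)⌋₊

/-- `c_2 = (1 + ζ(U)) / (1 - ζ(U))`. -/
noncomputable def cheb2 {n : ℕ} (U : Matrix (Fin n) (Fin n) ℝ) : ℝ :=
  (1 + zeta U) / (1 - zeta U)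

/-- `c_3 = 2 / ((1 + ζ(U)) σ_1(U))`. -/
noncomputable def cheb3 {n : ℕ} (U : Matrix (Fin n) (Fin n) ℝ) : ℝ :=
  2 / ((1 + zeta U) * sigma U 1)

/-- The Chebyshev gossip matrix `P_K(U) = I - T_K(c_2 (I - c_3 U)) / T_K(c_2)`.
If `ζ(U) = 1`, then `K = 1` and `c_2` is infinite; as `P_1(U) = c_3 U` for every finite `c_2 ≠ 0`,
this is also the value taken in that case. -/
noncomputable def chebGossip {n : ℕ} (U : Matrix (Fin n) (Fin n) ℝ) : Matrix (Fin n) (Fin n) ℝ :=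
  open Classical in
  if zeta U = 1 then cheb3 U • U
  else
    1 - ((Polynomial.Chebyshev.T ℝ (chebDegree U : ℤ)).eval (cheb2 U))⁻¹ •
      Polynomial.aeval (cheb2 U • (1 - cheb3 U • U)) (Polynomial.Chebyshev.T ℝ (chebDegree U : ℤ))

/-! ### Katyusha

Katyusha for `min_θ (1/m) ∑_j f_j(θ) - ⟨θ, p⟩`, where each `f_j` is `L`-smooth and `μ`-strongly
convex. The objective is split as `(1/m) ∑_j h_j + ψ` with the convex `L`-smooth functions
`h_j = f_j - (μ/2)‖·‖²` and the `μ`-strongly convex term `ψ(θ) = (μ/2)‖θ‖² - ⟨θ, p⟩`.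
Epochs have length `2m`. A counter records the evaluations of gradients `∇f_j`. -/

section Katyusha

variable {d m : ℕ}

/-- `∇h_j(θ) = ∇f_j(θ) - μ θ`; one stochastic gradient evaluation. -/
noncomputable def katyushaGrad (f : Fin m → Vec d → ℝ) (μ : ℝ) (j : Fin m) (θ : Vec d) : Vec d :=
  gradient (f j) θ - μ • θ

/-- `τ_1 = min {√(2mμ/(3L)), 1/2}`. -/
noncomputable def katyushaTau (m : ℕ) (L μ : ℝ) : ℝ :=
  min (Real.sqrt (2 * m * μ / (3 * L))) (1 / 2)

/-- The step size `1/(3 τ_1 L)`. -/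
noncomputable def katyushaStep (m : ℕ) (L μ : ℝ) : ℝ :=
  1 / (3 * katyushaTau m L μ * L)

/-- State in the course of an epoch: the sequences `y` and `z`, the weighted sum of the `y` computed
so far in the epoch, and the number of stochastic gradients evaluated so far. -/
structure InnerState (d : ℕ) where
  y : Vec d
  z : Vec d
  acc : Vec d
  evals : ℕ

/-- One inner step with sampled index `i`, at position `j` of the epoch with snapshot `w`, where
`full` is the full gradient `(1/m) ∑_j ∇h_j(w)`. The new `z` is
`argmin_u ‖u - z‖²/(2α) + ⟨g, u⟩ + ψ(u)`. Two stochastic gradients are evaluated. -/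
noncomputable def katyushaInner (f : Fin m → Vec d → ℝ) (L μ : ℝ) (p w full : Vec d)
    (j : ℕ) (i : Fin m) (s : InnerState d) : InnerState d :=
  let τ := katyushaTau m L μ
  let α := katyushaStep m L μ
  let x := τ • s.z + (1 / 2 : ℝ) • w + (1 - τ - 1 / 2) • s.y
  let g := full + katyushaGrad f μ i x - katyushaGrad f μ i w
  let z' := (1 / (1 + α * μ)) • (s.z - α • (g - p))
  let y' := x + τ • (z' - s.z)
  { y := y'
    z := z'
    acc := s.acc + (1 + α * μ) ^ j • y'
    evals := s.evals + 2 }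

/-- State after `j` inner steps of an epoch, with sampled indices `idx 0, …, idx (j - 1)`. -/
noncomputable def katyushaInnerIter (f : Fin m → Vec d → ℝ) (L μ : ℝ) (p w full : Vec d)
    (idx : ℕ → Fin m) (s : InnerState d) : ℕ → InnerState d
  | 0 => s
  | j + 1 => katyushaInner f L μ p w full j (idx j) (katyushaInnerIter f L μ p w full idx s j)

/-- State between epochs: snapshot, `y`, `z`, and the number of stochastic gradients. -/
structure EpochState (d : ℕ) where
  snap : Vec d
  y : Vec d
  z : Vec d
  evals : ℕ

/-- One epoch: `m` stochastic gradients for the full gradient at the snapshot, then `2m` inner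
steps; the new snapshot is the weighted average of the `y` of this epoch. -/
noncomputable def katyushaEpoch (f : Fin m → Vec d → ℝ) (L μ : ℝ) (p : Vec d)
    (idx : ℕ → Fin m) (s : EpochState d) : EpochState d :=
  let full := (1 / m : ℝ) • ∑ j, katyushaGrad f μ j s.snap
  let r := katyushaInnerIter f L μ p s.snap full idx
    { y := s.y, z := s.z, acc := 0, evals := s.evals + m } (2 * m)
  { snap := (∑ j ∈ Finset.range (2 * m), (1 + katyushaStep m L μ * μ) ^ j)⁻¹ • r.acc
    y := r.y
    z := r.z
    evals := r.evals }

/-- Katyusha started at `θ₀`, after `S` epochs; `idx s j` is the index sampled at step `j` of epoch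
`s`. The output is the field `snap`. -/
noncomputable def katyusha (f : Fin m → Vec d → ℝ) (L μ : ℝ) (p : Vec d)
    (idx : ℕ → ℕ → Fin m) (θ₀ : Vec d) : ℕ → EpochState d
  | 0 => { snap := θ₀, y := θ₀, z := θ₀, evals := 0 }
  | s + 1 => katyushaEpoch f L μ p (idx s) (katyusha f L μ p idx θ₀ s)

end Katyusha

/-! ### The problem and the parameters -/

/-- The data: local functions `f_{i,j}` (`i` a worker, `j = 1, …, m`), constants `L_i` and `μ_i`,
weight matrix `W`, and maximal delay `D`. -/
structure Data (n m d : ℕ) where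
  f : Fin n → Fin m → Vec d → ℝ
  L : Fin n → ℝ
  μ : Fin n → ℝ
  W : Matrix (Fin n) (Fin n) ℝ
  D : ℕ

namespace Data

variable {n m d : ℕ} (p : Data n m d)

/-- Each `f_{i,j}` is `L_i`-smooth and `μ_i`-strongly convex, with `μ_i > 0`. -/
def SmoothStronglyConvex : Prop :=
  ∀ i, 0 < p.μ i ∧ ∀ j, IsLSmooth (p.f i j) (p.L i) ∧ IsStronglyConvex (p.f i j) (p.μ i)

/-- `f_i = (1/m) ∑_j f_{i,j}`. -/
noncomputable def fLocal (i : Fin n) (θ : Vec d) : ℝ := (1 / m : ℝ) * ∑ j, p.f i j θ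

/-- `F(Θ) = ∑_i f_i(θ_i)`. -/
noncomputable def F (Θ : Cols n d) : ℝ := ∑ i, p.fLocal i (Θ i)

noncomputable def muMin : ℝ := ⨅ i, p.μ i
noncomputable def Lmax : ℝ := ⨆ i, p.L i
noncomputable def kappaMax : ℝ := ⨆ i, p.L i / p.μ i
noncomputable def kappaF : ℝ := p.Lmax / p.muMin

/-- The gossip matrix `U = I - W`. -/
def U : Matrix (Fin n) (Fin n) ℝ := 1 - p.W

/-- `P_K(U)`. -/
noncomputable def PK : Matrix (Fin n) (Fin n) ℝ := chebGossip p.U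

/-- The dual objective `G(ξ) = F^*(ξ √U)`. -/
noncomputable def dual (ξ : Cols n d) : ℝ := conjCols p.F (rmul ξ (msqrt p.U))

/-- `α' = σ_{n-1}(P_K(U)) / L_max`. -/
noncomputable def alpha : ℝ := sigma p.PK (n - 1) / p.Lmax

/-- `β' = σ_1(P_K(U)) / μ_min`. -/
noncomputable def beta : ℝ := sigma p.PK 1 / p.muMin

noncomputable def gamma : ℝ :=
  p.alpha * p.beta * p.muMin ^ 2 / (288 * p.D * frobNorm (msqrt p.PK) ^ 4) *
    Real.exp (-(2 * p.D / Real.sqrt p.kappaF))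

noncomputable def c : ℝ :=
  p.alpha * p.beta * p.muMin ^ 2 / (1200 * p.D * frobNorm (msqrt p.PK) ^ 4) *
    Real.exp (-(2 * (p.D + 1) / Real.sqrt p.kappaF))

noncomputable def eta : ℝ := 2 / 15 * (1 / p.beta)

/-- `κ' = κ_F / ζ(P_K(U))`. -/
noncomputable def kappa' : ℝ := p.kappaF / zeta p.PK

/-- The momentum `(√(sκ') - 1)/(√(sκ') + 1)` with `s = 10`. -/
noncomputable def momentum : ℝ :=
  (Real.sqrt (10 * p.kappa') - 1) / (Real.sqrt (10 * p.kappa') + 1)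

/-- The number of epochs of each Katyusha call: `⌈A (1 + √(κ_max/m)) log(2κ_max/c)⌉`. -/
noncomputable def epochs (A : ℝ) : ℕ :=
  ⌈A * (1 + Real.sqrt (p.kappaMax / m)) * Real.log (2 * p.kappaMax / p.c)⌉₊

/-! ### The algorithm -/

/-- Worker `i`'s lazy condition at iteration `k`, for the cached vector `old` (`θ̂_i^{k-1}`), the
fresh vector `new` (`θ_i^k`) and the sequence `x j = x_i^j`, `j ≤ k`. Terms with a negative index
`j` are absent. -/
def Lazy (k : ℕ) (old new : Vec d) (x : ℕ → Vec d) : Prop :=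
  ‖old - new‖ ^ 2 ≤
    3 * ∑ j ∈ Finset.range (k - p.D),
        p.c ^ (k - p.D - j) / p.muMin ^ 2 * ‖x j - x (j + 1)‖ ^ 2
    + 3 * ∑ j ∈ Finset.range k, p.c ^ (k - j) / p.muMin ^ 2 * ‖x j - x (j + 1)‖ ^ 2
    + 3 * ∑ j ∈ Finset.Ico (k - p.D) k, p.c / p.muMin ^ 2 * ‖x j - x (j + 1)‖ ^ 2
    + 3 * ∑ j ∈ Finset.Ico (k - p.D) k, p.gamma / p.muMin ^ 2 * ‖x j - x (j + 1)‖ ^ 2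

end Data

/-- State of the algorithm at iteration `k`: `hist j = x^j` for `j ≤ k`, `y = y^k`, `theta = Θ^k`,
`thetaHat` the cached matrix used for the update, `age i = d_i^k`, and `evals` the number of
stochastic gradients evaluated so far by all workers together. -/
structure State (n d : ℕ) where
  hist : ℕ → Cols n d
  y : Cols n d
  theta : Cols n d
  thetaHat : Cols n d
  age : Fin n → ℕ
  evals : ℕ

namespace Data

variable {n m d : ℕ} (p : Data n m d)

/-- `x^0 = y^0 = 0` and `Θ̂^0 = Θ^0 = ∇F^*(0)`, that is `θ_i^0 = ∇f_i^*(0)`. -/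
noncomputable def init : State n d where
  hist := fun _ => 0
  y := 0
  theta := fun i => gradient (conj (p.fLocal i)) 0
  thetaHat := fun i => gradient (conj (p.fLocal i)) 0
  age := fun _ => 0
  evals := 0

/-- From iteration `k` to iteration `k + 1`: `y^{k+1} = x^k - η Θ̂^k P_K(U)`, then `x^{k+1}`, then
Katyusha on each worker, warm started at `θ_i^k`, then the lazy update of the cache. Here
`idx i s j` is the index sampled by worker `i` at step `j` of epoch `s` of this Katyusha call. -/
noncomputable def step (A : ℝ) (k : ℕ) (idx : Fin n → ℕ → ℕ → Fin m) (s : State n d) :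
    State n d :=
  open Classical in
  let y' : Cols n d := s.hist k - p.eta • rmul s.thetaHat p.PK
  let x' : Cols n d := y' + p.momentum • (y' - s.y)
  let hist' : ℕ → Cols n d := Function.update s.hist (k + 1) x'
  let kat : Fin n → EpochState d := fun i =>
    katyusha (p.f i) (p.L i) (p.μ i) (x' i) (idx i) (s.theta i) (p.epochs A)
  let send : Fin n → Prop := fun i =>
    ¬ p.Lazy (k + 1) (s.thetaHat i) (kat i).snap (fun j => hist' j i) ∨ s.age i = p.D
  { hist := hist'
    y := y'
    theta := fun i => (kat i).snap
    thetaHat := fun i => if send i then (kat i).snap else s.thetaHat i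
    age := fun i => if send i then 0 else s.age i + 1
    evals := s.evals + ∑ i, (kat i).evals }

/-- The run of MDLAG; `idx k i s j` is the index sampled by worker `i` at iteration `k`, epoch `s`,
inner step `j`. -/
noncomputable def run (A : ℝ) (idx : ℕ → Fin n → ℕ → ℕ → Fin m) : ℕ → State n d
  | 0 => p.init
  | k + 1 => p.step A k (idx (k + 1)) (run A idx k)

end Data

/-- Independent and uniformly distributed sampling of indices. -/
structure IsUniformSampling {Ω : Type*} [MeasurableSpace Ω] (P : Measure Ω) {n m : ℕ}
    (idx : ℕ → Fin n → ℕ → ℕ → Ω → Fin m) : Prop where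
  measurable : ∀ k i s j, Measurable (idx k i s j)
  indep : iIndepFun (fun q : ℕ × Fin n × ℕ × ℕ => idx q.1 q.2.1 q.2.2.1 q.2.2.2) P
  uniform : ∀ k i s j (a : Fin m), P.real (idx k i s j ⁻¹' {a}) = 1 / m

end MDLAG

/-!
The matrix `P = P_K(U)` is a polynomial in `U` which annihilates the constant vectors and whose
other eigenvalues lie within `3/5` of `1` (`exists_polynomial_chebGossip`), whence `ζ(P) ≥ 1/4`
(`zeta_chebGossip`) and `κ' ≤ 4 κ_F`.

Write `x^k = u^k √P` and `y^k = v^k √P`. Then `v^{k+1} = u^k - η Θ̂^k √P`, so MDLAG is Nesterov's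
method for `H(u) = F^*(u √P)` with `Θ̂^k √P` in place of `∇H(u^k) = ∇F^*(x^k) √P`. The function `H`
is `β'`-smooth, and `α'`-strongly convex on the matrices whose columns sum to zero, where all
iterates stay. With `t = 1/√(10 κ')`, one step (`accelerated_step`) contracts the Lyapunov function
`H(v) - H^* + (3α'/8) ‖w - ξ^*‖²` by `1 - t` up to a multiple of the gradient error
`‖Θ̂^k - ∇F^*(x^k)‖²`. The step size `η` is small enough to leave negative multiples of
`‖Θ̂^k √P‖²` and `‖u^k - v^k‖²` over, and these dominate the increments `‖x^k - x^{k+1}‖²`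
(`incr_le`).

The gradient error has two sources. Katyusha contracts `E ‖θ - θ^*‖²` by `4 (L_i/μ_i) (1 + τ)^{-S}`
(`katyusha_expect`), which is at most `c/2` for the chosen `S` (`katyusha_factor_le`); since `∇F^*`
is `1/μ_min`-Lipschitz, the error of `Θ^k` is at most a convolution of the past increments with
the powers of `c` (`expect_thetaErr_le`). The lazy condition bounds `‖Θ̂^k - Θ^k‖²` by a similar
convolution.
So the error is at most `8/μ_min²` times a memory of past increments, with weights of total mass at
most `1/(130 κ')` even after multiplication of the `s`-th one by `(1 - t)^{-s}`
(`sum_memWeight_le`): this is what the exponential factors in `c` and `γ` are for. Summed over the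
run, the memory is therefore absorbed by the negative terms (`linear_convergence_of_memory`), and
the expected Lyapunov function decreases linearly with rate `t ≥ 1/√(40 κ_F)`.

The zero-sum matrices are the range of both `X ↦ X √P` and `X ↦ X √U`
(`IsLaplacian.exists_rmul_msqrt`), which turns the statement about `F^*(y^k)` into the one about
`G`. All expectations are of functions of finitely many samples, each uniform on a finite set; this
gives integrability, and lets a fresh sample be averaged out (`IsUniformFamily.expect_update`).
-/

namespace MDLAG

open Matrix MeasureTheory ProbabilityTheory

/-! ### Spectra of gossip matrices -/

/-- A positive semidefinite matrix whose null space is spanned by the all-ones vector. -/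
structure IsLaplacian {n : ℕ} (M : Matrix (Fin n) (Fin n) ℝ) : Prop where
  posSemidef : M.PosSemidef
  null : ∀ v : Fin n → ℝ, M *ᵥ v = 0 ↔ ∃ a : ℝ, v = fun _ => a

lemma IsGossip.isLaplacian {n : ℕ} {G : SimpleGraph (Fin n)} {W : Matrix (Fin n) (Fin n) ℝ}
    (h : IsGossip G W) : IsLaplacian (1 - W) := ⟨h.posSemidef, h.null⟩

section Spectral

variable {n : ℕ} {M : Matrix (Fin n) (Fin n) ℝ}

lemma dotProduct_eigenvectorBasis (h : M.IsHermitian) (v w : Fin n → ℝ) :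
    v ⬝ᵥ w = ∑ i, (v ⬝ᵥ ⇑(h.eigenvectorBasis i)) * (⇑(h.eigenvectorBasis i) ⬝ᵥ w) := by
  have := h.eigenvectorBasis.sum_inner_mul_inner (WithLp.toLp 2 v) (WithLp.toLp 2 w)
  simp only [EuclideanSpace.inner_eq_star_dotProduct, star_trivial] at this
  rw [dotProduct_comm v w, ← this]
  exact Finset.sum_congr rfl fun i _ => by rw [dotProduct_comm, dotProduct_comm w]

lemma dotProduct_mulVec_eigen (h : M.IsHermitian) (v : Fin n → ℝ) :
    v ⬝ᵥ (M *ᵥ v) = ∑ i, h.eigenvalues i * (v ⬝ᵥ ⇑(h.eigenvectorBasis i)) ^ 2 := by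
  rw [dotProduct_eigenvectorBasis h]
  refine Finset.sum_congr rfl fun i _ => ?_
  have hM : Mᵀ = M := by
    rw [← conjTranspose_eq_transpose_of_trivial]; exact h
  have : ⇑(h.eigenvectorBasis i) ⬝ᵥ (M *ᵥ v)
      = h.eigenvalues i * (v ⬝ᵥ ⇑(h.eigenvectorBasis i)) := by
    rw [dotProduct_mulVec, ← mulVec_transpose, hM, h.mulVec_eigenvectorBasis, smul_dotProduct,
      dotProduct_comm, smul_eq_mul]
  rw [this]; ring

lemma sigma_eq (h : M.IsHermitian) {k : ℕ} (hk : k - 1 < n) :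
    sigma M k = h.eigenvalues₀ ⟨k - 1, by simpa using hk⟩ := by
  have hk' : k - 1 < Fintype.card (Fin n) := by simpa using hk
  simp only [sigma, h, hk', dif_pos]

lemma exists_sigma_eq (h : M.IsHermitian) {k : ℕ} (hk : k - 1 < n) :
    ∃ i, sigma M k = h.eigenvalues i := by
  refine ⟨(Fintype.equivOfCardEq (Fintype.card_fin _)) ⟨k - 1, by simpa using hk⟩, ?_⟩
  rw [sigma_eq h hk, Matrix.IsHermitian.eigenvalues, Equiv.symm_apply_apply]

lemma eigenvalues_le_sigma_one (h : M.IsHermitian) (i : Fin n) :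
    h.eigenvalues i ≤ sigma M 1 := by
  rw [sigma_eq h (k := 1) (by have := i.2; omega)]
  exact h.eigenvalues₀_antitone (Fin.mk_le_of_le_val (Nat.zero_le _))

lemma dotProduct_mulVec_le (h : M.IsHermitian) (v : Fin n → ℝ) :
    v ⬝ᵥ (M *ᵥ v) ≤ sigma M 1 * (v ⬝ᵥ v) := by
  rw [dotProduct_mulVec_eigen h, dotProduct_eigenvectorBasis h v v, Finset.mul_sum]
  refine Finset.sum_le_sum fun i _ => ?_
  rw [dotProduct_comm _ v, ← sq]
  exact mul_le_mul_of_nonneg_right (eigenvalues_le_sigma_one h i) (sq_nonneg _)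

/-- Exactly one eigenvalue of a Laplacian vanishes; it belongs to the constant vectors, and all
others are at least `σ_{n-1}`. -/
lemma IsLaplacian.exists_zero_index (hM : IsLaplacian M) (hn : 2 ≤ n) :
    0 < sigma M (n - 1) ∧ ∃ i₀, (∃ a : ℝ, ⇑(hM.posSemidef.1.eigenvectorBasis i₀) = fun _ => a) ∧
      hM.posSemidef.1.eigenvalues i₀ = 0 ∧
      ∀ i ≠ i₀, sigma M (n - 1) ≤ hM.posSemidef.1.eigenvalues i := by
  set h := hM.posSemidef.1 with hh
  let e : Fin (Fintype.card (Fin n)) ≃ Fin n := Fintype.equivOfCardEq (Fintype.card_fin _)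
  have hev : ∀ k, h.eigenvalues (e k) = h.eigenvalues₀ k := fun k => by
    rw [Matrix.IsHermitian.eigenvalues, Equiv.symm_apply_apply]
  have hnn : ∀ i, 0 ≤ h.eigenvalues i := hM.posSemidef.eigenvalues_nonneg
  -- otherwise the all-ones vector would be orthogonal to every eigenvector
  have hone : ∃ i, h.eigenvalues i = 0 := by
    by_contra! hne
    have h1 : (fun _ => (1 : ℝ)) ⬝ᵥ (M *ᵥ (fun _ : Fin n => (1 : ℝ))) = 0 := by
      rw [(hM.null _).2 ⟨1, rfl⟩, dotProduct_zero]
    rw [dotProduct_mulVec_eigen h, Finset.sum_eq_zero_iff_of_nonneg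
      (fun i _ => mul_nonneg (hnn i) (sq_nonneg _))] at h1
    have h2 := dotProduct_eigenvectorBasis h (fun _ => (1 : ℝ)) (fun _ => (1 : ℝ))
    rw [Finset.sum_eq_zero] at h2
    · simp [dotProduct] at h2; omega
    · intro i _
      have := h1 i (Finset.mem_univ _)
      rcases mul_eq_zero.1 this with h3 | h3
      · exact absurd h3 (hne i)
      · rw [pow_eq_zero_iff two_ne_zero] at h3; rw [h3, zero_mul]
  obtain ⟨l, hl⟩ : ∃ l : Fin (Fintype.card (Fin n)), (l : ℕ) = n - 1 :=
    ⟨⟨n - 1, by simp; omega⟩, rfl⟩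
  have hconst : ∀ i, h.eigenvalues i = 0 → ∃ a : ℝ, ⇑(h.eigenvectorBasis i) = fun _ => a := by
    intro i hi
    rw [← hM.null, h.mulVec_eigenvectorBasis, hi, zero_smul]
  have hl0 : h.eigenvalues (e l) = 0 := by
    obtain ⟨i, hi⟩ := hone
    refine le_antisymm ?_ (hnn _)
    rw [← hi, ← e.apply_symm_apply i, hev, hev]
    exact h.eigenvalues₀_antitone (Fin.le_def.2 (by
      rw [hl]; have := (e.symm i).2; simp at this; omega))
  -- two orthonormal vectors cannot both be constant
  have huniq : ∀ i ≠ e l, h.eigenvalues i ≠ 0 := by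
    intro i hi h0
    obtain ⟨a, ha⟩ := hconst i h0
    obtain ⟨b, hb⟩ := hconst _ hl0
    have h1 : inner ℝ (h.eigenvectorBasis i) (h.eigenvectorBasis (e l)) = 0 :=
      h.eigenvectorBasis.orthonormal.2 hi
    have h2 := h.eigenvectorBasis.orthonormal.1 i
    have h3 := h.eigenvectorBasis.orthonormal.1 (e l)
    rw [EuclideanSpace.norm_eq] at h2 h3
    rw [EuclideanSpace.inner_eq_star_dotProduct] at h1
    have hn0 : (n : ℝ) ≠ 0 := by positivity
    simp only [star_trivial, ha, hb, dotProduct, Finset.sum_const, Finset.card_univ,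
      Fintype.card_fin, nsmul_eq_mul] at h1 h2 h3
    rcases mul_eq_zero.1 ((mul_eq_zero.1 h1).resolve_left hn0) with h4 | h4
    · simp [h4] at h3
    · simp [h4] at h2
  have hs : sigma M (n - 1) = h.eigenvalues₀ ⟨n - 1 - 1, by simp; omega⟩ :=
    sigma_eq h (by omega)
  refine ⟨?_, e l, hconst _ hl0, hl0, ?_⟩
  · rw [hs, ← hev]
    refine lt_of_le_of_ne (hnn _) (Ne.symm (huniq _ ?_))
    intro heq
    have := congrArg Fin.val (e.injective heq)
    simp [hl] at this; omega
  · intro i hi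
    rw [hs, ← e.apply_symm_apply i, hev]
    refine h.eigenvalues₀_antitone (Fin.le_def.2 ?_)
    have h1 : e.symm i ≠ l := fun h' => hi (by rw [← h', e.apply_symm_apply])
    have h2 : (e.symm i : ℕ) ≠ n - 1 := fun h' => h1 (Fin.ext (by rw [h', hl]))
    have h3 := (e.symm i).2
    simp only [Fintype.card_fin] at h3
    simp only
    omega

lemma IsLaplacian.sigma_pos (hM : IsLaplacian M) (hn : 2 ≤ n) : 0 < sigma M (n - 1) :=
  (hM.exists_zero_index hn).1

lemma IsLaplacian.sigma_le (hM : IsLaplacian M) (hn : 2 ≤ n) :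
    sigma M (n - 1) ≤ sigma M 1 := by
  obtain ⟨i, hi⟩ := exists_sigma_eq hM.posSemidef.1 (k := n - 1) (by omega)
  rw [hi]; exact eigenvalues_le_sigma_one _ i

lemma IsLaplacian.le_dotProduct_mulVec (hM : IsLaplacian M) (hn : 2 ≤ n) {v : Fin n → ℝ}
    (hv : ∑ i, v i = 0) : sigma M (n - 1) * (v ⬝ᵥ v) ≤ v ⬝ᵥ (M *ᵥ v) := by
  obtain ⟨-, i₀, ⟨a, ha⟩, -, hi⟩ := hM.exists_zero_index hn
  rw [dotProduct_mulVec_eigen hM.posSemidef.1,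
    dotProduct_eigenvectorBasis hM.posSemidef.1 v v, Finset.mul_sum]
  refine Finset.sum_le_sum fun i _ => ?_
  rw [dotProduct_comm _ v, ← sq]
  rcases eq_or_ne i i₀ with rfl | hne
  · have : v ⬝ᵥ ⇑(hM.posSemidef.1.eigenvectorBasis i) = 0 := by
      rw [ha]; simp [dotProduct, ← Finset.sum_mul, hv]
    rw [this]; simp
  · exact mul_le_mul_of_nonneg_right (hi i hne) (sq_nonneg _)

lemma IsLaplacian.mem_spectrum (hM : IsLaplacian M) (hn : 2 ≤ n) {x : ℝ}
    (hx : x ∈ spectrum ℝ M) : x = 0 ∨ (sigma M (n - 1) ≤ x ∧ x ≤ sigma M 1) := by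
  rw [hM.posSemidef.1.spectrum_real_eq_range_eigenvalues] at hx
  obtain ⟨i, rfl⟩ := hx
  obtain ⟨-, i₀, -, h0, hi⟩ := hM.exists_zero_index hn
  rcases eq_or_ne i i₀ with rfl | hne
  · exact Or.inl h0
  · exact Or.inr ⟨hi i hne, eigenvalues_le_sigma_one _ i⟩

lemma sigma_mem_spectrum (h : M.IsHermitian) {k : ℕ} (hk : k - 1 < n) :
    sigma M k ∈ spectrum ℝ M := by
  obtain ⟨i, hi⟩ := exists_sigma_eq h hk
  rw [hi]; exact h.eigenvalues_mem_spectrum_real i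

lemma IsLaplacian.zeta_pos (hM : IsLaplacian M) (hn : 2 ≤ n) : 0 < zeta M :=
  div_pos (hM.sigma_pos hn) ((hM.sigma_pos hn).trans_le (hM.sigma_le hn))

lemma IsLaplacian.zeta_le_one (hM : IsLaplacian M) (hn : 2 ≤ n) : zeta M ≤ 1 :=
  div_le_one_of_le₀ (hM.sigma_le hn) ((hM.sigma_pos hn).le.trans (hM.sigma_le hn))

/-- A polynomial `Q` in a Laplacian `M` with `Q(0) = 0` and positive values on the nonzero spectrum
is again a Laplacian: `M = h(M) Q(M)` with `h(x) = x / Q(x)`, so that the null spaces agree. -/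
lemma IsLaplacian.aeval (hM : IsLaplacian M) (hn : 2 ≤ n) {Q : Polynomial ℝ} (hQ0 : Q.eval 0 = 0)
    (hQ : ∀ x, sigma M (n - 1) ≤ x → x ≤ sigma M 1 → 0 < Q.eval x) :
    IsLaplacian (Polynomial.aeval M Q) := by
  have hsa : IsSelfAdjoint M := hM.posSemidef.1
  have hcont : ∀ f : ℝ → ℝ, ContinuousOn f (spectrum ℝ M) := fun f =>
    (Matrix.finite_real_spectrum (A := M)).continuousOn f
  have hQs : ∀ x ∈ spectrum ℝ M, x = 0 ∨ 0 < Q.eval x := fun x hx =>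
    (hM.mem_spectrum hn hx).imp id fun h => hQ x h.1 h.2
  have hcfc : cfc Q.eval M = Polynomial.aeval M Q := cfc_polynomial Q M hsa
  have hherm : (Polynomial.aeval M Q).IsHermitian := by
    rw [← hcfc]; exact cfc_predicate _ _
  refine ⟨?_, fun v => ⟨fun hv => ?_, ?_⟩⟩
  · rw [hherm.posSemidef_iff_eigenvalues_nonneg]
    intro i
    have := hherm.eigenvalues_mem_spectrum_real i
    have hsp : spectrum ℝ (Polynomial.aeval M Q) = Q.eval '' spectrum ℝ M := by
      rw [← hcfc, cfc_map_spectrum (R := ℝ) _ M hsa (hcont _)]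
    rw [hsp] at this
    obtain ⟨x, hx, hxe⟩ := this
    rw [Pi.zero_apply, ← hxe]
    rcases hQs x hx with rfl | h
    · exact hQ0.ge
    · exact h.le
  · rw [← hM.null]
    have : M = cfc (fun x => x / Q.eval x) M * cfc Q.eval M := by
      rw [← cfc_mul _ _ M (hcont _) (hcont _)]
      conv_lhs => rw [← cfc_id' ℝ M hsa]
      refine cfc_congr fun x hx => ?_
      rcases hQs x hx with rfl | h
      · simp
      · exact (div_mul_cancel₀ x h.ne').symm
    rw [this, hcfc, ← Matrix.mulVec_mulVec, hv, Matrix.mulVec_zero]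
  · intro hv
    rw [← hM.null] at hv
    obtain ⟨q, rfl⟩ : Polynomial.X ∣ Q :=
      Polynomial.dvd_iff_isRoot.2 hQ0 |> fun h => by simpa using h
    rw [mul_comm, map_mul, Polynomial.aeval_X, ← Matrix.mulVec_mulVec, hv, Matrix.mulVec_zero]

lemma IsLaplacian.sigma_aeval_mem (hM : IsLaplacian M) (hn : 2 ≤ n) {Q : Polynomial ℝ} {lo hi : ℝ}
    (hlo : 0 < lo) (hQ0 : Q.eval 0 = 0)
    (hQ : ∀ x, sigma M (n - 1) ≤ x → x ≤ sigma M 1 → lo ≤ Q.eval x ∧ Q.eval x ≤ hi) :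
    lo ≤ sigma (Polynomial.aeval M Q) (n - 1) ∧ sigma (Polynomial.aeval M Q) 1 ≤ hi := by
  have hP := hM.aeval hn hQ0 fun x h1 h2 => hlo.trans_le (hQ x h1 h2).1
  have hsa : IsSelfAdjoint M := hM.posSemidef.1
  have key : ∀ k, k - 1 < n → 0 < sigma (Polynomial.aeval M Q) k →
      lo ≤ sigma (Polynomial.aeval M Q) k ∧ sigma (Polynomial.aeval M Q) k ≤ hi := by
    intro k hk hpos
    have := sigma_mem_spectrum hP.posSemidef.1 hk
    have h2 : spectrum ℝ (Polynomial.aeval M Q) = Q.eval '' spectrum ℝ M := by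
      rw [← cfc_polynomial Q M hsa]
      exact cfc_map_spectrum (R := ℝ) _ M hsa
        ((Matrix.finite_real_spectrum (A := M)).continuousOn _)
    rw [h2] at this
    obtain ⟨x, hx, hxe⟩ := this
    rw [← hxe] at hpos ⊢
    rcases hM.mem_spectrum hn hx with rfl | h
    · simp only [hQ0] at hpos; exact absurd hpos (lt_irrefl _)
    · exact hQ x h.1 h.2
  exact ⟨(key _ (by omega) (hP.sigma_pos hn)).1,
    (key 1 (by omega) ((hP.sigma_pos hn).trans_le (hP.sigma_le hn))).2⟩

end Spectral

/-! ### The Chebyshev gossip matrix -/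

/-- With `E = (1 + √ζ) / (1 - √ζ)`, one has `T_K((1 + ζ)/(1 - ζ)) = (E^K + E^{-K}) / 2`, and
`E^K ≥ (1 + 2/K)^K ≥ 3` because `√ζ > 1/(K + 1)`. -/
lemma chebyshev_eval_ge {z : ℝ} (hz : 0 < z) (hz1 : z < 1) :
    5 / 3 ≤ (Polynomial.Chebyshev.T ℝ (⌊1 / Real.sqrt z⌋₊ : ℤ)).eval ((1 + z) / (1 - z)) := by
  set s := Real.sqrt z with hs
  have hs0 : 0 < s := Real.sqrt_pos.2 hz
  have hss : s ^ 2 = z := Real.sq_sqrt hz.le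
  have hs1 : s < 1 := by nlinarith
  set K := ⌊1 / s⌋₊ with hK
  have hK1 : 1 ≤ K := Nat.le_floor (by rw [Nat.cast_one, le_div_iff₀ hs0]; linarith)
  have hK2 : 1 / s < K + 1 := Nat.lt_floor_add_one _
  set E := (1 + s) / (1 - s) with hE
  have hE0 : 0 < E := div_pos (by linarith) (by linarith)
  have hcosh : Real.cosh (Real.log E) = (1 + z) / (1 - z) := by
    rw [Real.cosh_log hE0, hE, ← hss]
    have h1 : 1 - s ≠ 0 := by linarith
    have h2 : 1 + s ≠ 0 := by linarith
    have h3 : 1 - s ^ 2 ≠ 0 := by nlinarith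
    field_simp
    ring
  have hKpos : (0 : ℝ) < K := by exact_mod_cast hK1
  have hE3 : 3 ≤ E ^ K := by
    have h1 : 1 + 2 / (K : ℝ) ≤ E := by
      rw [hE, le_div_iff₀ (by linarith)]
      rw [div_lt_iff₀ hs0] at hK2
      have : (1 + 2 / (K : ℝ)) * (1 - s) = (K + 2 - (K + 2) * s) / K := by field_simp
      rw [this, div_le_iff₀ hKpos]
      nlinarith
    have h0 : 0 < 2 / (K : ℝ) := by positivity
    have h2 := one_add_mul_le_pow (a := 2 / (K : ℝ)) (by linarith) K
    have h3 : (K : ℝ) * (2 / K) = 2 := by field_simp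
    rw [h3] at h2
    calc (3 : ℝ) = 1 + 2 := by norm_num
      _ ≤ _ := h2
      _ ≤ E ^ K := pow_le_pow_left₀ (by positivity) h1 K
  rw [← hcosh, Polynomial.Chebyshev.T_real_cosh]
  have h4 : ((K : ℤ) : ℝ) * Real.log E = Real.log (E ^ K) := by rw [Real.log_pow]; push_cast; ring
  rw [h4, Real.cosh_log (by positivity)]
  have h5 : 0 < E ^ K := by positivity
  have h6 : 5 / 3 = (3 + 3⁻¹ : ℝ) / 2 := by norm_num
  rw [h6]
  have h7 : (3 : ℝ) + 3⁻¹ ≤ E ^ K + (E ^ K)⁻¹ := by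
    have : E ^ K + (E ^ K)⁻¹ - (3 + 3⁻¹) = (E ^ K - 3) * (3 * E ^ K - 1) / (3 * E ^ K) := by
      field_simp; ring
    have h8 : 0 ≤ (E ^ K - 3) * (3 * E ^ K - 1) / (3 * E ^ K) := by
      apply div_nonneg _ (by positivity)
      apply mul_nonneg <;> linarith
    linarith
  linarith

/-- `P_K(U)` is a polynomial in `U` which vanishes at `0` and is within `3/5` of `1` on the nonzero
spectrum of `U`. -/
lemma exists_polynomial_chebGossip {n : ℕ} {U : Matrix (Fin n) (Fin n) ℝ} (hU : IsLaplacian U)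
    (hn : 2 ≤ n) : ∃ Q : Polynomial ℝ, chebGossip U = Polynomial.aeval U Q ∧ Q.eval 0 = 0 ∧
      ∀ x, sigma U (n - 1) ≤ x → x ≤ sigma U 1 → 2 / 5 ≤ Q.eval x ∧ Q.eval x ≤ 8 / 5 := by
  have hpos := hU.sigma_pos hn
  have hle := hU.sigma_le hn
  have hz0 := hU.zeta_pos hn
  have hz1 := hU.zeta_le_one hn
  have hs1 : 0 < sigma U 1 := hpos.trans_le hle
  have hz : sigma U (n - 1) = zeta U * sigma U 1 := by
    rw [zeta, div_mul_cancel₀ _ hs1.ne']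
  by_cases h1 : zeta U = 1
  · refine ⟨Polynomial.C (cheb3 U) * Polynomial.X, ?_, by simp, fun x hx hx' => ?_⟩
    · simp [chebGossip, h1, Algebra.smul_def]
    · have : x = sigma U 1 := by rw [hz, h1, one_mul] at hx; exact le_antisymm hx' hx
      have : Polynomial.eval x (Polynomial.C (cheb3 U) * Polynomial.X) = 1 := by
        simp [cheb3, h1, this]; field_simp; norm_num
      rw [this]; norm_num
  · have hz1' : zeta U < 1 := lt_of_le_of_ne hz1 h1
    set T := Polynomial.Chebyshev.T ℝ (chebDegree U : ℤ) with hT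
    set t := T.eval (cheb2 U) with ht
    have ht53 : 5 / 3 ≤ t := chebyshev_eval_ge hz0 hz1'
    have h1z : 0 < 1 - zeta U := by linarith
    refine ⟨1 - Polynomial.C t⁻¹ * T.comp (Polynomial.C (cheb2 U) *
      (1 - Polynomial.C (cheb3 U) * Polynomial.X)), ?_, ?_, fun x hx hx' => ?_⟩
    · simp [chebGossip, h1, Polynomial.aeval_comp, Algebra.smul_def, ← hT, ← ht]
    · simp [← ht, inv_mul_cancel₀ (show t ≠ 0 by linarith)]
    · simp only [Polynomial.eval_sub, Polynomial.eval_one, Polynomial.eval_mul, Polynomial.eval_C,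
        Polynomial.eval_comp, Polynomial.eval_X]
      have habs : |cheb2 U * (1 - cheb3 U * x)| ≤ 1 := by
        have : cheb2 U * (1 - cheb3 U * x)
            = (1 + zeta U - 2 * (x / sigma U 1)) / (1 - zeta U) := by
          rw [cheb2, cheb3]
          have : 1 + zeta U ≠ 0 := by linarith
          field_simp
        have hx1 : x / sigma U 1 ≤ 1 := (div_le_one hs1).2 hx'
        have hx2 : zeta U ≤ x / sigma U 1 := by rw [le_div_iff₀ hs1, ← hz]; exact hx
        rw [this, abs_le, le_div_iff₀ h1z, div_le_iff₀ h1z]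
        constructor <;> linarith
      have hb := abs_le.1 (Polynomial.Chebyshev.abs_eval_T_real_le_one (chebDegree U : ℤ) habs)
      have ht0 : t⁻¹ ≤ 3 / 5 := by
        rw [inv_le_comm₀ (by linarith) (by norm_num)]; norm_num; exact ht53
      have ht1 : 0 < t⁻¹ := inv_pos.2 (by linarith)
      constructor <;> nlinarith [hb.1, hb.2]

lemma isLaplacian_chebGossip {n : ℕ} {U : Matrix (Fin n) (Fin n) ℝ} (hU : IsLaplacian U)
    (hn : 2 ≤ n) : IsLaplacian (chebGossip U) := by
  obtain ⟨Q, hQ, h0, hb⟩ := exists_polynomial_chebGossip hU hn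
  rw [hQ]
  exact hU.aeval hn h0 fun x h1 h2 => lt_of_lt_of_le (by norm_num) (hb x h1 h2).1

lemma zeta_chebGossip {n : ℕ} {U : Matrix (Fin n) (Fin n) ℝ} (hU : IsLaplacian U)
    (hn : 2 ≤ n) : 1 / 4 ≤ zeta (chebGossip U) := by
  have hP := isLaplacian_chebGossip hU hn
  obtain ⟨Q, hQ, h0, hb⟩ := exists_polynomial_chebGossip hU hn
  have := hU.sigma_aeval_mem hn (by norm_num) h0 hb
  rw [← hQ] at this
  rw [zeta, le_div_iff₀ ((hP.sigma_pos hn).trans_le (hP.sigma_le hn))]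
  linarith [this.1, this.2]

/-! ### The square root of a positive semidefinite matrix -/

section Sqrt

variable {n : ℕ} {M : Matrix (Fin n) (Fin n) ℝ}

lemma msqrt_transpose (M : Matrix (Fin n) (Fin n) ℝ) : (msqrt M)ᵀ = msqrt M := by
  have : IsSelfAdjoint (msqrt M) := cfc_predicate _ _
  rw [← conjTranspose_eq_transpose_of_trivial]; exact this

lemma msqrt_mul_msqrt (h : M.PosSemidef) : msqrt M * msqrt M = M := by
  have hcont : ∀ f : ℝ → ℝ, ContinuousOn f (spectrum ℝ M) := fun f =>
    (Matrix.finite_real_spectrum (A := M)).continuousOn f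
  have hsa : IsSelfAdjoint M := h.1
  rw [msqrt, ← cfc_mul _ _ M (hcont _) (hcont _)]
  conv_rhs => rw [← cfc_id' ℝ M hsa]
  refine cfc_congr fun x hx => ?_
  rw [h.1.spectrum_real_eq_range_eigenvalues] at hx
  obtain ⟨i, rfl⟩ := hx
  exact Real.mul_self_sqrt (h.eigenvalues_nonneg i)

lemma msqrt_mulVec_dotProduct (h : M.PosSemidef) (v : Fin n → ℝ) :
    (msqrt M *ᵥ v) ⬝ᵥ (msqrt M *ᵥ v) = v ⬝ᵥ (M *ᵥ v) := by
  conv_rhs => rw [← msqrt_mul_msqrt h, ← mulVec_mulVec, dotProduct_mulVec, ← mulVec_transpose,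
    msqrt_transpose]

lemma msqrt_mulVec_eq_zero_iff (h : M.PosSemidef) (v : Fin n → ℝ) :
    msqrt M *ᵥ v = 0 ↔ M *ᵥ v = 0 := by
  constructor
  · intro hv
    rw [← msqrt_mul_msqrt h, ← mulVec_mulVec, hv, mulVec_zero]
  · intro hv
    have := msqrt_mulVec_dotProduct h v
    rw [hv, dotProduct_zero] at this
    exact dotProduct_self_eq_zero.1 this

lemma frobNorm_msqrt_sq (h : M.PosSemidef) : frobNorm (msqrt M) ^ 2 = M.trace := by
  rw [frobNorm, Real.sq_sqrt (by positivity)]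
  conv_rhs => rw [← msqrt_mul_msqrt h]
  rw [Matrix.trace]
  refine Finset.sum_congr rfl fun i _ => ?_
  rw [Matrix.diag_apply, Matrix.mul_apply]
  refine Finset.sum_congr rfl fun j _ => ?_
  have := congrFun (congrFun (msqrt_transpose M) i) j
  rw [transpose_apply] at this
  rw [this, sq]

lemma sigma_one_le_trace (h : M.PosSemidef) (hn : 1 ≤ n) : sigma M 1 ≤ M.trace := by
  obtain ⟨i, hi⟩ := exists_sigma_eq h.1 (k := 1) (by omega)
  rw [hi, h.1.trace_eq_sum_eigenvalues]
  exact Finset.single_le_sum (f := h.1.eigenvalues) (fun j _ => h.eigenvalues_nonneg j)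
    (Finset.mem_univ i)

/-- Vectors whose entries sum to zero lie in the range of the square root of a Laplacian, since that
range is the orthogonal complement of the null space. -/
lemma IsLaplacian.exists_msqrt_mulVec (hM : IsLaplacian M) {v : Fin n → ℝ} (hv : ∑ i, v i = 0) :
    ∃ u, msqrt M *ᵥ u = v := by
  have hherm : (msqrt M).IsHermitian := by
    rw [Matrix.IsHermitian, conjTranspose_eq_transpose_of_trivial, msqrt_transpose]
  have hsym := Matrix.isSymmetric_toEuclideanLin_iff.2 hherm
  have hmem : WithLp.toLp 2 v ∈ LinearMap.range (Matrix.toEuclideanLin (msqrt M)) := by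
    rw [← Submodule.orthogonal_orthogonal (LinearMap.range _), hsym.orthogonal_range,
      Submodule.mem_orthogonal]
    intro u hu
    rw [LinearMap.mem_ker, Matrix.toLpLin_apply] at hu
    have hu' : msqrt M *ᵥ u.ofLp = 0 := by simpa using congrArg WithLp.ofLp hu
    rw [msqrt_mulVec_eq_zero_iff hM.posSemidef, hM.null] at hu'
    obtain ⟨a, ha⟩ := hu'
    rw [EuclideanSpace.inner_eq_star_dotProduct]
    simp [ha, dotProduct, ← Finset.sum_mul, hv]
  obtain ⟨u, hu⟩ := hmem
  refine ⟨u.ofLp, ?_⟩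
  rw [Matrix.toLpLin_apply] at hu
  simpa using congrArg WithLp.ofLp hu

end Sqrt

/-! ### Convex conjugates of smooth strongly convex functions -/

section Conj

variable {d : ℕ} {φ : Vec d → ℝ} {L μ : ℝ}

lemma le_of_isLSmooth_of_isStronglyConvex (hd : 1 ≤ d) (hs : IsLSmooth φ L)
    (hc : IsStronglyConvex φ μ) : μ ≤ L := by
  obtain ⟨v, hv⟩ : ∃ v : Vec d, ‖v‖ = 1 :=
    ⟨EuclideanSpace.single ⟨0, hd⟩ (1 : ℝ), by simp⟩
  have h1 := hs.2 0 v
  have h2 := hc 0 v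
  simp only [sub_zero, hv] at h1 h2
  linarith

/-- A linear-plus-quadratic lower bound dominates any constant far away from the origin. -/
lemma eventually_le_of_quadratic_lower_bound {E : Type*} [NormedAddCommGroup E]
    [InnerProductSpace ℝ E] [ProperSpace E] {ψ : E → ℝ} {μ : ℝ} (hμ : 0 < μ) (a : ℝ) (v : E)
    (h : ∀ x, a + inner ℝ v x + μ / 2 * ‖x‖ ^ 2 ≤ ψ x) :
    ∀ᶠ x in Filter.cocompact E, a ≤ ψ x := by
  filter_upwards [(tendsto_norm_cocompact_atTop (E := E)).eventually_ge_atTop (2 * ‖v‖ / μ)]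
    with x hx
  have h1 := abs_le.1 (abs_real_inner_le_norm v x)
  rw [div_le_iff₀ hμ] at hx
  nlinarith [h x, norm_nonneg x, h1.1]

/-- The gradient of a strongly convex function is onto: `φ - ⟨y, ·⟩` has a minimizer. -/
lemma exists_gradient_eq (hμ : 0 < μ) (hs : Differentiable ℝ φ) (hc : IsStronglyConvex φ μ)
    (y : Vec d) : ∃ x, gradient φ x = y := by
  have hcont : Continuous fun x => φ x - inner ℝ y x := hs.continuous.sub (by fun_prop)
  obtain ⟨x, hx⟩ := hcont.exists_forall_le' 0
    (eventually_le_of_quadratic_lower_bound hμ (φ 0 - inner ℝ y 0) (gradient φ 0 - y) fun x => by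
      have := hc 0 x
      simp only [sub_zero, inner_zero_right, inner_sub_left] at this ⊢
      linarith)
  refine ⟨x, ?_⟩
  have hd : HasGradientAt (fun x => φ x - inner ℝ y x) (gradient φ x - y) x := by
    rw [hasGradientAt_iff_hasFDerivAt, map_sub]
    exact (hs x).hasGradientAt.hasFDerivAt.sub ((InnerProductSpace.toDual ℝ (Vec d) y).hasFDerivAt)
  have hmin : IsLocalMin (fun x => φ x - inner ℝ y x) x := Filter.Eventually.of_forall hx
  have := hmin.hasFDerivAt_eq_zero hd.hasFDerivAt
  rw [map_eq_zero_iff _ (InnerProductSpace.toDual ℝ (Vec d)).injective] at this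
  exact sub_eq_zero.1 this

lemma inner_sub_le_of_isStronglyConvex (hμ : 0 < μ) (hc : IsStronglyConvex φ μ)
    (x y' : Vec d) :
    ∀ x', inner ℝ y' x' - φ x' ≤ inner ℝ y' x - φ x + 1 / (2 * μ) * ‖y' - gradient φ x‖ ^ 2 := by
  intro x'
  have h1 := hc x x'
  -- complete the square
  have h2 : 0 ≤ μ / 2 * ‖(x' - x) - μ⁻¹ • (y' - gradient φ x)‖ ^ 2 := by positivity
  rw [norm_sub_sq_real, norm_smul, mul_pow, Real.norm_eq_abs, sq_abs, inner_smul_right] at h2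
  have h3 : inner ℝ (x' - x) (y' - gradient φ x)
      = inner ℝ y' x' - inner ℝ y' x - inner ℝ (gradient φ x) (x' - x) := by
    rw [inner_sub_right, inner_sub_left, real_inner_comm y' x', real_inner_comm y' x,
      real_inner_comm (gradient φ x)]
  rw [h3] at h2
  have h4 : μ / 2 * (‖x' - x‖ ^ 2 - 2 * (μ⁻¹ * (inner ℝ y' x' - inner ℝ y' x
      - inner ℝ (gradient φ x) (x' - x))) + μ⁻¹ ^ 2 * ‖y' - gradient φ x‖ ^ 2)
      = μ / 2 * ‖x' - x‖ ^ 2 - (inner ℝ y' x' - inner ℝ y' x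
      - inner ℝ (gradient φ x) (x' - x)) + 1 / (2 * μ) * ‖y' - gradient φ x‖ ^ 2 := by
    field_simp
  linarith

lemma conj_le (hμ : 0 < μ) (hc : IsStronglyConvex φ μ) (x y' : Vec d) :
    conj φ y' ≤ inner ℝ y' x - φ x + 1 / (2 * μ) * ‖y' - gradient φ x‖ ^ 2 :=
  ciSup_le (inner_sub_le_of_isStronglyConvex hμ hc x y')

lemma le_conj (hμ : 0 < μ) (hc : IsStronglyConvex φ μ) (x y : Vec d) :
    inner ℝ y x - φ x ≤ conj φ y :=
  le_ciSup (f := fun x => inner ℝ y x - φ x)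
    ⟨_, Set.forall_mem_range.2 (inner_sub_le_of_isStronglyConvex hμ hc 0 y)⟩ x

lemma conj_gradient_eq (hμ : 0 < μ) (hc : IsStronglyConvex φ μ) (x : Vec d) :
    conj φ (gradient φ x) = inner ℝ (gradient φ x) x - φ x :=
  le_antisymm (by simpa using conj_le hμ hc x (gradient φ x)) (le_conj hμ hc x _)

/-- The conjugate of a `μ`-strongly convex function is `1/μ`-smooth. -/
lemma conj_upper (hμ : 0 < μ) (hc : IsStronglyConvex φ μ) (x y' : Vec d) :
    conj φ y' ≤ conj φ (gradient φ x) + inner ℝ x (y' - gradient φ x)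
      + 1 / (2 * μ) * ‖y' - gradient φ x‖ ^ 2 := by
  rw [conj_gradient_eq hμ hc, inner_sub_right, real_inner_comm y' x,
    real_inner_comm (gradient φ x) x]
  linarith [conj_le hμ hc x y']

/-- The conjugate of an `L`-smooth function is `1/L`-strongly convex. -/
lemma conj_lower (hμ : 0 < μ) (hL : 0 < L) (hs : IsLSmooth φ L) (hc : IsStronglyConvex φ μ)
    (x y' : Vec d) : conj φ (gradient φ x) + inner ℝ x (y' - gradient φ x)
      + 1 / (2 * L) * ‖y' - gradient φ x‖ ^ 2 ≤ conj φ y' := by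
  -- evaluate the supremum at the gradient step `x + (y' - ∇φ x) / L`
  have h1 := le_conj hμ hc (x + L⁻¹ • (y' - gradient φ x)) y'
  have h2 := hs.2 x (x + L⁻¹ • (y' - gradient φ x))
  rw [add_sub_cancel_left, norm_smul, mul_pow, inner_smul_right, Real.norm_eq_abs, sq_abs] at h2
  rw [inner_add_right, inner_smul_right] at h1
  rw [conj_gradient_eq hμ hc]
  set δ := y' - gradient φ x with hδ
  have h3 : inner ℝ y' δ - inner ℝ (gradient φ x) δ = ‖δ‖ ^ 2 := by
    rw [← inner_sub_left, ← hδ, real_inner_self_eq_norm_sq]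
  have h4 : inner ℝ x δ = inner ℝ y' x - inner ℝ (gradient φ x) x := by
    rw [hδ, inner_sub_right, real_inner_comm x, real_inner_comm x]
  have h5 : L⁻¹ * inner ℝ y' δ - L⁻¹ * inner ℝ (gradient φ x) δ = L⁻¹ * ‖δ‖ ^ 2 := by
    rw [← mul_sub, h3]
  have h6 : L⁻¹ * ‖δ‖ ^ 2 - L / 2 * (L⁻¹ ^ 2 * ‖δ‖ ^ 2) = 1 / (2 * L) * ‖δ‖ ^ 2 := by
    field_simp; ring
  linarith

lemma gradient_lipschitz_inv (hμ : 0 < μ) (hc : IsStronglyConvex φ μ) (x x' : Vec d) :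
    ‖x - x'‖ ≤ ‖gradient φ x - gradient φ x'‖ / μ := by
  have h1 := hc x x'
  have h2 := hc x' x
  have h3 : inner ℝ (gradient φ x) (x' - x) = - inner ℝ (gradient φ x) (x - x') := by
    rw [← inner_neg_right, neg_sub]
  have h5 : inner ℝ (gradient φ x - gradient φ x') (x - x')
      = inner ℝ (gradient φ x) (x - x') - inner ℝ (gradient φ x') (x - x') := inner_sub_left _ _ _
  have h4 := real_inner_le_norm (gradient φ x - gradient φ x') (x - x')
  rw [norm_sub_rev x' x] at h1
  rw [le_div_iff₀ hμ]
  rcases (norm_nonneg (x - x')).eq_or_lt with h0 | h0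
  · rw [← h0, zero_mul]; exact norm_nonneg _
  · have : (‖x - x'‖ * μ) * ‖x - x'‖ ≤ ‖gradient φ x - gradient φ x'‖ * ‖x - x'‖ := by nlinarith
    exact le_of_mul_le_mul_right this h0

lemma hasGradientAt_conj (hμ : 0 < μ) (hL : 0 < L) (hs : IsLSmooth φ L)
    (hc : IsStronglyConvex φ μ) (x : Vec d) : HasGradientAt (conj φ) x (gradient φ x) := by
  rw [hasGradientAt_iff_isLittleO]
  refine Asymptotics.IsBigO.trans_isLittleO (g := fun y' => ‖y' - gradient φ x‖ ^ 2) ?_ ?_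
  · refine Asymptotics.IsBigO.of_bound (1 / (2 * μ)) (Filter.Eventually.of_forall fun y' => ?_)
    have h1 := conj_upper hμ hc x y'
    have h2 := conj_lower hμ hL hs hc x y'
    have h3 : 0 ≤ 1 / (2 * L) * ‖y' - gradient φ x‖ ^ 2 := by positivity
    rw [Real.norm_eq_abs, Real.norm_eq_abs, abs_of_nonneg (sq_nonneg ‖y' - gradient φ x‖), abs_le]
    have h4 : 0 ≤ 1 / (2 * μ) * ‖y' - gradient φ x‖ ^ 2 := by positivity
    constructor <;> linarith
  · have h1 : Filter.Tendsto (fun y' => y' - gradient φ x) (nhds (gradient φ x)) (nhds 0) := by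
      rw [← sub_self (gradient φ x)]
      exact (continuous_id.sub continuous_const).tendsto _
    exact ((Asymptotics.isLittleO_norm_pow_id one_lt_two).comp_tendsto h1)

/-- The gradient of the conjugate inverts the gradient of the function. -/
lemma gradient_gradient_conj (hμ : 0 < μ) (hL : 0 < L) (hs : IsLSmooth φ L)
    (hc : IsStronglyConvex φ μ) (y : Vec d) : gradient φ (gradient (conj φ) y) = y := by
  obtain ⟨x, rfl⟩ := exists_gradient_eq hμ hs.1 hc y
  rw [(hasGradientAt_conj hμ hL hs hc x).gradient]

end Conj

/-! ### The objective and its conjugate -/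

section Cols

variable {n d : ℕ}

/-- The squared Frobenius norm of a matrix given by its columns. -/
noncomputable def sqn (X : Cols n d) : ℝ := ∑ i, ‖X i‖ ^ 2

/-- The Frobenius inner product of matrices given by their columns. -/
noncomputable def ip (X Y : Cols n d) : ℝ := ∑ i, inner ℝ (X i) (Y i)

lemma sqn_nonneg (X : Cols n d) : 0 ≤ sqn X := Finset.sum_nonneg fun _ _ => sq_nonneg _

end Cols

namespace Data

variable {n m d : ℕ} {p : Data n m d}

lemma hasGradientAt_fLocal (hf : p.SmoothStronglyConvex) (i : Fin n) (θ : Vec d) :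
    HasGradientAt (p.fLocal i) ((1 / m : ℝ) • ∑ j, gradient (p.f i j) θ) θ := by
  rw [hasGradientAt_iff_hasFDerivAt, map_smul, map_sum]
  have h : HasFDerivAt (fun θ => ∑ j, p.f i j θ)
      (∑ j, InnerProductSpace.toDual ℝ (Vec d) (gradient (p.f i j) θ)) θ :=
    HasFDerivAt.fun_sum fun j _ => (((hf i).2 j).1.1 θ).hasGradientAt.hasFDerivAt
  exact h.const_mul (1 / m : ℝ)

lemma gradient_fLocal (hf : p.SmoothStronglyConvex) (i : Fin n) (θ : Vec d) :
    gradient (p.fLocal i) θ = (1 / m : ℝ) • ∑ j, gradient (p.f i j) θ :=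
  (hasGradientAt_fLocal hf i θ).gradient

lemma avg_const (hm : 1 ≤ m) (a : ℝ) : (1 / m : ℝ) * ∑ _j : Fin m, a = a := by
  have : (m : ℝ) ≠ 0 := by positivity
  simp; field_simp

lemma isLSmooth_fLocal (hm : 1 ≤ m) (hf : p.SmoothStronglyConvex) (i : Fin n) :
    IsLSmooth (p.fLocal i) (p.L i) := by
  refine ⟨fun θ => (hasGradientAt_fLocal hf i θ).differentiableAt, fun x y => ?_⟩
  rw [gradient_fLocal hf, real_inner_smul_left, sum_inner]
  conv_rhs => rw [← avg_const hm (p.L i / 2 * ‖y - x‖ ^ 2)]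
  rw [fLocal, fLocal, ← mul_add, ← mul_add, ← Finset.sum_add_distrib, ← Finset.sum_add_distrib]
  exact mul_le_mul_of_nonneg_left (Finset.sum_le_sum fun j _ => ((hf i).2 j).1.2 x y)
    (by positivity)

lemma isStronglyConvex_fLocal (hm : 1 ≤ m) (hf : p.SmoothStronglyConvex) (i : Fin n) :
    IsStronglyConvex (p.fLocal i) (p.μ i) := by
  intro x y
  rw [gradient_fLocal hf, real_inner_smul_left, sum_inner]
  conv_lhs => rw [← avg_const hm (p.μ i / 2 * ‖y - x‖ ^ 2)]
  rw [fLocal, fLocal, ← mul_add, ← mul_add, ← Finset.sum_add_distrib, ← Finset.sum_add_distrib]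
  exact mul_le_mul_of_nonneg_left (Finset.sum_le_sum fun j _ => ((hf i).2 j).2 x y)
    (by positivity)

lemma mu_le_L (hm : 1 ≤ m) (hd : 1 ≤ d) (hf : p.SmoothStronglyConvex) (i : Fin n) :
    p.μ i ≤ p.L i :=
  le_of_isLSmooth_of_isStronglyConvex hd (isLSmooth_fLocal hm hf i)
    (isStronglyConvex_fLocal hm hf i)

lemma muMin_le (p : Data n m d) (i : Fin n) : p.muMin ≤ p.μ i :=
  ciInf_le (Set.finite_range _).bddBelow i

lemma le_Lmax (p : Data n m d) (i : Fin n) : p.L i ≤ p.Lmax :=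
  le_ciSup (f := p.L) (Set.finite_range _).bddAbove i

lemma le_kappaMax (p : Data n m d) (i : Fin n) : p.L i / p.μ i ≤ p.kappaMax :=
  le_ciSup (f := fun i => p.L i / p.μ i) (Set.finite_range _).bddAbove i

lemma muMin_pos (hn : 2 ≤ n) (hf : p.SmoothStronglyConvex) : 0 < p.muMin := by
  have : Nonempty (Fin n) := ⟨⟨0, by omega⟩⟩
  obtain ⟨i, hi⟩ := exists_eq_ciInf_of_finite (f := p.μ)
  rw [muMin, ← hi]; exact (hf i).1

lemma muMin_le_Lmax (hn : 2 ≤ n) (hm : 1 ≤ m) (hd : 1 ≤ d) (hf : p.SmoothStronglyConvex) :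
    p.muMin ≤ p.Lmax :=
  ((p.muMin_le ⟨0, by omega⟩).trans (mu_le_L hm hd hf _)).trans (p.le_Lmax _)

lemma one_le_kappaMax (hn : 2 ≤ n) (hm : 1 ≤ m) (hd : 1 ≤ d) (hf : p.SmoothStronglyConvex) :
    1 ≤ p.kappaMax :=
  ((one_le_div (hf ⟨0, by omega⟩).1).2 (mu_le_L hm hd hf _)).trans (p.le_kappaMax _)

lemma L_pos (hm : 1 ≤ m) (hd : 1 ≤ d) (hf : p.SmoothStronglyConvex) (i : Fin n) : 0 < p.L i :=
  (hf i).1.trans_le (mu_le_L hm hd hf i)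

/-- `∇F^*(Y)`, by columns; the matrix of the minimizers of `f_i - ⟨·, Y_i⟩`. -/
noncomputable def gradConj (p : Data n m d) (Y : Cols n d) : Cols n d :=
  fun i => gradient (conj (p.fLocal i)) (Y i)

lemma gradient_fLocal_gradConj (hm : 1 ≤ m) (hd : 1 ≤ d) (hf : p.SmoothStronglyConvex)
    (Y : Cols n d) (i : Fin n) : gradient (p.fLocal i) (p.gradConj Y i) = Y i :=
  gradient_gradient_conj (hf i).1 (L_pos hm hd hf i) (isLSmooth_fLocal hm hf i)
    (isStronglyConvex_fLocal hm hf i) (Y i)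

lemma conjCols_F (hm : 1 ≤ m) (hd : 1 ≤ d) (hf : p.SmoothStronglyConvex) (Y : Cols n d) :
    conjCols p.F Y = ∑ i, conj (p.fLocal i) (Y i) := by
  have hle : ∀ X : Cols n d, (∑ i, inner ℝ (Y i) (X i)) - p.F X ≤ ∑ i, conj (p.fLocal i) (Y i) := by
    intro X
    rw [F, ← Finset.sum_sub_distrib]
    exact Finset.sum_le_sum fun i _ => le_conj (hf i).1 (isStronglyConvex_fLocal hm hf i) _ _
  refine le_antisymm (ciSup_le hle) ?_
  refine le_trans (le_of_eq ?_) (le_ciSup (f := fun X => (∑ i, inner ℝ (Y i) (X i)) - p.F X)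
    ⟨_, Set.forall_mem_range.2 hle⟩ (p.gradConj Y))
  simp only [F, ← Finset.sum_sub_distrib]
  refine Finset.sum_congr rfl fun i _ => ?_
  have := conj_gradient_eq (hf i).1 (isStronglyConvex_fLocal hm hf i) (p.gradConj Y i)
  rwa [gradient_fLocal_gradConj hm hd hf] at this

lemma conjCols_upper (hn : 2 ≤ n) (hm : 1 ≤ m) (hd : 1 ≤ d) (hf : p.SmoothStronglyConvex)
    (Y Y' : Cols n d) : conjCols p.F Y' ≤ conjCols p.F Y + ip (p.gradConj Y) (Y' - Y)
      + 1 / (2 * p.muMin) * sqn (Y' - Y) := by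
  rw [conjCols_F hm hd hf, conjCols_F hm hd hf, ip, sqn, Finset.mul_sum, ← Finset.sum_add_distrib,
    ← Finset.sum_add_distrib]
  refine Finset.sum_le_sum fun i _ => ?_
  have := conj_upper (hf i).1 (isStronglyConvex_fLocal hm hf i) (p.gradConj Y i) (Y' i)
  rw [gradient_fLocal_gradConj hm hd hf] at this
  have h2 : 1 / (2 * p.μ i) ≤ 1 / (2 * p.muMin) := by
    have := muMin_pos hn hf
    have := p.muMin_le i
    gcongr
  have h3 := mul_le_mul_of_nonneg_right h2 (sq_nonneg ‖Y' i - Y i‖)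
  simp only [Pi.sub_apply]
  linarith

lemma conjCols_lower (hm : 1 ≤ m) (hd : 1 ≤ d) (hf : p.SmoothStronglyConvex)
    (Y Y' : Cols n d) : conjCols p.F Y + ip (p.gradConj Y) (Y' - Y)
      + 1 / (2 * p.Lmax) * sqn (Y' - Y) ≤ conjCols p.F Y' := by
  rw [conjCols_F hm hd hf, conjCols_F hm hd hf, ip, sqn, Finset.mul_sum, ← Finset.sum_add_distrib,
    ← Finset.sum_add_distrib]
  refine Finset.sum_le_sum fun i _ => ?_
  have := conj_lower (hf i).1 (L_pos hm hd hf i) (isLSmooth_fLocal hm hf i)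
    (isStronglyConvex_fLocal hm hf i) (p.gradConj Y i) (Y' i)
  rw [gradient_fLocal_gradConj hm hd hf] at this
  have h2 : 1 / (2 * p.Lmax) ≤ 1 / (2 * p.L i) := by
    have := L_pos hm hd hf i
    have := p.le_Lmax i
    gcongr
  have h3 := mul_le_mul_of_nonneg_right h2 (sq_nonneg ‖Y' i - Y i‖)
  simp only [Pi.sub_apply]
  linarith

lemma norm_gradConj_sub_le (hn : 2 ≤ n) (hm : 1 ≤ m) (hd : 1 ≤ d) (hf : p.SmoothStronglyConvex)
    (Y Y' : Cols n d) (i : Fin n) :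
    ‖p.gradConj Y i - p.gradConj Y' i‖ ≤ ‖Y i - Y' i‖ / p.muMin := by
  have := gradient_lipschitz_inv (hf i).1 (isStronglyConvex_fLocal hm hf i) (p.gradConj Y i)
    (p.gradConj Y' i)
  rw [gradient_fLocal_gradConj hm hd hf, gradient_fLocal_gradConj hm hd hf] at this
  exact this.trans (div_le_div_of_nonneg_left (norm_nonneg _) (muMin_pos hn hf) (p.muMin_le i))

end Data

/-! ### One inner step of Katyusha -/

section Avg

variable {m : ℕ}

/-- The mean of finitely many real numbers. -/
noncomputable def avg (X : Fin m → ℝ) : ℝ := (1 / m : ℝ) * ∑ j, X j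

lemma avg_add (X Y : Fin m → ℝ) : avg (fun j => X j + Y j) = avg X + avg Y := by
  simp only [avg, Finset.sum_add_distrib, mul_add]

lemma avg_sub (X Y : Fin m → ℝ) : avg (fun j => X j - Y j) = avg X - avg Y := by
  simp only [avg, Finset.sum_sub_distrib, mul_sub]

lemma avg_const_mul (a : ℝ) (X : Fin m → ℝ) : avg (fun j => a * X j) = a * avg X := by
  simp only [avg, ← Finset.mul_sum]; ring

lemma avg_const' (hm : 1 ≤ m) (a : ℝ) : avg (fun _ : Fin m => a) = a := Data.avg_const hm a

lemma avg_mono {X Y : Fin m → ℝ} (h : ∀ j, X j ≤ Y j) : avg X ≤ avg Y :=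
  mul_le_mul_of_nonneg_left (Finset.sum_le_sum fun j _ => h j) (by positivity)

lemma avg_inner {E : Type*} [NormedAddCommGroup E] [InnerProductSpace ℝ E] (v : Fin m → E) (x : E) :
    avg (fun j => inner ℝ (v j) x) = inner ℝ ((1 / m : ℝ) • ∑ j, v j) x := by
  rw [avg, real_inner_smul_left, sum_inner]

/-- The variance is at most the second moment. -/
lemma avg_norm_sub_mean_sq_le {E : Type*} [NormedAddCommGroup E] [InnerProductSpace ℝ E]
    (hm : 1 ≤ m) (v : Fin m → E) :
    avg (fun j => ‖v j - (1 / m : ℝ) • ∑ i, v i‖ ^ 2) ≤ avg fun j => ‖v j‖ ^ 2 := by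
  set c := (1 / m : ℝ) • ∑ i, v i with hc
  have h : (fun j => ‖v j - c‖ ^ 2) = fun j => ‖v j‖ ^ 2 - 2 * inner ℝ (v j) c + ‖c‖ ^ 2 := by
    funext j; exact norm_sub_sq_real _ _
  rw [h, avg_add, avg_sub, avg_const_mul, avg_inner, avg_const' hm, ← hc,
    real_inner_self_eq_norm_sq]
  nlinarith [sq_nonneg ‖c‖]

end Avg

section KatyushaStep

variable {d m : ℕ}

/-- `h_j = f_j - (μ/2)‖·‖²`, the convex part of the `j`-th summand. -/
noncomputable def katyushaPart (f : Fin m → Vec d → ℝ) (μ : ℝ) (j : Fin m) (θ : Vec d) : ℝ :=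
  f j θ - μ / 2 * ‖θ‖ ^ 2

/-- The objective `(1/m) ∑_j f_j(θ) - ⟨p, θ⟩` of a Katyusha call. -/
noncomputable def katyushaObj (f : Fin m → Vec d → ℝ) (p θ : Vec d) : ℝ :=
  avg (fun j => f j θ) - inner ℝ p θ

/-- `(1/m) ∑_j ∇h_j(θ)`. -/
noncomputable def katyushaFull (f : Fin m → Vec d → ℝ) (μ : ℝ) (θ : Vec d) : Vec d :=
  (1 / m : ℝ) • ∑ j, katyushaGrad f μ j θ

variable {f : Fin m → Vec d → ℝ} {L μ : ℝ}

lemma norm_sq_expand {E : Type*} [NormedAddCommGroup E] [InnerProductSpace ℝ E] (x y : E) :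
    ‖y‖ ^ 2 = ‖x‖ ^ 2 + 2 * inner ℝ x (y - x) + ‖y - x‖ ^ 2 := by
  have := norm_add_sq_real x (y - x)
  rwa [add_sub_cancel] at this

lemma katyushaPart_lower (hc : ∀ j, IsStronglyConvex (f j) μ) (j : Fin m) (x y : Vec d) :
    katyushaPart f μ j x + inner ℝ (katyushaGrad f μ j x) (y - x) ≤ katyushaPart f μ j y := by
  have h1 := hc j x y
  rw [katyushaPart, katyushaPart, katyushaGrad, inner_sub_left, real_inner_smul_left,
    norm_sq_expand x y]
  linarith

lemma katyushaPart_upper (hμ : 0 ≤ μ) (hs : ∀ j, IsLSmooth (f j) L) (j : Fin m) (x y : Vec d) :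
    katyushaPart f μ j y ≤ katyushaPart f μ j x + inner ℝ (katyushaGrad f μ j x) (y - x)
      + L / 2 * ‖y - x‖ ^ 2 := by
  have h1 := (hs j).2 x y
  rw [katyushaPart, katyushaPart, katyushaGrad, inner_sub_left, real_inner_smul_left,
    norm_sq_expand x y]
  have : 0 ≤ μ / 2 * ‖y - x‖ ^ 2 := by positivity
  linarith

/-- Cocoercivity: the gradient gap is controlled by the Bregman distance. -/
lemma katyushaGrad_cocoercive (hμ : 0 ≤ μ) (hL : 0 < L) (hs : ∀ j, IsLSmooth (f j) L)
    (hc : ∀ j, IsStronglyConvex (f j) μ) (j : Fin m) (x w : Vec d) :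
    ‖katyushaGrad f μ j x - katyushaGrad f μ j w‖ ^ 2 ≤ 2 * L * (katyushaPart f μ j w
      - katyushaPart f μ j x - inner ℝ (katyushaGrad f μ j x) (w - x)) := by
  set δ := katyushaGrad f μ j x - katyushaGrad f μ j w with hδ
  -- compare at the gradient step `w + δ / L` for `h_j - ⟨∇h_j(x), ·⟩`, which is minimal at `x`
  have h1 := katyushaPart_lower hc j x (w + L⁻¹ • δ)
  have h2 := katyushaPart_upper hμ hs j w (w + L⁻¹ • δ)
  rw [add_sub_cancel_left, norm_smul, mul_pow, Real.norm_eq_abs, sq_abs, inner_smul_right] at h2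
  rw [show w + L⁻¹ • δ - x = (w - x) + L⁻¹ • δ by abel, inner_add_right, inner_smul_right] at h1
  have h3 : inner ℝ (katyushaGrad f μ j x) δ - inner ℝ (katyushaGrad f μ j w) δ = ‖δ‖ ^ 2 := by
    rw [← inner_sub_left, ← hδ, real_inner_self_eq_norm_sq]
  have h5 : L⁻¹ * inner ℝ (katyushaGrad f μ j x) δ - L⁻¹ * inner ℝ (katyushaGrad f μ j w) δ
      = L⁻¹ * ‖δ‖ ^ 2 := by rw [← mul_sub, h3]
  have h6 : L⁻¹ * ‖δ‖ ^ 2 - L / 2 * (L⁻¹ ^ 2 * ‖δ‖ ^ 2) = ‖δ‖ ^ 2 / (2 * L) := by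
    field_simp; ring
  have h7 : ‖δ‖ ^ 2 / (2 * L) ≤ katyushaPart f μ j w
      - katyushaPart f μ j x - inner ℝ (katyushaGrad f μ j x) (w - x) := by linarith
  rw [div_le_iff₀ (by positivity)] at h7
  linarith

lemma katyushaObj_eq (hm : 1 ≤ m) (p θ : Vec d) : katyushaObj f p θ
    = avg (fun j => katyushaPart f μ j θ) + (μ / 2 * ‖θ‖ ^ 2 - inner ℝ p θ) := by
  rw [katyushaObj]
  simp only [katyushaPart]
  rw [avg_sub, avg_const' hm]; ring

lemma avg_katyushaPart_lower (hc : ∀ j, IsStronglyConvex (f j) μ) (x y : Vec d) :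
    avg (fun j => katyushaPart f μ j x) + inner ℝ (katyushaFull f μ x) (y - x)
      ≤ avg fun j => katyushaPart f μ j y := by
  rw [katyushaFull, ← avg_inner, ← avg_add]
  exact avg_mono fun j => katyushaPart_lower hc j x y

lemma avg_katyushaPart_upper (hm : 1 ≤ m) (hμ : 0 ≤ μ) (hs : ∀ j, IsLSmooth (f j) L) (x y : Vec d) :
    avg (fun j => katyushaPart f μ j y) ≤ avg (fun j => katyushaPart f μ j x)
      + inner ℝ (katyushaFull f μ x) (y - x) + L / 2 * ‖y - x‖ ^ 2 := by
  rw [katyushaFull, ← avg_inner, ← avg_const' hm (L / 2 * ‖y - x‖ ^ 2), ← avg_add, ← avg_add]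
  exact avg_mono fun j => katyushaPart_upper hμ hs j x y

/-- The proximal step with the quadratic `ψ(θ) = (μ/2)‖θ‖² - ⟨p, θ⟩` satisfies the three-point
inequality with equality. -/
lemma prox_identity {E : Type*} [NormedAddCommGroup E] [InnerProductSpace ℝ E] {a μ : ℝ}
    {z z' g p : E} (h : (1 + a * μ) • z' = z - a • (g - p)) (u : E) :
    a * inner ℝ g (z' - u) + a * (μ / 2 * ‖z'‖ ^ 2 - inner ℝ p z')
        - a * (μ / 2 * ‖u‖ ^ 2 - inner ℝ p u)
      = 1 / 2 * ‖z - u‖ ^ 2 - (1 + a * μ) / 2 * ‖z' - u‖ ^ 2 - 1 / 2 * ‖z' - z‖ ^ 2 := by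
  have hv : z - z' = (a * μ) • z' + a • (g - p) := by
    rw [add_smul, one_smul] at h
    rw [eq_comm, ← sub_eq_zero, show (a * μ) • z' + a • (g - p) - (z - z')
      = (z' + (a * μ) • z') - (z - a • (g - p)) by abel, h, sub_self]
  have h1 : ‖z - u‖ ^ 2 = ‖z - z'‖ ^ 2 + 2 * inner ℝ (z - z') (z' - u) + ‖z' - u‖ ^ 2 := by
    rw [← norm_add_sq_real, sub_add_sub_cancel]
  have h2 : inner ℝ (z - z') (z' - u)
      = a * μ * inner ℝ z' (z' - u) + a * (inner ℝ g (z' - u) - (inner ℝ p z' - inner ℝ p u)) := by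
    rw [hv, inner_add_left, real_inner_smul_left, real_inner_smul_left, inner_sub_left,
      inner_sub_right p]
  have h3 : ‖u‖ ^ 2 = ‖z'‖ ^ 2 - 2 * inner ℝ z' (z' - u) + ‖z' - u‖ ^ 2 := by
    rw [← norm_sub_sq_real, sub_sub_cancel]
  rw [norm_sub_rev z' z, h1, h2, h3]
  ring

/-- The pathwise part of the analysis of one inner step, before the mean over the sampled index
is taken; `g` is the gradient estimate and `g - ∇h(x)` its error. -/
lemma katyushaStep_pathwise {h : Vec d → ℝ} {gr : Vec d} {a τ : ℝ} (hL : 0 < L) (hτ : 0 < τ)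
    (ha : 3 * (a * τ * L) = 1) {x z z' y' g p : Vec d}
    (hup : h y' ≤ h x + inner ℝ gr (y' - x) + L / 2 * ‖y' - x‖ ^ 2)
    (hz : (1 + a * μ) • z' = z - a • (g - p)) (hy : y' = x + τ • (z' - z)) (u : Vec d) :
    a * inner ℝ g (z - u) + a * (μ / 2 * ‖z'‖ ^ 2 - inner ℝ p z') + (a / τ) * h y'
        + (1 + a * μ) / 2 * ‖z' - u‖ ^ 2
      ≤ (a / τ) * h x + (a / τ) * (1 / (4 * L) * ‖g - gr‖ ^ 2)
        + a * (μ / 2 * ‖u‖ ^ 2 - inner ℝ p u) + 1 / 2 * ‖z - u‖ ^ 2 := by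
  have ha0 : 0 < a := by
    by_contra hneg
    have : a * (τ * L) ≤ 0 := mul_nonpos_of_nonpos_of_nonneg (not_lt.1 hneg) (by positivity)
    nlinarith
  have h1 := prox_identity hz u
  have h2 : inner ℝ g (z - u) = inner ℝ g (z' - u) - inner ℝ g (z' - z) := by
    rw [← inner_sub_right]; congr 1; abel
  have hd : y' - x = τ • (z' - z) := by rw [hy, add_sub_cancel_left]
  have h3 : inner ℝ g (y' - x) = τ * inner ℝ g (z' - z) := by rw [hd, inner_smul_right]
  have h4 : ‖y' - x‖ ^ 2 = τ ^ 2 * ‖z' - z‖ ^ 2 := by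
    rw [hd, norm_smul, mul_pow, Real.norm_eq_abs, sq_abs]
  -- Young's inequality with the weight that leaves `3L/2 = L/2 + L`
  have h5 : inner ℝ gr (y' - x) - inner ℝ g (y' - x)
      ≤ 1 / (4 * L) * ‖g - gr‖ ^ 2 + L * ‖y' - x‖ ^ 2 := by
    rw [← inner_sub_left]
    have h6 := real_inner_le_norm (gr - g) (y' - x)
    rw [norm_sub_rev gr g] at h6
    have h7 : 1 / (4 * L) * ‖g - gr‖ ^ 2 + L * ‖y' - x‖ ^ 2 - ‖g - gr‖ * ‖y' - x‖
        = 1 / (4 * L) * (‖g - gr‖ - 2 * L * ‖y' - x‖) ^ 2 := by field_simp; ring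
    have h8 : 0 ≤ 1 / (4 * L) * (‖g - gr‖ - 2 * L * ‖y' - x‖) ^ 2 := by positivity
    linarith
  have h9 : (a / τ) * (h y' + inner ℝ g (y' - x) * (-1) - h x - 1 / (4 * L) * ‖g - gr‖ ^ 2
      - 3 * L / 2 * ‖y' - x‖ ^ 2) ≤ 0 := by
    refine mul_nonpos_of_nonneg_of_nonpos (by positivity) ?_
    linarith
  have h10 : (a / τ) * (3 * L / 2 * ‖y' - x‖ ^ 2) = 1 / 2 * ‖z' - z‖ ^ 2 := by
    rw [h4]
    have : (a / τ) * (3 * L / 2 * (τ ^ 2 * ‖z' - z‖ ^ 2))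
        = 3 * (a * τ * L) / 2 * ‖z' - z‖ ^ 2 := by field_simp
    rw [this, ha]
  have h11 : (a / τ) * inner ℝ g (y' - x) = a * inner ℝ g (z' - z) := by
    rw [h3]; field_simp
  have h12 : a * inner ℝ g (z - u) = a * inner ℝ g (z' - u) - a * inner ℝ g (z' - z) := by
    rw [h2]; ring
  linarith

lemma sq_norm_convexComb_le {E : Type*} [NormedAddCommGroup E] [InnerProductSpace ℝ E]
    {τ : ℝ} (hτ : 0 ≤ τ) (hτ2 : τ ≤ 1 / 2) (x y w : E) :
    ‖τ • x + (1 / 2 : ℝ) • w + (1 - τ - 1 / 2) • y‖ ^ 2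
      ≤ τ * ‖x‖ ^ 2 + 1 / 2 * ‖w‖ ^ 2 + (1 / 2 - τ) * ‖y‖ ^ 2 := by
  have h1 : ‖τ • x + (1 / 2 : ℝ) • w + (1 - τ - 1 / 2) • y‖
      ≤ τ * ‖x‖ + 1 / 2 * ‖w‖ + (1 / 2 - τ) * ‖y‖ := by
    refine (norm_add₃_le).trans (le_of_eq ?_)
    rw [norm_smul, norm_smul, norm_smul, Real.norm_of_nonneg hτ,
      Real.norm_of_nonneg (show (0 : ℝ) ≤ 1 / 2 by norm_num),
      Real.norm_of_nonneg (show (0 : ℝ) ≤ 1 - τ - 1 / 2 by linarith)]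
    ring
  have h2 := pow_le_pow_left₀ (norm_nonneg _) h1 2
  have h3 : 0 ≤ τ * (1 / 2) * (‖x‖ - ‖w‖) ^ 2 := by positivity
  have h4 : 0 ≤ τ * (1 / 2 - τ) * (‖x‖ - ‖y‖) ^ 2 :=
    mul_nonneg (mul_nonneg hτ (by linarith)) (sq_nonneg _)
  have h5 : 0 ≤ (1 / 2) * (1 / 2 - τ) * (‖w‖ - ‖y‖) ^ 2 :=
    mul_nonneg (by linarith) (sq_nonneg _)
  nlinarith

/-- The mean progress of one inner step of Katyusha. -/
lemma katyushaInner_avg_le (hm : 1 ≤ m) (hμ : 0 < μ) (hL : 0 < L) (hs : ∀ j, IsLSmooth (f j) L)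
    (hc : ∀ j, IsStronglyConvex (f j) μ) (p w : Vec d) (j : ℕ) (s : InnerState d) (u : Vec d) :
    avg (fun i => katyushaStep m L μ / katyushaTau m L μ *
          (katyushaObj f p (katyushaInner f L μ p w (katyushaFull f μ w) j i s).y
            - katyushaObj f p u)
        + (1 + katyushaStep m L μ * μ) / 2 *
          ‖(katyushaInner f L μ p w (katyushaFull f μ w) j i s).z - u‖ ^ 2)
      ≤ katyushaStep m L μ / katyushaTau m L μ *
          ((1 / 2 - katyushaTau m L μ) * (katyushaObj f p s.y - katyushaObj f p u)
            + 1 / 2 * (katyushaObj f p w - katyushaObj f p u)) + 1 / 2 * ‖s.z - u‖ ^ 2 := by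
  have hm0 : (0 : ℝ) < m := by exact_mod_cast hm
  set τ := katyushaTau m L μ with hτ
  set a := katyushaStep m L μ with ha
  have hτ0 : 0 < τ := lt_min (Real.sqrt_pos.2 (by positivity)) (by norm_num)
  have hτ2 : τ ≤ 1 / 2 := min_le_right _ _
  have ha3 : 3 * (a * τ * L) = 1 := by rw [ha, katyushaStep, ← hτ]; field_simp
  have ha0 : 0 < a := by rw [ha, katyushaStep, ← hτ]; positivity
  set x : Vec d := τ • s.z + (1 / 2 : ℝ) • w + (1 - τ - 1 / 2) • s.y with hx
  set H : Vec d → ℝ := fun θ => avg fun j => katyushaPart f μ j θ with hH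
  set ψ : Vec d → ℝ := fun θ => μ / 2 * ‖θ‖ ^ 2 - inner ℝ p θ with hψ
  set g : Fin m → Vec d := fun i =>
    katyushaFull f μ w + katyushaGrad f μ i x - katyushaGrad f μ i w with hg
  set zz : Fin m → Vec d := fun i => (1 / (1 + a * μ)) • (s.z - a • (g i - p)) with hzz
  set yy : Fin m → Vec d := fun i => x + τ • (zz i - s.z) with hyy
  have hobj : ∀ θ, katyushaObj f p θ = H θ + ψ θ := fun θ => katyushaObj_eq hm p θ
  change avg (fun i => a / τ * (katyushaObj f p (yy i) - katyushaObj f p u)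
    + (1 + a * μ) / 2 * ‖zz i - u‖ ^ 2) ≤ _
  set G := katyushaFull f μ x with hG
  have hr : 0 < 1 + a * μ := by positivity
  -- pathwise bound, with the convexity of `ψ` along `y' = τ z' + w / 2 + (1/2 - τ) y`
  have hpath : ∀ i, a / τ * (katyushaObj f p (yy i) - katyushaObj f p u)
      + (1 + a * μ) / 2 * ‖zz i - u‖ ^ 2 ≤
      ((a / τ) * H x + a * ψ u + 1 / 2 * ‖s.z - u‖ ^ 2
        + (a / τ) * (1 / 2 * ψ w + (1 / 2 - τ) * ψ s.y) - a / τ * katyushaObj f p u)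
        + ((a / τ) * (1 / (4 * L)) * ‖g i - G‖ ^ 2 - a * inner ℝ (g i) (s.z - u)) := by
    intro i
    have h1 := katyushaStep_pathwise (h := H) (gr := G) (μ := μ) hL hτ0 ha3
      (avg_katyushaPart_upper hm hμ.le hs x (yy i))
      (z := s.z) (z' := zz i) (g := g i) (p := p)
      (by rw [hzz, smul_smul, mul_one_div_cancel hr.ne', one_smul]) rfl u
    have hcomb : yy i = τ • zz i + (1 / 2 : ℝ) • w + (1 - τ - 1 / 2) • s.y := by
      simp only [hyy, hx, smul_sub]; abel
    have h2 : ψ (yy i) ≤ τ * ψ (zz i) + 1 / 2 * ψ w + (1 / 2 - τ) * ψ s.y := by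
      have h3 := sq_norm_convexComb_le hτ0.le hτ2 (zz i) s.y w
      rw [← hcomb] at h3
      have h4 : inner ℝ p (yy i) = τ * inner ℝ p (zz i) + 1 / 2 * inner ℝ p w
          + (1 / 2 - τ) * inner ℝ p s.y := by
        rw [hcomb, inner_add_right, inner_add_right, real_inner_smul_right p (zz i),
          real_inner_smul_right p w, real_inner_smul_right p s.y]
        ring
      simp only [hψ, h4]
      have h5 := mul_le_mul_of_nonneg_left h3 (by positivity : 0 ≤ μ / 2)
      linarith
    have h6 := mul_le_mul_of_nonneg_left h2 (by positivity : 0 ≤ a / τ)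
    have h7 : a / τ * (τ * ψ (zz i) + 1 / 2 * ψ w + (1 / 2 - τ) * ψ s.y)
        = a * ψ (zz i) + a / τ * (1 / 2 * ψ w + (1 / 2 - τ) * ψ s.y) := by
      field_simp; ring
    rw [h7] at h6
    have h8 : a / τ * katyushaObj f p (yy i) = a / τ * H (yy i) + a / τ * ψ (yy i) := by
      rw [hobj]; ring
    have h9 : (a / τ) * (1 / (4 * L)) * ‖g i - G‖ ^ 2
      = (a / τ) * (1 / (4 * L) * ‖g i - G‖ ^ 2) := by ring
    have h10 : a / τ * (katyushaObj f p (yy i) - katyushaObj f p u)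
      = a / τ * katyushaObj f p (yy i) - a / τ * katyushaObj f p u := by ring
    rw [h10, h8, h9]
    simp only [hψ] at h1 h6 ⊢
    linarith
  refine (avg_mono hpath).trans ?_
  rw [avg_add, avg_const' hm, avg_sub, avg_const_mul, avg_const_mul, avg_inner]
  -- the gradient estimate is unbiased
  have hmean : (1 / m : ℝ) • ∑ i, g i = G := by
    simp only [hg, Finset.sum_sub_distrib, Finset.sum_add_distrib, Finset.sum_const,
      Finset.card_univ, Fintype.card_fin, smul_sub, smul_add]
    rw [hG, katyushaFull, katyushaFull, ← Nat.cast_smul_eq_nsmul ℝ, smul_smul,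
      one_div_mul_cancel hm0.ne', one_smul]
    abel
  -- its variance is at most the Bregman distance between `x` and the snapshot
  have hvar : avg (fun i => ‖g i - G‖ ^ 2) ≤ 2 * L * (H w - H x - inner ℝ G (w - x)) := by
    have h1 : ∀ i, g i - G = (katyushaGrad f μ i x - katyushaGrad f μ i w)
        - (1 / m : ℝ) • ∑ i, (katyushaGrad f μ i x - katyushaGrad f μ i w) := by
      intro i
      rw [Finset.sum_sub_distrib, smul_sub]
      simp only [hg, hG, katyushaFull]
      abel
    simp only [h1]
    refine (avg_norm_sub_mean_sq_le hm _).trans ?_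
    refine (avg_mono fun i => katyushaGrad_cocoercive hμ.le hL hs hc i x w).trans (le_of_eq ?_)
    rw [avg_const_mul, avg_sub, avg_sub, avg_inner]
    rfl
  rw [hmean]
  have hlow : ∀ θ, H x + inner ℝ G (θ - x) ≤ H θ := fun θ => avg_katyushaPart_lower hc x θ
  have hv2 := mul_le_mul_of_nonneg_left hvar (by positivity : 0 ≤ (a / τ) * (1 / (4 * L)))
  have hv3 : (a / τ) * (1 / (4 * L)) * (2 * L * (H w - H x - inner ℝ G (w - x)))
      = (a / τ) * (1 / 2 * (H w - H x - inner ℝ G (w - x))) := by field_simp; ring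
  rw [hv3] at hv2
  -- `τ (x - z) = (w - x) / 2 + (1/2 - τ) (y - x)`
  have hgz : a * inner ℝ G (s.z - u) = a * inner ℝ G (x - u)
      - (a / τ) * (1 / 2 * inner ℝ G (w - x) + (1 / 2 - τ) * inner ℝ G (s.y - x)) := by
    have h1 : τ • (s.z - u) = τ • (x - u) - ((1 / 2 : ℝ) • (w - x) + (1 / 2 - τ) • (s.y - x)) := by
      rw [← sub_eq_zero]
      have : τ • (s.z - u) - (τ • (x - u) - ((1 / 2 : ℝ) • (w - x) + (1 / 2 - τ) • (s.y - x)))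
          = (τ • s.z + (1 / 2 : ℝ) • w + (1 - τ - 1 / 2) • s.y) - x := by module
      rw [this, ← hx, sub_self]
    have h2 := congrArg (inner ℝ G) h1
    rw [real_inner_smul_right, inner_sub_right G (τ • (x - u)), real_inner_smul_right G (x - u),
      inner_add_right, real_inner_smul_right, real_inner_smul_right] at h2
    have h3 : a * inner ℝ G (s.z - u) = (a / τ) * (τ * inner ℝ G (s.z - u)) := by field_simp
    rw [h3, h2]; field_simp
  have hy := mul_le_mul_of_nonneg_left (hlow s.y)
    (mul_nonneg (by positivity : 0 ≤ a / τ) (by linarith : 0 ≤ 1 / 2 - τ))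
  have hu := mul_le_mul_of_nonneg_left (hlow u) ha0.le
  have hux : inner ℝ G (x - u) = - inner ℝ G (u - x) := by rw [← inner_neg_right, neg_sub]
  rw [hgz, hux]
  simp only [hobj]
  have e1 : a * H x = (a / τ) * (τ * H x) := by field_simp
  have e2 : a * ψ u = (a / τ) * (τ * ψ u) := by field_simp
  have e3 : a * H u = (a / τ) * (τ * H u) := by field_simp
  have e4 : a * inner ℝ G (u - x) = (a / τ) * (τ * inner ℝ G (u - x)) := by field_simp
  rw [mul_add a, e1, e4, e3] at hu
  rw [e2, mul_neg, e4]
  nlinarith [hu, hy, hv2]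

lemma norm_sq_le_katyushaObj (hm : 1 ≤ m) (hc : ∀ j, IsStronglyConvex (f j) μ) {p θs : Vec d}
    (hθ : (1 / m : ℝ) • ∑ j, gradient (f j) θs = p) (θ : Vec d) :
    μ / 2 * ‖θ - θs‖ ^ 2 ≤ katyushaObj f p θ - katyushaObj f p θs := by
  have h := avg_mono fun j => hc j θs θ
  rw [avg_add, avg_add, avg_const' hm, avg_inner, hθ, inner_sub_right] at h
  rw [katyushaObj, katyushaObj]
  linarith

lemma katyushaObj_le_norm_sq (hm : 1 ≤ m) (hs : ∀ j, IsLSmooth (f j) L) {p θs : Vec d}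
    (hθ : (1 / m : ℝ) • ∑ j, gradient (f j) θs = p) (θ : Vec d) :
    katyushaObj f p θ - katyushaObj f p θs ≤ L / 2 * ‖θ - θs‖ ^ 2 := by
  have h := avg_mono fun j => (hs j).2 θs θ
  rw [avg_add, avg_add, avg_const' hm, avg_inner, hθ, inner_sub_right] at h
  rw [katyushaObj, katyushaObj]
  linarith

end KatyushaStep

/-! ### Expectations of functions of finitely many samples -/

section Sampling

variable {Ω Q : Type*} [MeasurableSpace Ω] {m : ℕ}

/-- Independent samples from the uniform distribution on `Fin m`, indexed by `Q`. -/
structure IsUniformFamily (P : Measure Ω) (s : Ω → Q → Fin m) : Prop where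
  measurable : ∀ q, Measurable fun ω => s ω q
  indep : iIndepFun (fun q ω => s ω q) P
  uniform : ∀ q a, P.real ((fun ω => s ω q) ⁻¹' {a}) = 1 / m

/-- The expectation of a function of the samples. -/
noncomputable def expect (P : Measure Ω) (s : Ω → Q → Fin m) (X : (Q → Fin m) → ℝ) : ℝ :=
  ∫ ω, X (s ω) ∂P

variable {P : Measure Ω} {s : Ω → Q → Fin m} {X Y : (Q → Fin m) → ℝ}
  {A : Finset Q}

lemma _root_.DependsOn.add {A : Set Q} {X Y : (Q → Fin m) → ℝ} (hX : DependsOn X A)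
    (hY : DependsOn Y A) : DependsOn (fun σ => X σ + Y σ) A := fun σ σ' h => by
  simp only [hX h, hY h]

lemma _root_.DependsOn.const_mul {A : Set Q} {X : (Q → Fin m) → ℝ} (a : ℝ)
    (hX : DependsOn X A) : DependsOn (fun σ => a * X σ) A := fun σ σ' h => by
  simp only [hX h]

lemma _root_.DependsOn.sum {ι : Type*} {A : Set Q} {S : Finset ι} {X : ι → (Q → Fin m) → ℝ}
    (hX : ∀ i ∈ S, DependsOn (X i) A) : DependsOn (fun σ => ∑ i ∈ S, X i σ) A := fun _ _ h =>
  Finset.sum_congr rfl fun i hi => hX i hi h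

lemma exists_eq_comp_of_dependsOn {β : Type*} {X : (Q → Fin m) → β} (hX : DependsOn X (A : Set Q))
    (a₀ : Fin m) :
    ∃ g : (A → Fin m) → β, ∀ σ, X σ = g fun q => σ q := by
  classical
  refine ⟨fun t => X fun q => if h : q ∈ A then t ⟨q, h⟩ else a₀, fun σ => hX fun q hq => ?_⟩
  simp [Finset.mem_coe.1 hq]

lemma IsUniformFamily.integrable [IsProbabilityMeasure P] (h : IsUniformFamily P s) (hm : 1 ≤ m)
    (hX : DependsOn X (A : Set Q)) : Integrable (fun ω => X (s ω)) P := by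
  obtain ⟨g, hg⟩ := exists_eq_comp_of_dependsOn hX ⟨0, hm⟩
  have hmeas : Measurable fun ω => fun q : A => s ω q :=
    measurable_pi_lambda _ fun q => h.measurable q
  have : IsProbabilityMeasure (P.map fun ω => fun q : A => s ω q) :=
    Measure.isProbabilityMeasure_map hmeas.aemeasurable
  have hi : Integrable g (P.map fun ω => fun q : A => s ω q) := Integrable.of_finite
  simpa only [hg, Function.comp_def] using hi.comp_measurable hmeas

/-- A fresh sample may be replaced by the mean over its values. -/
lemma IsUniformFamily.expect_update [IsProbabilityMeasure P] [DecidableEq Q]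
    (h : IsUniformFamily P s) (hm : 1 ≤ m) {q : Q}
    (hq : q ∉ A) (hX : DependsOn X (insert q A : Set Q)) :
    expect P s X = expect P s fun σ => avg fun a => X (Function.update σ q a) := by
  have hY : ∀ a, DependsOn (fun σ => X (Function.update σ q a)) (A : Set Q) := by
    intro a σ σ' hσ
    refine hX fun r hr => ?_
    rcases eq_or_ne r q with rfl | hne
    · simp
    · rw [Function.update_of_ne hne, Function.update_of_ne hne]
      exact hσ r (hr.resolve_left hne)
  have hsum : ∀ ω, X (s ω) = ∑ a, (if s ω q = a then (1 : ℝ) else 0) *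
      X (Function.update (s ω) q a) := by
    intro ω
    simp
  have hterm : ∀ a, ∫ ω, (if s ω q = a then (1 : ℝ) else 0) * X (Function.update (s ω) q a) ∂P
      = (1 / m : ℝ) * ∫ ω, X (Function.update (s ω) q a) ∂P := by
    intro a
    obtain ⟨g, hg⟩ := exists_eq_comp_of_dependsOn (hY a) ⟨0, hm⟩
    have hind := h.indep.indepFun_finset {q} A (by simpa using hq) h.measurable
    have hind2 := hind.comp (φ := fun t => if t ⟨q, by simp⟩ = a then (1 : ℝ) else 0) (ψ := g)
      (measurable_of_finite _) (measurable_of_finite _)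
    have hmeasA : Measurable fun ω => fun q : A => s ω q :=
      measurable_pi_lambda _ fun q => h.measurable q
    have hms : MeasurableSet ((fun ω => s ω q) ⁻¹' {a}) :=
      h.measurable q (measurableSet_singleton a)
    have := hind2.integral_fun_mul_eq_mul_integral
      ((Measurable.ite hms measurable_const measurable_const).aestronglyMeasurable)
      (((measurable_of_finite g).comp hmeasA).aestronglyMeasurable)
    simp only [hg]
    refine this.trans ?_
    congr 1
    rw [← h.uniform q a, ← integral_indicator_one hms]
    refine integral_congr_ae (Filter.Eventually.of_forall fun ω => ?_)
    simp [Set.indicator]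
  have hint : ∀ a, Integrable (fun ω => X (Function.update (s ω) q a)) P := fun a =>
    h.integrable hm (hY a)
  rw [expect, expect]
  simp only [hsum, avg]
  rw [integral_finsetSum]
  · simp only [hterm]
    rw [integral_const_mul, integral_finsetSum _ fun a _ => hint a, Finset.mul_sum]
  · intro a _
    have hms : MeasurableSet ((fun ω => s ω q) ⁻¹' {a}) :=
      h.measurable q (measurableSet_singleton a)
    refine ((hint a).indicator hms).congr (Filter.Eventually.of_forall fun ω => ?_)
    by_cases hω : s ω q = a <;> simp [Set.indicator, hω]

lemma IsUniformFamily.expect_mono [IsProbabilityMeasure P] (h : IsUniformFamily P s) (hm : 1 ≤ m)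
    (hX : DependsOn X (A : Set Q)) (hY : DependsOn Y (A : Set Q)) (hXY : ∀ σ, X σ ≤ Y σ) :
    expect P s X ≤ expect P s Y :=
  integral_mono (h.integrable hm hX) (h.integrable hm hY) fun ω => hXY (s ω)

lemma IsUniformFamily.expect_add [IsProbabilityMeasure P] (h : IsUniformFamily P s) (hm : 1 ≤ m)
    (hX : DependsOn X (A : Set Q)) (hY : DependsOn Y (A : Set Q)) :
    expect P s (fun σ => X σ + Y σ) = expect P s X + expect P s Y :=
  integral_add (h.integrable hm hX) (h.integrable hm hY)

lemma IsUniformFamily.expect_sum [IsProbabilityMeasure P] {ι : Type*}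
    (h : IsUniformFamily P s) (hm : 1 ≤ m) (S : Finset ι)
    {X : ι → (Q → Fin m) → ℝ} (hX : ∀ i ∈ S, DependsOn (X i) (A : Set Q)) :
    expect P s (fun σ => ∑ i ∈ S, X i σ) = ∑ i ∈ S, expect P s (X i) :=
  integral_finsetSum S fun i hi => h.integrable hm (hX i hi)

lemma expect_const_mul (a : ℝ) (X : (Q → Fin m) → ℝ) :
    expect P s (fun σ => a * X σ) = a * expect P s X :=
  integral_const_mul a _

lemma expect_nonneg (hX : ∀ σ, 0 ≤ X σ) : 0 ≤ expect P s X :=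
  integral_nonneg fun ω => hX (s ω)

end Sampling

/-! ### Convergence of Katyusha in expectation -/

section RealSequences

/-- Telescoping of the inner steps of an epoch, with weights `r ^ j`. -/
lemma katyusha_telescope {b τ r dw : ℝ} {D Z : ℕ → ℝ} (hr : 0 ≤ r)
    (h : ∀ j, b * D (j + 1) + r / 2 * Z (j + 1)
      ≤ b * ((1 / 2 - τ) * D j + 1 / 2 * dw) + 1 / 2 * Z j) (j : ℕ) :
    b * ((1 - (1 / 2 - τ) * r) * ∑ k ∈ Finset.range j, r ^ k * D (k + 1)
        + (1 / 2 - τ) * (r ^ j * D j)) + r ^ j / 2 * Z j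
      ≤ b * (1 / 2 * (∑ k ∈ Finset.range j, r ^ k) * dw + (1 / 2 - τ) * D 0) + 1 / 2 * Z 0 := by
  induction j with
  | zero => simp
  | succ j ih =>
    have h1 := mul_le_mul_of_nonneg_left (h j) (pow_nonneg hr j)
    rw [Finset.sum_range_succ, Finset.sum_range_succ, pow_succ]
    nlinarith [h1, ih]

end RealSequences

section KatyushaRun

variable {d m : ℕ} {f : Fin m → Vec d → ℝ} {L μ : ℝ}

lemma katyushaInnerIter_congr (p w full : Vec d) {idx idx' : ℕ → Fin m} (s : InnerState d) {j : ℕ}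
    (h : ∀ k < j, idx k = idx' k) :
    katyushaInnerIter f L μ p w full idx s j = katyushaInnerIter f L μ p w full idx' s j := by
  induction j with
  | zero => rfl
  | succ j ih =>
    rw [katyushaInnerIter, katyushaInnerIter, ih fun k hk => h k (hk.trans (Nat.lt_succ_self j)),
      h j (Nat.lt_succ_self j)]

lemma katyushaEpoch_congr (p : Vec d) {idx idx' : ℕ → Fin m} (s : EpochState d)
    (h : ∀ k < 2 * m, idx k = idx' k) :
    katyushaEpoch f L μ p idx s = katyushaEpoch f L μ p idx' s := by
  simp only [katyushaEpoch, katyushaInnerIter_congr _ _ _ _ h]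

lemma katyusha_congr (p : Vec d) {idx idx' : ℕ → ℕ → Fin m} (θ₀ : Vec d) {S : ℕ}
    (h : ∀ e < S, ∀ k < 2 * m, idx e k = idx' e k) :
    katyusha f L μ p idx θ₀ S = katyusha f L μ p idx' θ₀ S := by
  induction S with
  | zero => rfl
  | succ S ih =>
    rw [katyusha, katyusha, ih fun e he => h e (he.trans (Nat.lt_succ_self S)),
      katyushaEpoch_congr _ _ (h S (Nat.lt_succ_self S))]

lemma katyushaInnerIter_evals (p w full : Vec d) (idx : ℕ → Fin m) (s : InnerState d) (j : ℕ) :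
    (katyushaInnerIter f L μ p w full idx s j).evals = s.evals + 2 * j := by
  induction j with
  | zero => rfl
  | succ j ih => simp only [katyushaInnerIter, katyushaInner, ih]; ring

lemma katyusha_evals (p : Vec d) (idx : ℕ → ℕ → Fin m) (θ₀ : Vec d) (S : ℕ) :
    (katyusha f L μ p idx θ₀ S).evals = S * (5 * m) := by
  induction S with
  | zero => simp [katyusha]
  | succ S ih =>
    simp only [katyusha, katyushaEpoch, katyushaInnerIter_evals, ih]; ring

lemma katyushaInnerIter_acc (p w full : Vec d) (idx : ℕ → Fin m) (s : InnerState d) (j : ℕ) :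
    (katyushaInnerIter f L μ p w full idx s j).acc = s.acc + ∑ k ∈ Finset.range j,
      (1 + katyushaStep m L μ * μ) ^ k • (katyushaInnerIter f L μ p w full idx s (k + 1)).y := by
  induction j with
  | zero => simp [katyushaInnerIter]
  | succ j ih =>
    rw [Finset.sum_range_succ, ← add_assoc, ← ih]
    rfl

/-- Jensen's inequality for the weighted average that ends an epoch. -/
lemma katyushaObj_average_le (hμ : 0 < μ) (hc : ∀ j, IsStronglyConvex (f j) μ)
    (p : Vec d) {M : ℕ} {wt : ℕ → ℝ} (hwt : ∀ k, 0 ≤ wt k)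
    (hpos : 0 < ∑ k ∈ Finset.range M, wt k) (y : ℕ → Vec d) (c : ℝ) :
    (∑ k ∈ Finset.range M, wt k) * (katyushaObj f p
        ((∑ k ∈ Finset.range M, wt k)⁻¹ • ∑ k ∈ Finset.range M, wt k • y k) - c)
      ≤ ∑ k ∈ Finset.range M, wt k * (katyushaObj f p (y k) - c) := by
  set W := ∑ k ∈ Finset.range M, wt k
  set v := W⁻¹ • ∑ k ∈ Finset.range M, wt k • y k with hv
  set G := (1 / m : ℝ) • ∑ j, gradient (f j) v - p with hG
  have hlow : ∀ θ, katyushaObj f p v + inner ℝ G (θ - v) ≤ katyushaObj f p θ := by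
    intro θ
    have h := avg_mono fun j => (le_add_of_nonneg_right (by positivity :
      0 ≤ μ / 2 * ‖θ - v‖ ^ 2)).trans (hc j v θ)
    rw [avg_add, avg_inner] at h
    rw [hG, inner_sub_left, inner_sub_right p, katyushaObj, katyushaObj]
    linarith
  have hzero : ∑ k ∈ Finset.range M, wt k * inner ℝ G (y k - v) = 0 := by
    have h1 : ∑ k ∈ Finset.range M, wt k • (y k - v) = 0 := by
      simp only [smul_sub, Finset.sum_sub_distrib, ← Finset.sum_smul]
      rw [hv, smul_smul, mul_inv_cancel₀ hpos.ne', one_smul, sub_self]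
    have h2 := congrArg (inner ℝ G) h1
    rw [inner_sum, inner_zero_right] at h2
    simpa only [real_inner_smul_right] using h2
  calc W * (katyushaObj f p v - c)
      = ∑ k ∈ Finset.range M, wt k * (katyushaObj f p v + inner ℝ G (y k - v) - c) := by
        rw [Finset.sum_mul, ← add_zero (∑ k ∈ Finset.range M, wt k * (katyushaObj f p v - c)),
          ← hzero, ← Finset.sum_add_distrib]
        exact Finset.sum_congr rfl fun k _ => by ring
    _ ≤ _ := Finset.sum_le_sum fun k _ =>
        mul_le_mul_of_nonneg_left (sub_le_sub_right (hlow _) _) (hwt k)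

end KatyushaRun

section KatyushaExpect

variable {d m : ℕ} {f : Fin m → Vec d → ℝ} {L μ : ℝ}

/-- The total weight of an epoch. -/
noncomputable def katyushaWeight (m : ℕ) (L μ : ℝ) : ℝ :=
  ∑ k ∈ Finset.range (2 * m), (1 + katyushaStep m L μ * μ) ^ k

/-- The potential of a state between epochs, for the objective with linear term `p` and the
minimizer `u`. -/
noncomputable def katyushaPotential (f : Fin m → Vec d → ℝ) (L μ : ℝ) (p u : Vec d)
    (s : EpochState d) : ℝ :=
  katyushaStep m L μ / katyushaTau m L μ *
      (1 / 2 * katyushaWeight m L μ * (katyushaObj f p s.snap - katyushaObj f p u)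
        + (1 / 2 - katyushaTau m L μ) * (katyushaObj f p s.y - katyushaObj f p u))
    + 1 / 2 * ‖s.z - u‖ ^ 2

lemma katyushaTau_pos (hm : 1 ≤ m) (hμ : 0 < μ) (hL : 0 < L) : 0 < katyushaTau m L μ := by
  have hm0 : (0 : ℝ) < m := by exact_mod_cast hm
  exact lt_min (Real.sqrt_pos.2 (by positivity)) (by norm_num)

lemma katyushaTau_le (m : ℕ) (L μ : ℝ) : katyushaTau m L μ ≤ 1 / 2 := min_le_right _ _

lemma katyushaStep_pos (hm : 1 ≤ m) (hμ : 0 < μ) (hL : 0 < L) : 0 < katyushaStep m L μ := by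
  have := katyushaTau_pos hm hμ hL
  rw [katyushaStep]; positivity

/-- `τ ≤ 2m · aμ`, with equality unless `τ = 1/2`. -/
lemma katyushaTau_le_mul (hm : 1 ≤ m) (hμ : 0 < μ) (hL : 0 < L) :
    katyushaTau m L μ ≤ 2 * m * (katyushaStep m L μ * μ) := by
  have h0 := katyushaTau_pos hm hμ hL
  have h1 : katyushaTau m L μ ^ 2 ≤ 2 * m * μ / (3 * L) := by
    rw [← Real.sq_sqrt (show 0 ≤ 2 * m * μ / (3 * L) by positivity)]
    exact pow_le_pow_left₀ h0.le (min_le_left _ _) 2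
  rw [katyushaStep]
  have : 2 * m * (1 / (3 * katyushaTau m L μ * L) * μ)
      = (2 * m * μ / (3 * L)) / katyushaTau m L μ := by field_simp
  rw [this, le_div_iff₀ h0, ← sq]
  exact h1

lemma one_add_katyushaTau_le_pow (hm : 1 ≤ m) (hμ : 0 < μ) (hL : 0 < L) :
    1 + katyushaTau m L μ ≤ (1 + katyushaStep m L μ * μ) ^ (2 * m) := by
  have h1 := katyushaTau_le_mul hm hμ hL
  have h2 := katyushaStep_pos hm hμ hL
  have h3 := one_add_mul_le_pow (a := katyushaStep m L μ * μ) (by nlinarith) (2 * m)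
  push_cast at h3
  linarith

/-- The inequality that lets the weighted sum of the inner steps pay for the new snapshot. -/
lemma katyushaTau_balance (hm : 1 ≤ m) (hμ : 0 < μ) (hL : 0 < L) :
    1 / 2 * (1 + katyushaTau m L μ)
      ≤ 1 - (1 / 2 - katyushaTau m L μ) * (1 + katyushaStep m L μ * μ) := by
  have h0 := katyushaTau_pos hm hμ hL
  have h2 := katyushaStep_pos hm hμ hL
  have hm1 : (1 : ℝ) ≤ m := by exact_mod_cast hm
  rcases min_choice (Real.sqrt (2 * m * μ / (3 * L))) (1 / 2) with h | h
  · have h1 : katyushaTau m L μ ^ 2 = 2 * m * μ / (3 * L) := by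
      rw [katyushaTau, h, Real.sq_sqrt (by positivity)]
    have h3 : 2 * m * (katyushaStep m L μ * μ) = katyushaTau m L μ := by
      rw [katyushaStep]
      have : 2 * m * (1 / (3 * katyushaTau m L μ * L) * μ)
          = (2 * m * μ / (3 * L)) / katyushaTau m L μ := by field_simp
      rw [this, ← h1, sq, mul_div_assoc, div_self h0.ne', mul_one]
    have h4 : 0 < katyushaStep m L μ * μ := by positivity
    nlinarith
  · have h1 : katyushaTau m L μ = 1 / 2 := h
    rw [h1]; norm_num

lemma two_mul_le_katyushaWeight (hm : 1 ≤ m) (hμ : 0 < μ) (hL : 0 < L) :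
    2 * (m : ℝ) ≤ katyushaWeight m L μ := by
  have h2 := katyushaStep_pos hm hμ hL
  have : ∑ _k ∈ Finset.range (2 * m), (1 : ℝ) ≤ katyushaWeight m L μ :=
    Finset.sum_le_sum fun k _ => one_le_pow₀ (by nlinarith [mul_pos h2 hμ])
  simpa using this

variable {Ω Q : Type*} [MeasurableSpace Ω] {P : Measure Ω} {s : Ω → Q → Fin m}

/-- One epoch contracts the expected potential by the factor `1 + τ`. -/
lemma katyushaEpoch_expect [IsProbabilityMeasure P] [DecidableEq Q] (h : IsUniformFamily P s)
    (hm : 1 ≤ m) (hμ : 0 < μ) (hL : 0 < L) (hs : ∀ j, IsLSmooth (f j) L)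
    (hc : ∀ j, IsStronglyConvex (f j) μ) {A : Finset Q} {pv θs : (Q → Fin m) → Vec d}
    {st : (Q → Fin m) → EpochState d} (hp : DependsOn pv (A : Set Q))
    (hθ : DependsOn θs (A : Set Q)) (hst : DependsOn st (A : Set Q))
    (hopt : ∀ σ, (1 / m : ℝ) • ∑ j, gradient (f j) (θs σ) = pv σ)
    {q : ℕ → Q} (hq : Function.Injective q) (hqA : ∀ j, q j ∉ A) :
    (1 + katyushaTau m L μ) * expect P s (fun σ => katyushaPotential f L μ (pv σ) (θs σ)
        (katyushaEpoch f L μ (pv σ) (fun k => σ (q k)) (st σ)))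
      ≤ expect P s fun σ => katyushaPotential f L μ (pv σ) (θs σ) (st σ) := by
  set τ := katyushaTau m L μ with hτ
  set a := katyushaStep m L μ with ha
  have hτ0 : 0 < τ := katyushaTau_pos hm hμ hL
  have hτ2 : τ ≤ 1 / 2 := katyushaTau_le m L μ
  have ha0 : 0 < a := katyushaStep_pos hm hμ hL
  set r := 1 + a * μ with hr
  have hr0 : 0 < r := by positivity
  have hb0 : 0 < a / τ := by positivity
  let R : (Q → Fin m) → ℕ → InnerState d := fun σ j => katyushaInnerIter f L μ (pv σ) (st σ).snap
    (katyushaFull f μ (st σ).snap) (fun k => σ (q k))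
    { y := (st σ).y, z := (st σ).z, acc := 0, evals := (st σ).evals + m } j
  let B : ℕ → Finset Q := fun j => A ∪ (Finset.range j).image q
  have hBA : ∀ j, (A : Set Q) ⊆ (B j : Set Q) := fun j => by
    simp only [B, Finset.coe_union]; exact Set.subset_union_left
  have hBmono : ∀ {i j}, i ≤ j → (B i : Set Q) ⊆ (B j : Set Q) := by
    intro i j hij
    simp only [B, Finset.coe_union, Finset.coe_image]
    refine Set.union_subset_union_right _ (Set.image_mono ?_)
    exact_mod_cast Finset.range_subset_range.2 hij
  have hqB : ∀ j, q j ∉ B j := by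
    intro j hj
    simp only [B, Finset.mem_union, Finset.mem_image, Finset.mem_range] at hj
    rcases hj with hj | ⟨k, hk, hkj⟩
    · exact hqA j hj
    · exact hk.ne (hq hkj)
  have hBsucc : ∀ j, (B (j + 1) : Set Q) = insert (q j) (B j : Set Q) := by
    intro j
    ext x
    simp only [B, Finset.coe_union, Finset.coe_image, Set.mem_union, Set.mem_image, Finset.mem_coe,
      Finset.mem_range, Set.mem_insert_iff, Nat.lt_succ_iff_lt_or_eq]
    constructor
    · rintro (hx | ⟨k, hk | rfl, rfl⟩)
      · exact Or.inr (Or.inl hx)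
      · exact Or.inr (Or.inr ⟨k, hk, rfl⟩)
      · exact Or.inl rfl
    · rintro (rfl | hx | ⟨k, hk, rfl⟩)
      · exact Or.inr ⟨j, Or.inr rfl, rfl⟩
      · exact Or.inl hx
      · exact Or.inr ⟨k, Or.inl hk, rfl⟩
  have hRdep : ∀ j, DependsOn (fun σ => R σ j) (B j : Set Q) := by
    intro j σ σ' hσ
    have hA : ∀ x ∈ (A : Set Q), σ x = σ' x := fun x hx => hσ x (hBA j hx)
    simp only [R]
    rw [hp hA, hst hA]
    refine katyushaInnerIter_congr _ _ _ _ fun k hk => hσ _ ?_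
    simp only [B, Finset.coe_union, Finset.coe_image]
    exact Or.inr ⟨k, by simpa using hk, rfl⟩
  have hdep : ∀ j (φ : Vec d → Vec d → EpochState d → InnerState d → ℝ),
      DependsOn (fun σ => φ (pv σ) (θs σ) (st σ) (R σ j)) (B j : Set Q) := by
    intro j φ σ σ' hσ
    have hA : ∀ x ∈ (A : Set Q), σ x = σ' x := fun x hx => hσ x (hBA j hx)
    have h1 : R σ j = R σ' j := hRdep j hσ
    simp only [hp hA, hθ hA, hst hA, h1]
  set D : ℕ → ℝ := fun j => expect P s fun σ =>
    katyushaObj f (pv σ) (R σ j).y - katyushaObj f (pv σ) (θs σ) with hD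
  set Z : ℕ → ℝ := fun j => expect P s fun σ => ‖(R σ j).z - θs σ‖ ^ 2 with hZ
  set dw : ℝ := expect P s fun σ =>
    katyushaObj f (pv σ) (st σ).snap - katyushaObj f (pv σ) (θs σ) with hdw
  have hDdep : ∀ j, DependsOn (fun σ => katyushaObj f (pv σ) (R σ j).y
      - katyushaObj f (pv σ) (θs σ)) (B j : Set Q) := fun j =>
    hdep j fun p u _ r => katyushaObj f p r.y - katyushaObj f p u
  have hZdep : ∀ j, DependsOn (fun σ => ‖(R σ j).z - θs σ‖ ^ 2) (B j : Set Q) := fun j =>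
    hdep j fun _ u _ r => ‖r.z - u‖ ^ 2
  have hwdep : ∀ j, DependsOn (fun σ => katyushaObj f (pv σ) (st σ).snap
      - katyushaObj f (pv σ) (θs σ)) (B j : Set Q) := fun j =>
    hdep j fun p u t _ => katyushaObj f p t.snap - katyushaObj f p u
  -- the recursion of the inner steps
  have hrec : ∀ j, a / τ * D (j + 1) + r / 2 * Z (j + 1)
      ≤ a / τ * ((1 / 2 - τ) * D j + 1 / 2 * dw) + 1 / 2 * Z j := by
    intro j
    have e1 : a / τ * D (j + 1) + r / 2 * Z (j + 1) = expect P s (fun σ =>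
        a / τ * (katyushaObj f (pv σ) (R σ (j + 1)).y - katyushaObj f (pv σ) (θs σ))
          + r / 2 * ‖(R σ (j + 1)).z - θs σ‖ ^ 2) := by
      rw [h.expect_add hm ((hDdep _).const_mul _) ((hZdep _).const_mul _), expect_const_mul,
        expect_const_mul]
    have e2 : a / τ * ((1 / 2 - τ) * D j + 1 / 2 * dw) + 1 / 2 * Z j = expect P s (fun σ =>
        a / τ * ((1 / 2 - τ) * (katyushaObj f (pv σ) (R σ j).y - katyushaObj f (pv σ) (θs σ))
          + 1 / 2 * (katyushaObj f (pv σ) (st σ).snap - katyushaObj f (pv σ) (θs σ)))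
          + 1 / 2 * ‖(R σ j).z - θs σ‖ ^ 2) := by
      rw [h.expect_add hm
        ((((hDdep j).const_mul _).add ((hwdep j).const_mul _)).const_mul _) ((hZdep j).const_mul _),
        expect_const_mul, expect_const_mul,
        h.expect_add hm ((hDdep j).const_mul _) ((hwdep j).const_mul _),
        expect_const_mul, expect_const_mul]
    rw [e1, e2, h.expect_update hm (hqB j)]
    swap
    · rw [← hBsucc]
      exact hdep (j + 1) fun p u _ t => a / τ * (katyushaObj f p t.y - katyushaObj f p u)
          + r / 2 * ‖t.z - u‖ ^ 2
    have hupd : ∀ (σ : Q → Fin m) (i : Fin m), ∀ x ∈ (B j : Set Q),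
        Function.update σ (q j) i x = σ x := by
      intro σ i x hx
      refine Function.update_of_ne ?_ _ _
      rintro rfl
      exact hqB j hx
    have hupd' : ∀ σ (i : Fin m),
        (pv (Function.update σ (q j) i) = pv σ ∧ θs (Function.update σ (q j) i) = θs σ) ∧
        R (Function.update σ (q j) i) (j + 1) = katyushaInner f L μ (pv σ) (st σ).snap
          (katyushaFull f μ (st σ).snap) j i (R σ j) := by
      intro σ i
      have hA : ∀ x ∈ (A : Set Q), Function.update σ (q j) i x = σ x := fun x hx =>
        hupd σ i x (hBA j hx)
      refine ⟨⟨hp hA, hθ hA⟩, ?_⟩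
      have h1 : R (Function.update σ (q j) i) j = R σ j := hRdep j (hupd σ i)
      change katyushaInner f L μ (pv (Function.update σ (q j) i))
        (st (Function.update σ (q j) i)).snap
        (katyushaFull f μ (st (Function.update σ (q j) i)).snap) j
        (Function.update σ (q j) i (q j)) (R (Function.update σ (q j) i) j) = _
      rw [h1, hp hA, hst hA, Function.update_self]
    have e3 : (fun σ => avg fun i =>
        a / τ * (katyushaObj f (pv (Function.update σ (q j) i))
            (R (Function.update σ (q j) i) (j + 1)).y
          - katyushaObj f (pv (Function.update σ (q j) i)) (θs (Function.update σ (q j) i)))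
          + r / 2 * ‖(R (Function.update σ (q j) i) (j + 1)).z
            - θs (Function.update σ (q j) i)‖ ^ 2)
        = fun σ => avg fun i =>
        a / τ * (katyushaObj f (pv σ) (katyushaInner f L μ (pv σ) (st σ).snap
          (katyushaFull f μ (st σ).snap) j i (R σ j)).y - katyushaObj f (pv σ) (θs σ))
          + r / 2 * ‖(katyushaInner f L μ (pv σ) (st σ).snap
          (katyushaFull f μ (st σ).snap) j i (R σ j)).z - θs σ‖ ^ 2 := by
      funext σ
      congr 1
      funext i
      rw [(hupd' σ i).1.1, (hupd' σ i).1.2, (hupd' σ i).2]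
    rw [e3]
    refine h.expect_mono hm (A := B j) ?_ ?_ fun σ =>
      katyushaInner_avg_le hm hμ hL hs hc (pv σ) (st σ).snap j (R σ j) (θs σ)
    · exact hdep j fun p u t w => avg fun i =>
        a / τ * (katyushaObj f p (katyushaInner f L μ p t.snap
          (katyushaFull f μ t.snap) j i w).y - katyushaObj f p u)
          + r / 2 * ‖(katyushaInner f L μ p t.snap
          (katyushaFull f μ t.snap) j i w).z - u‖ ^ 2
    · exact hdep j fun p u t w => a / τ * ((1 / 2 - τ) * (katyushaObj f p w.y - katyushaObj f p u)
          + 1 / 2 * (katyushaObj f p t.snap - katyushaObj f p u)) + 1 / 2 * ‖w.z - u‖ ^ 2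
  have htel := katyusha_telescope hr0.le hrec (2 * m)
  -- Jensen's inequality for the new snapshot
  set W := katyushaWeight m L μ with hW
  have hW0 : 0 < W := by
    have := two_mul_le_katyushaWeight hm hμ hL
    have hm1 : (1 : ℝ) ≤ m := by exact_mod_cast hm
    linarith
  let nx : (Q → Fin m) → EpochState d := fun σ =>
    katyushaEpoch f L μ (pv σ) (fun k => σ (q k)) (st σ)
  have hsnap : ∀ σ, (nx σ).snap
      = W⁻¹ • ∑ k ∈ Finset.range (2 * m), r ^ k • (R σ (k + 1)).y := by
    intro σ
    have := katyushaInnerIter_acc (f := f) (L := L) (μ := μ) (pv σ) (st σ).snap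
      (katyushaFull f μ (st σ).snap) (fun k => σ (q k))
      { y := (st σ).y, z := (st σ).z, acc := 0, evals := (st σ).evals + m } (2 * m)
    rw [zero_add] at this
    change W⁻¹ • (R σ (2 * m)).acc = _
    exact congrArg _ this
  have hny : ∀ σ, (nx σ).y = (R σ (2 * m)).y := fun σ => rfl
  have hnz : ∀ σ, (nx σ).z = (R σ (2 * m)).z := fun σ => rfl
  have hnxdep : DependsOn nx (B (2 * m) : Set Q) := by
    intro σ σ' hσ
    have hA : ∀ x ∈ (A : Set Q), σ x = σ' x := fun x hx => hσ x (hBA _ hx)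
    simp only [nx]
    rw [hp hA, hst hA]
    refine katyushaEpoch_congr _ _ fun k hk => hσ _ ?_
    simp only [B, Finset.coe_union, Finset.coe_image]
    exact Or.inr ⟨k, by simpa using hk, rfl⟩
  have hnwdep : DependsOn (fun σ => katyushaObj f (pv σ) (nx σ).snap
      - katyushaObj f (pv σ) (θs σ)) (B (2 * m) : Set Q) := by
    intro σ σ' hσ
    have hA : ∀ x ∈ (A : Set Q), σ x = σ' x := fun x hx => hσ x (hBA _ hx)
    simp only [hp hA, hθ hA, hnxdep hσ]
  set dn : ℝ := expect P s fun σ =>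
    katyushaObj f (pv σ) (nx σ).snap - katyushaObj f (pv σ) (θs σ) with hdn
  have hjen : W * dn ≤ ∑ k ∈ Finset.range (2 * m), r ^ k * D (k + 1) := by
    have e1 : ∑ k ∈ Finset.range (2 * m), r ^ k * D (k + 1) = expect P s fun σ =>
        ∑ k ∈ Finset.range (2 * m), r ^ k *
          (katyushaObj f (pv σ) (R σ (k + 1)).y - katyushaObj f (pv σ) (θs σ)) := by
      rw [h.expect_sum hm (A := B (2 * m))]
      · exact Finset.sum_congr rfl fun k _ => (expect_const_mul _ _).symm
      · intro k hk
        exact ((hDdep (k + 1)).mono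
          (hBmono (by have := Finset.mem_range.1 hk; omega))).const_mul _
    rw [e1, hdn, ← expect_const_mul]
    refine h.expect_mono hm (A := B (2 * m)) (hnwdep.const_mul _) ?_ fun σ => ?_
    · intro σ σ' hσ
      refine Finset.sum_congr rfl fun k hk => ?_
      have := (hDdep (k + 1)) fun x hx =>
        hσ x (hBmono (by have := Finset.mem_range.1 hk; omega) hx)
      simp only [this]
    · rw [hsnap]
      exact katyushaObj_average_le hμ hc (pv σ) (fun k => (pow_pos hr0 k).le) hW0 _ _
  have hgap : ∀ σ θ, 0 ≤ katyushaObj f (pv σ) θ - katyushaObj f (pv σ) (θs σ) := fun σ θ =>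
    (by positivity : 0 ≤ μ / 2 * ‖θ - θs σ‖ ^ 2).trans (norm_sq_le_katyushaObj hm hc (hopt σ) θ)
  have hdn0 : 0 ≤ dn := expect_nonneg fun σ => hgap σ _
  have hDM0 : 0 ≤ D (2 * m) := expect_nonneg fun σ => hgap σ _
  have hZM0 : 0 ≤ Z (2 * m) := expect_nonneg fun σ => sq_nonneg _
  have e1 : expect P s (fun σ => katyushaPotential f L μ (pv σ) (θs σ) (nx σ))
      = a / τ * (1 / 2 * W * dn + (1 / 2 - τ) * D (2 * m)) + 1 / 2 * Z (2 * m) := by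
    simp only [katyushaPotential, hny, hnz]
    rw [h.expect_add hm
      (((hnwdep.const_mul _).add ((hDdep _).const_mul _)).const_mul _) ((hZdep _).const_mul _),
      expect_const_mul, expect_const_mul,
      h.expect_add hm (hnwdep.const_mul _) ((hDdep _).const_mul _),
      expect_const_mul, expect_const_mul]
  have e2 : expect P s (fun σ => katyushaPotential f L μ (pv σ) (θs σ) (st σ))
      = a / τ * (1 / 2 * W * dw + (1 / 2 - τ) * D 0) + 1 / 2 * Z 0 := by
    simp only [katyushaPotential]
    have hD0 := hDdep 0
    have hZ0 := hZdep 0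
    simp only [hD, hZ]
    simp only [R, katyushaInnerIter] at hD0 hZ0 ⊢
    rw [h.expect_add hm
      ((((hwdep 0).const_mul _).add (hD0.const_mul _)).const_mul _) (hZ0.const_mul _),
      expect_const_mul, expect_const_mul, h.expect_add hm ((hwdep 0).const_mul _) (hD0.const_mul _),
      expect_const_mul, expect_const_mul]
  rw [e1, e2]
  refine le_trans ?_ htel
  have hbal := katyushaTau_balance hm hμ hL
  have hpow := one_add_katyushaTau_le_pow hm hμ hL
  rw [← hτ, ← ha, ← hr] at hbal hpow
  have i1 : (1 + τ) * (1 / 2 * W * dn)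
      ≤ (1 - (1 / 2 - τ) * r) * ∑ k ∈ Finset.range (2 * m), r ^ k * D (k + 1) := by
    have := mul_nonneg hW0.le hdn0
    calc (1 + τ) * (1 / 2 * W * dn) = 1 / 2 * (1 + τ) * (W * dn) := by ring
      _ ≤ (1 - (1 / 2 - τ) * r) * (W * dn) := mul_le_mul_of_nonneg_right hbal this
      _ ≤ _ := mul_le_mul_of_nonneg_left hjen (by linarith)
  have i2 : (1 + τ) * ((1 / 2 - τ) * D (2 * m)) ≤ (1 / 2 - τ) * (r ^ (2 * m) * D (2 * m)) := by
    have := mul_le_mul_of_nonneg_right hpow (mul_nonneg (by linarith : 0 ≤ 1 / 2 - τ) hDM0)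
    linarith
  have i3 : (1 + τ) * (1 / 2 * Z (2 * m)) ≤ r ^ (2 * m) / 2 * Z (2 * m) := by
    have := mul_le_mul_of_nonneg_right hpow hZM0
    linarith
  have i4 := mul_le_mul_of_nonneg_left (add_le_add i1 i2) hb0.le
  linarith

/-- `S` epochs of Katyusha decrease the expected squared distance to the minimizer by the factor
`4 (L/μ) (1 + τ)^{-S}`. Start, linear term and minimizer may depend on earlier samples. -/
lemma katyusha_expect [IsProbabilityMeasure P] (h : IsUniformFamily P s)
    (hm : 1 ≤ m) (hμ : 0 < μ) (hL : 0 < L) (hs : ∀ j, IsLSmooth (f j) L)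
    (hc : ∀ j, IsStronglyConvex (f j) μ) {A : Finset Q} {pv θs θ₀ : (Q → Fin m) → Vec d}
    (hp : DependsOn pv (A : Set Q)) (hθ : DependsOn θs (A : Set Q))
    (hθ₀ : DependsOn θ₀ (A : Set Q))
    (hopt : ∀ σ, (1 / m : ℝ) • ∑ j, gradient (f j) (θs σ) = pv σ)
    {q : ℕ → ℕ → Q} (hq : ∀ e j e' j', q e j = q e' j' → e = e' ∧ j = j')
    (hqA : ∀ e j, q e j ∉ A) (S : ℕ) :
    expect P s (fun σ => ‖(katyusha f L μ (pv σ) (fun e k => σ (q e k)) (θ₀ σ) S).snap - θs σ‖ ^ 2)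
      ≤ 4 * (L / μ) / (1 + katyushaTau m L μ) ^ S * expect P s fun σ => ‖θ₀ σ - θs σ‖ ^ 2 := by
  classical
  set τ := katyushaTau m L μ with hτ
  have hτ0 : 0 < τ := katyushaTau_pos hm hμ hL
  have hτ2 : τ ≤ 1 / 2 := katyushaTau_le m L μ
  set a := katyushaStep m L μ with ha
  have ha0 : 0 < a := katyushaStep_pos hm hμ hL
  set W := katyushaWeight m L μ with hW
  have hm1 : (1 : ℝ) ≤ m := by exact_mod_cast hm
  have hW2 : 2 * (m : ℝ) ≤ W := two_mul_le_katyushaWeight hm hμ hL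
  have hW0 : 0 < W := by linarith
  have hb0 : 0 < a / τ := by positivity
  let st : ℕ → (Q → Fin m) → EpochState d := fun e σ =>
    katyusha f L μ (pv σ) (fun e k => σ (q e k)) (θ₀ σ) e
  let B : ℕ → Finset Q := fun e =>
    A ∪ (Finset.range e ×ˢ Finset.range (2 * m)).image fun x => q x.1 x.2
  have hBA : ∀ e, (A : Set Q) ⊆ (B e : Set Q) := fun e => by
    simp only [B, Finset.coe_union]; exact Set.subset_union_left
  have hqB : ∀ e j, q e j ∉ B e := by
    intro e j hj
    simp only [B, Finset.mem_union, Finset.mem_image, Finset.mem_product, Finset.mem_range] at hj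
    rcases hj with hj | ⟨x, hx, hxj⟩
    · exact hqA e j hj
    · exact hx.1.ne (hq _ _ _ _ hxj).1
  have hstdep : ∀ e, DependsOn (st e) (B e : Set Q) := by
    intro e σ σ' hσ
    have hA : ∀ x ∈ (A : Set Q), σ x = σ' x := fun x hx => hσ x (hBA _ hx)
    simp only [st]
    rw [hp hA, hθ₀ hA]
    refine katyusha_congr _ _ fun e' he' k hk => hσ _ ?_
    simp only [B, Finset.coe_union, Finset.coe_image]
    exact Or.inr ⟨(e', k), by simpa using ⟨he', hk⟩, rfl⟩
  have hstep : ∀ e, (1 + τ) * expect P s (fun σ => katyushaPotential f L μ (pv σ) (θs σ)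
      (st (e + 1) σ)) ≤ expect P s fun σ => katyushaPotential f L μ (pv σ) (θs σ) (st e σ) :=
    fun e => katyushaEpoch_expect h hm hμ hL hs hc (hp.mono (hBA e)) (hθ.mono (hBA e)) (hstdep e)
      hopt (q := q e) (fun j j' hj => (hq _ _ _ _ hj).2) (hqB e)
  have hall : ∀ e, (1 + τ) ^ e * expect P s (fun σ => katyushaPotential f L μ (pv σ) (θs σ)
      (st e σ)) ≤ expect P s fun σ => katyushaPotential f L μ (pv σ) (θs σ) (st 0 σ) := by
    intro e
    induction e with
    | zero => simp
    | succ e ih =>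
      refine le_trans ?_ ih
      rw [pow_succ, mul_assoc]
      exact mul_le_mul_of_nonneg_left (hstep e) (by positivity)
  have hgap : ∀ σ θ, μ / 2 * ‖θ - θs σ‖ ^ 2
      ≤ katyushaObj f (pv σ) θ - katyushaObj f (pv σ) (θs σ) := fun σ θ =>
    norm_sq_le_katyushaObj hm hc (hopt σ) θ
  have hgap0 : ∀ σ θ, 0 ≤ katyushaObj f (pv σ) θ - katyushaObj f (pv σ) (θs σ) := fun σ θ =>
    (by positivity : 0 ≤ μ / 2 * ‖θ - θs σ‖ ^ 2).trans (hgap σ θ)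
  -- the potential controls the squared distance of the snapshot from below
  have hlow : ∀ σ, a / τ * (1 / 2 * W) * (μ / 2) * ‖(st S σ).snap - θs σ‖ ^ 2
      ≤ katyushaPotential f L μ (pv σ) (θs σ) (st S σ) := by
    intro σ
    have h1 := mul_le_mul_of_nonneg_left (hgap σ (st S σ).snap)
      (by positivity : 0 ≤ a / τ * (1 / 2 * W))
    have h2 : 0 ≤ a / τ * ((1 / 2 - τ) * (katyushaObj f (pv σ) (st S σ).y
        - katyushaObj f (pv σ) (θs σ))) :=
      mul_nonneg hb0.le (mul_nonneg (by linarith) (hgap0 σ _))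
    have h3 : 0 ≤ 1 / 2 * ‖(st S σ).z - θs σ‖ ^ 2 := by positivity
    rw [katyushaPotential]
    linarith
  -- and from above at the start
  have hup : ∀ σ, katyushaPotential f L μ (pv σ) (θs σ) (st 0 σ)
      ≤ a / τ * (1 / 2 * W) * (4 * (L / 2)) * ‖θ₀ σ - θs σ‖ ^ 2 := by
    intro σ
    change a / τ * (1 / 2 * W * (katyushaObj f (pv σ) (θ₀ σ) - katyushaObj f (pv σ) (θs σ))
      + (1 / 2 - τ) * (katyushaObj f (pv σ) (θ₀ σ) - katyushaObj f (pv σ) (θs σ)))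
      + 1 / 2 * ‖θ₀ σ - θs σ‖ ^ 2 ≤ _
    have h1 := hgap σ (θ₀ σ)
    have h2 := katyushaObj_le_norm_sq hm hs (hopt σ) (θ₀ σ)
    have h0 := hgap0 σ (θ₀ σ)
    set Δ := katyushaObj f (pv σ) (θ₀ σ) - katyushaObj f (pv σ) (θs σ)
    have h3 : 1 ≤ a / τ * W * μ := by
      have h4 := katyushaTau_le_mul hm hμ hL
      rw [← hτ, ← ha] at h4
      rw [show a / τ * W * μ = W * (a * μ) / τ by ring, one_le_div hτ0]
      exact h4.trans (mul_le_mul_of_nonneg_right hW2 (by positivity))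
    have h5 : 1 / 2 * ‖θ₀ σ - θs σ‖ ^ 2 ≤ a / τ * W * Δ := by
      have h6 := mul_le_mul_of_nonneg_left h1 (by positivity : 0 ≤ a / τ * W)
      have h7 := mul_le_mul_of_nonneg_right h3 (by positivity : 0 ≤ 1 / 2 * ‖θ₀ σ - θs σ‖ ^ 2)
      linarith
    have h8 : a / τ * ((1 / 2 - τ) * Δ) ≤ a / τ * (1 / 2 * W * Δ) := by
      refine mul_le_mul_of_nonneg_left (mul_le_mul_of_nonneg_right ?_ h0) hb0.le
      linarith
    have h9 := mul_le_mul_of_nonneg_left h2 (by positivity : 0 ≤ a / τ * (1 / 2 * W) * 4)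
    linarith
  have hBS : ∀ {σ σ' : Q → Fin m}, (∀ x ∈ (B S : Set Q), σ x = σ' x) →
    ∀ x ∈ (A : Set Q), σ x = σ' x := fun hσ x hx => hσ x (hBA _ hx)
  have hB0 : ∀ {σ σ' : Q → Fin m}, (∀ x ∈ (B 0 : Set Q), σ x = σ' x) →
    ∀ x ∈ (A : Set Q), σ x = σ' x := fun hσ x hx => hσ x (hBA _ hx)
  have e1 : a / τ * (1 / 2 * W) * (μ / 2) * expect P s (fun σ => ‖(st S σ).snap - θs σ‖ ^ 2)
      ≤ expect P s fun σ => katyushaPotential f L μ (pv σ) (θs σ) (st S σ) := by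
    rw [← expect_const_mul]
    refine h.expect_mono hm (A := B S) (fun σ σ' hσ => ?_) (fun σ σ' hσ => ?_) hlow
    · simp only [hstdep S hσ, hθ (hBS hσ)]
    · simp only [hstdep S hσ, hθ (hBS hσ), hp (hBS hσ)]
  have e2 : expect P s (fun σ => katyushaPotential f L μ (pv σ) (θs σ) (st 0 σ))
      ≤ a / τ * (1 / 2 * W) * (4 * (L / 2)) * expect P s fun σ => ‖θ₀ σ - θs σ‖ ^ 2 := by
    rw [← expect_const_mul]
    refine h.expect_mono hm (A := B 0) (fun σ σ' hσ => ?_) (fun σ σ' hσ => ?_) hup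
    · simp only [hstdep 0 hσ, hθ (hB0 hσ), hp (hB0 hσ)]
    · simp only [hθ (hB0 hσ), hθ₀ (hB0 hσ)]
  have hpow : 0 < (1 + τ) ^ S := by positivity
  have e3 := (mul_le_mul_of_nonneg_left e1 hpow.le).trans ((hall S).trans e2)
  have hK : 0 < a / τ * (1 / 2 * W) := by positivity
  rw [div_mul_eq_mul_div, le_div_iff₀ hpow, show 4 * (L / μ) * expect P s (fun σ =>
    ‖θ₀ σ - θs σ‖ ^ 2) = 4 * L * expect P s (fun σ => ‖θ₀ σ - θs σ‖ ^ 2) / μ by ring,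
    le_div_iff₀ hμ]
  refine le_of_mul_le_mul_left ?_ hK
  linarith

end KatyushaExpect

/-! ### Inexact accelerated gradient descent with memory -/

section Accelerated

/-- One step of Nesterov's method with the gradient estimate `gh` in place of the gradient `g`. The
point `w` is the auxiliary sequence of the method. The step size is so far below `1/β`, and the
curvature `t² / η = 3α/4` encoded in the momentum so far below `α`, that squares of `gh` and `u - v`
remain as negative terms. -/
lemma accelerated_step {E : Type*} [NormedAddCommGroup E] [InnerProductSpace ℝ E]
    {α β η t Hu Hv Hv' Hξ : ℝ} {u v v' w w' ξ g gh : E} (hα : 0 < α) (hη : 0 < η)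
    (ht : 0 < t) (ht3 : t ≤ 1 / 3) (hβη : β * η = 2 / 15) (htα : t ^ 2 = 3 / 4 * (α * η))
    (hup : Hv' ≤ Hu + inner ℝ g (v' - u) + β / 2 * ‖v' - u‖ ^ 2)
    (hlv : Hu + inner ℝ g (v - u) ≤ Hv)
    (hlξ : Hu + inner ℝ g (ξ - u) + α / 2 * ‖ξ - u‖ ^ 2 ≤ Hξ)
    (hv' : v' = u - η • gh) (hu : (1 + t) • u = v + t • w)
    (hw' : w' = (1 - t) • w + t • u - (η / t) • gh) :
    Hv' - Hξ + 3 * α / 8 * ‖w' - ξ‖ ^ 2 ≤ (1 - t) * (Hv - Hξ + 3 * α / 8 * ‖w - ξ‖ ^ 2)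
      + 5 * (t / α) * ‖gh - g‖ ^ 2 - 3 / 10 * η * ‖gh‖ ^ 2
      - (1 - t) * (t / (4 * η)) * ‖u - v‖ ^ 2 := by
  set ε := gh - g with hε
  have hg : g = gh - ε := by rw [hε, sub_sub_cancel]
  have hαt : 3 * α / 8 = t ^ 2 / η / 2 := by rw [htα]; field_simp; norm_num
  -- the gradient step
  have a1 : Hv' ≤ Hu - η * (1 - 1 / 15) * ‖gh‖ ^ 2 + η * inner ℝ ε gh := by
    have h1 : v' - u = -(η • gh) := by rw [hv']; abel
    rw [h1, inner_neg_right, real_inner_smul_right, norm_neg, norm_smul, mul_pow, Real.norm_eq_abs,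
      sq_abs] at hup
    have h2 : inner ℝ g gh = ‖gh‖ ^ 2 - inner ℝ ε gh := by
      rw [hg, inner_sub_left, real_inner_self_eq_norm_sq]
    have h3 : β / 2 * (η ^ 2 * ‖gh‖ ^ 2) = β * η / 2 * (η * ‖gh‖ ^ 2) := by ring
    rw [h2, h3, hβη] at hup
    linarith
  -- `u - v` and `w - u` are parallel
  have a2 : t • (w - u) = u - v := by
    have : t • (w - u) = (v + t • w) - v - t • u := by rw [smul_sub]; abel
    rw [this, ← hu, add_smul, one_smul]; abel
  have a3 : t ^ 2 * ‖w - u‖ ^ 2 = ‖u - v‖ ^ 2 := by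
    rw [← a2, norm_smul, mul_pow, Real.norm_eq_abs, sq_abs]
  -- expansion of the distance term
  set y := (1 - t) • (w - ξ) + t • (u - ξ) with hy
  have b1 : w' - ξ = y - (η / t) • gh := by
    rw [hw', hy]; module
  have b2 : ‖y‖ ^ 2 = (1 - t) * ‖w - ξ‖ ^ 2 + t * ‖u - ξ‖ ^ 2 - t * (1 - t) * ‖w - u‖ ^ 2 := by
    have h1 : w - u = (w - ξ) - (u - ξ) := by abel
    rw [hy, norm_add_sq_real, h1, norm_sub_sq_real (w - ξ) (u - ξ), norm_smul, norm_smul,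
      real_inner_smul_left, real_inner_smul_right, mul_pow, mul_pow, Real.norm_eq_abs,
      Real.norm_eq_abs, sq_abs, sq_abs]
    ring
  have b3 : ‖w' - ξ‖ ^ 2 = ‖y‖ ^ 2 - 2 * (η / t) * inner ℝ gh y + (η / t) ^ 2 * ‖gh‖ ^ 2 := by
    rw [b1, norm_sub_sq_real, real_inner_smul_right, norm_smul, mul_pow, Real.norm_eq_abs, sq_abs,
      real_inner_comm]
    ring
  have b4 : t * inner ℝ gh y = (1 - t) * inner ℝ gh (u - v) + t * inner ℝ gh (u - ξ) := by
    have h1 : t • y = (1 - t) • (u - v) + t • (u - ξ) := by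
      rw [← a2, hy]; module
    rw [← real_inner_smul_right gh y t, h1, inner_add_right, real_inner_smul_right,
      real_inner_smul_right]
  have b5 : 3 * α / 8 * ‖w' - ξ‖ ^ 2 = 3 * α / 8 * ‖y‖ ^ 2
      - ((1 - t) * inner ℝ gh (u - v) + t * inner ℝ gh (u - ξ)) + η / 2 * ‖gh‖ ^ 2 := by
    rw [b3, ← b4, hαt]; field_simp
  have b6 : 3 * α / 8 * (t * (1 - t) * ‖w - u‖ ^ 2)
      = (1 - t) * (t / (2 * η)) * ‖u - v‖ ^ 2 := by
    rw [hαt, ← a3]; field_simp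
  -- inner products with the error
  have c1 : inner ℝ g (v - u) = - inner ℝ gh (u - v) + inner ℝ ε (u - v) := by
    rw [hg, inner_sub_left, ← neg_sub u v, inner_neg_right, inner_neg_right]; ring
  have c2 : inner ℝ g (ξ - u) = - inner ℝ gh (u - ξ) + inner ℝ ε (u - ξ) := by
    rw [hg, inner_sub_left, ← neg_sub u ξ, inner_neg_right, inner_neg_right]; ring
  rw [c1] at hlv
  rw [c2, norm_sub_rev ξ u] at hlξ
  have young : ∀ (x : E) (a : ℝ), 0 < a →
      |inner ℝ ε x| ≤ a * ‖x‖ ^ 2 + 1 / (4 * a) * ‖ε‖ ^ 2 := by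
    intro x a ha
    refine (abs_real_inner_le_norm ε x).trans ?_
    have h1 : a * ‖x‖ ^ 2 + 1 / (4 * a) * ‖ε‖ ^ 2 - ‖ε‖ * ‖x‖
        = 1 / (4 * a) * (2 * a * ‖x‖ - ‖ε‖) ^ 2 := by field_simp; ring
    have h2 : 0 ≤ 1 / (4 * a) * (2 * a * ‖x‖ - ‖ε‖) ^ 2 := by positivity
    linarith
  -- the weights use part of the three quadratic terms that the method leaves
  have d1 := (le_abs_self _).trans (young gh (2 / 15) (by norm_num))
  have d2 := (neg_le_abs _).trans (young (u - v) (t / (4 * η)) (by positivity))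
  have d3 := (neg_le_abs _).trans (young (u - ξ) (α / 8) (by positivity))
  have k1 : 1 / (4 * (2 / 15)) * η ≤ t / α := by
    have : η = 4 / 3 * t * (t / α) := by
      have h4 : η = t ^ 2 * 4 / (3 * α) := by rw [htα]; field_simp
      rw [h4]; field_simp
    have h5 : 0 < t / α := by positivity
    calc 1 / (4 * (2 / 15)) * η = (5 / 2 * t) * (t / α) := by
          conv_lhs => rw [this]
          ring
      _ ≤ 1 * (t / α) := mul_le_mul_of_nonneg_right (by linarith) h5.le
      _ = t / α := one_mul _
  have k2 : 1 / (4 * (t / (4 * η))) = 4 / 3 * (t / α) := by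
    have h4 : η = t ^ 2 * 4 / (3 * α) := by rw [htα]; field_simp
    rw [h4]; field_simp
  have k3 : t * (1 / (4 * (α / 8))) = 2 * (t / α) := by field_simp; norm_num
  have e1 := mul_le_mul_of_nonneg_left d1 hη.le
  have e2 := mul_le_mul_of_nonneg_left d2 (by linarith : 0 ≤ 1 - t)
  have e3 := mul_le_mul_of_nonneg_left d3 ht.le
  have f2 := mul_le_mul_of_nonneg_left hlv (by linarith : 0 ≤ 1 - t)
  have f3 := mul_le_mul_of_nonneg_left hlξ ht.le
  have hεn : 0 ≤ t / α * ‖ε‖ ^ 2 := by positivity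
  have g1 : η * (1 / (4 * (2 / 15)) * ‖ε‖ ^ 2) ≤ t / α * ‖ε‖ ^ 2 := by
    have := mul_le_mul_of_nonneg_right k1 (sq_nonneg ‖ε‖)
    linarith
  have g2 : (1 - t) * (1 / (4 * (t / (4 * η))) * ‖ε‖ ^ 2) ≤ 4 / 3 * (t / α * ‖ε‖ ^ 2) := by
    rw [k2]
    have := mul_nonneg ht.le hεn
    linarith
  have g3 : t * (1 / (4 * (α / 8)) * ‖ε‖ ^ 2) = 2 * (t / α * ‖ε‖ ^ 2) := by
    rw [← mul_assoc, k3]; ring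
  rw [b5, b2]
  rw [mul_add, g3] at e3
  rw [mul_add] at e1 e2
  clear_value ε y
  linear_combination a1 + f2 + f3 + e1 + e2 + e3 + g1 + g2 - b6 + 2 / 3 * hεn

/-- Interchange of summation for a discrete convolution with geometric weights. -/
lemma sum_weighted_memory_le {q W : ℝ} {wt δ : ℕ → ℝ} (hq : 0 < q) (hδ : ∀ j, 0 ≤ δ j)
    (hW : ∀ T, ∑ s ∈ Finset.range T, q ^ (s + 1) * wt (s + 1) ≤ W) (K : ℕ) :
    ∑ k ∈ Finset.range (K + 1), q ^ (k + 1) * ∑ j ∈ Finset.range k, wt (k - j) * δ j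
      ≤ W * ∑ j ∈ Finset.range K, q ^ (j + 1) * δ j := by
  have h1 : ∑ k ∈ Finset.range (K + 1), q ^ (k + 1) * ∑ j ∈ Finset.range k, wt (k - j) * δ j
      = ∑ j ∈ Finset.range (K + 1), ∑ k ∈ Finset.Ico (j + 1) (K + 1),
        q ^ (k + 1) * (wt (k - j) * δ j) := by
    simp only [Finset.mul_sum, Finset.range_eq_Ico]
    rw [Finset.sum_Ico_Ico_comm']
  rw [h1, Finset.sum_range_succ, Finset.Ico_self, Finset.sum_empty, add_zero, Finset.mul_sum]
  refine Finset.sum_le_sum fun j _ => ?_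
  rw [Finset.sum_Ico_eq_sum_range]
  have h2 : ∀ s ∈ Finset.range (K + 1 - (j + 1)),
      q ^ (j + 1 + s + 1) * (wt (j + 1 + s - j) * δ j)
        = (q ^ (j + 1) * δ j) * (q ^ (s + 1) * wt (s + 1)) := by
    intro s _
    rw [show j + 1 + s - j = s + 1 by omega]
    ring
  rw [Finset.sum_congr rfl h2, ← Finset.mul_sum, mul_comm W]
  exact mul_le_mul_of_nonneg_left (hW _) (mul_nonneg (pow_pos hq _).le (hδ j))

/-- Linear convergence of a recursion whose error terms are a memory of earlier increments `δ`, when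
the increments are dominated by the negative terms of the recursion and the memory has small
weighted mass. -/
lemma linear_convergence_of_memory {t M W ca cb s η : ℝ} {wt φ a b δ : ℕ → ℝ} (ht0 : 0 < t)
    (ht1 : t < 1) (hM : 0 ≤ M) (hs : 0 ≤ s) (hW0 : 0 ≤ W) (ha : ∀ k, 0 ≤ a k) (hb : ∀ k, 0 ≤ b k)
    (hδ : ∀ k, 0 ≤ δ k)
    (hW : ∀ T, ∑ s ∈ Finset.range T, (1 / (1 - t)) ^ (s + 1) * wt (s + 1) ≤ W)
    (hrec : ∀ k, φ (k + 1) ≤ (1 - t) * φ k + M * ∑ j ∈ Finset.range k, wt (k - j) * δ j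
      - ca * a k - cb * b k)
    (hδab : ∀ j, δ j ≤ s * (2 * b (j + 1) + 2 * η ^ 2 * a j))
    (hcb : 2 * M * W * s ≤ cb) (hca : 2 * M * W * s * η ^ 2 ≤ ca) (K : ℕ) :
    φ K ≤ (1 - t) ^ K * φ 0 := by
  set q := 1 / (1 - t) with hq
  have h1t : 0 < 1 - t := by linarith
  have hq1 : 1 ≤ q := by rw [hq, one_le_div h1t]; linarith
  have hq0 : 0 < q := by linarith
  have hqt : q * (1 - t) = 1 := by rw [hq, one_div, inv_mul_cancel₀ h1t.ne']
  have htel : ∀ K, q ^ K * φ K ≤ φ 0 + ∑ k ∈ Finset.range K, q ^ (k + 1) *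
      (M * ∑ j ∈ Finset.range k, wt (k - j) * δ j - ca * a k - cb * b k) := by
    intro K
    induction K with
    | zero => simp
    | succ K ih =>
      rw [Finset.sum_range_succ]
      have h1 := mul_le_mul_of_nonneg_left (hrec K) (pow_pos hq0 (K + 1)).le
      have h2 : q ^ (K + 1) * ((1 - t) * φ K) = q ^ K * φ K := by
        rw [pow_succ, mul_assoc, ← mul_assoc q, hqt, one_mul]
      linarith
  have hN : 0 ≤ 2 * M * W * s := by positivity
  have hsum : ∑ k ∈ Finset.range K, q ^ (k + 1) *
      (M * ∑ j ∈ Finset.range k, wt (k - j) * δ j - ca * a k - cb * b k) ≤ 0 := by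
    rcases K with _ | K
    · simp
    have h1 := sum_weighted_memory_le hq0 hδ hW K
    have h2 : ∑ j ∈ Finset.range K, q ^ (j + 1) * δ j
        ≤ 2 * s * ∑ k ∈ Finset.range (K + 1), q ^ (k + 1) * b k
          + 2 * s * η ^ 2 * ∑ k ∈ Finset.range (K + 1), q ^ (k + 1) * a k := by
      have h3 : ∑ j ∈ Finset.range K, q ^ (j + 1) * δ j ≤ ∑ j ∈ Finset.range K,
          (2 * s * (q ^ (j + 1 + 1) * b (j + 1)) + 2 * s * η ^ 2 * (q ^ (j + 1) * a j)) := by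
        refine Finset.sum_le_sum fun j _ => ?_
        have h4 := mul_le_mul_of_nonneg_left (hδab j) (pow_pos hq0 (j + 1)).le
        have h5 : q ^ (j + 1) * b (j + 1) ≤ q ^ (j + 1 + 1) * b (j + 1) :=
          mul_le_mul_of_nonneg_right (pow_le_pow_right₀ hq1 (Nat.le_succ _)) (hb _)
        have h6 := mul_le_mul_of_nonneg_left h5 (by positivity : 0 ≤ 2 * s)
        linarith
      refine h3.trans ?_
      rw [Finset.sum_add_distrib, ← Finset.mul_sum, ← Finset.mul_sum]
      refine add_le_add (mul_le_mul_of_nonneg_left ?_ (by positivity))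
        (mul_le_mul_of_nonneg_left ?_ (by positivity))
      · rw [Finset.sum_range_succ' (fun k => q ^ (k + 1) * b k)]
        exact le_add_of_nonneg_right (mul_nonneg (pow_pos hq0 _).le (hb 0))
      · rw [Finset.sum_range_succ]
        exact le_add_of_nonneg_right (mul_nonneg (pow_pos hq0 _).le (ha K))
    have h7 : ∑ k ∈ Finset.range (K + 1), q ^ (k + 1) *
        (M * ∑ j ∈ Finset.range k, wt (k - j) * δ j - ca * a k - cb * b k)
        = M * ∑ k ∈ Finset.range (K + 1), q ^ (k + 1) * ∑ j ∈ Finset.range k, wt (k - j) * δ j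
          - ca * ∑ k ∈ Finset.range (K + 1), q ^ (k + 1) * a k
          - cb * ∑ k ∈ Finset.range (K + 1), q ^ (k + 1) * b k := by
      simp only [Finset.mul_sum (s := Finset.range (K + 1)), ← Finset.sum_sub_distrib]
      exact Finset.sum_congr rfl fun k _ => by ring
    have hA : 0 ≤ ∑ k ∈ Finset.range (K + 1), q ^ (k + 1) * a k :=
      Finset.sum_nonneg fun k _ => mul_nonneg (pow_pos hq0 _).le (ha k)
    have hB : 0 ≤ ∑ k ∈ Finset.range (K + 1), q ^ (k + 1) * b k :=
      Finset.sum_nonneg fun k _ => mul_nonneg (pow_pos hq0 _).le (hb k)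
    rw [h7]
    have h8 := mul_le_mul_of_nonneg_left (h1.trans (mul_le_mul_of_nonneg_left h2 hW0)) hM
    have h9 := mul_le_mul_of_nonneg_right hcb hB
    have h10 := mul_le_mul_of_nonneg_right hca hA
    linarith
  have h1 := (htel K).trans (add_le_of_nonpos_right hsum)
  have h2 : (1 - t) ^ K * (q ^ K * φ K) = φ K := by
    rw [← mul_assoc, ← mul_pow, mul_comm (1 - t), hqt, one_pow, one_mul]
  rw [← h2]
  exact mul_le_mul_of_nonneg_left h1 (pow_pos h1t K).le

end Accelerated

/-! ### Multiplication by matrices from the right -/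

section Rmul

variable {n d : ℕ} {M : Matrix (Fin n) (Fin n) ℝ}

/-- The rows of a matrix given by its columns. -/
def row (X : Cols n d) (a : Fin d) : Fin n → ℝ := fun j => X j a

lemma row_rmul (X : Cols n d) (A : Matrix (Fin n) (Fin n) ℝ) (a : Fin d) :
    row (rmul X A) a = Aᵀ *ᵥ row X a := by
  funext i
  simp [row, rmul, Matrix.mulVec, dotProduct, WithLp.ofLp_sum]

lemma cols_ext {X Y : Cols n d} (h : ∀ a, row X a = row Y a) : X = Y := by
  funext i
  ext a
  exact congrFun (h a) i

lemma ip_eq_sum_row (X Y : Cols n d) : ip X Y = ∑ a, row X a ⬝ᵥ row Y a := by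
  simp only [ip, row, dotProduct, PiLp.inner_apply]
  rw [Finset.sum_comm]
  simp [mul_comm]

lemma sqn_eq_ip (X : Cols n d) : sqn X = ip X X := by
  simp only [sqn, ip, real_inner_self_eq_norm_sq]

lemma sqn_eq_sum_row (X : Cols n d) : sqn X = ∑ a, row X a ⬝ᵥ row X a := by
  rw [sqn_eq_ip, ip_eq_sum_row]

lemma rmul_rmul (X : Cols n d) (A B : Matrix (Fin n) (Fin n) ℝ) :
    rmul (rmul X A) B = rmul X (A * B) := by
  refine cols_ext fun a => ?_
  rw [row_rmul, row_rmul, row_rmul, mulVec_mulVec, transpose_mul]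

lemma rmul_add (X Y : Cols n d) (A : Matrix (Fin n) (Fin n) ℝ) :
    rmul (X + Y) A = rmul X A + rmul Y A := by
  funext i; simp [rmul, Finset.sum_add_distrib]

lemma rmul_sub (X Y : Cols n d) (A : Matrix (Fin n) (Fin n) ℝ) :
    rmul (X - Y) A = rmul X A - rmul Y A := by
  funext i; simp [rmul, smul_sub]

lemma rmul_smul (a : ℝ) (X : Cols n d) (A : Matrix (Fin n) (Fin n) ℝ) :
    rmul (a • X) A = a • rmul X A := by
  funext i
  simp only [rmul, Pi.smul_apply, Finset.smul_sum]
  exact Finset.sum_congr rfl fun j _ => smul_comm _ _ _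

lemma rmul_zero (A : Matrix (Fin n) (Fin n) ℝ) : rmul (0 : Cols n d) A = 0 := by
  funext i; simp [rmul]

lemma ip_rmul_msqrt (X Y : Cols n d) (M : Matrix (Fin n) (Fin n) ℝ) :
    ip X (rmul Y (msqrt M)) = ip (rmul X (msqrt M)) Y := by
  rw [ip_eq_sum_row, ip_eq_sum_row]
  refine Finset.sum_congr rfl fun a _ => ?_
  rw [row_rmul, row_rmul, dotProduct_mulVec, ← mulVec_transpose, transpose_transpose,
    msqrt_transpose]

lemma sqn_rmul_msqrt (h : M.PosSemidef) (X : Cols n d) :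
    sqn (rmul X (msqrt M)) = ∑ a, row X a ⬝ᵥ (M *ᵥ row X a) := by
  rw [sqn_eq_sum_row]
  refine Finset.sum_congr rfl fun a _ => ?_
  rw [row_rmul, msqrt_transpose, msqrt_mulVec_dotProduct h]

lemma sqn_rmul_msqrt_le (h : M.PosSemidef) (X : Cols n d) :
    sqn (rmul X (msqrt M)) ≤ sigma M 1 * sqn X := by
  rw [sqn_rmul_msqrt h, sqn_eq_sum_row, Finset.mul_sum]
  exact Finset.sum_le_sum fun a _ => dotProduct_mulVec_le h.1 _

lemma sum_row_eq_zero {X : Cols n d} (hX : ∑ i, X i = 0) (a : Fin d) : ∑ i, row X a i = 0 := by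
  have := congrArg (fun v : Vec d => v a) hX
  simpa [row, WithLp.ofLp_sum] using this

lemma sum_eq_zero_of_row {X : Cols n d} (hX : ∀ a, ∑ i, row X a i = 0) : ∑ i, X i = 0 := by
  ext a
  simpa [row, WithLp.ofLp_sum] using hX a

lemma IsLaplacian.le_sqn_rmul_msqrt (h : IsLaplacian M) (hn : 2 ≤ n) {X : Cols n d}
    (hX : ∑ i, X i = 0) : sigma M (n - 1) * sqn X ≤ sqn (rmul X (msqrt M)) := by
  rw [sqn_rmul_msqrt h.posSemidef, sqn_eq_sum_row, Finset.mul_sum]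
  exact Finset.sum_le_sum fun a _ => h.le_dotProduct_mulVec hn (sum_row_eq_zero hX a)

lemma IsLaplacian.msqrt_mulVec_const (h : IsLaplacian M) (a : ℝ) :
    msqrt M *ᵥ (fun _ => a) = 0 := by
  rw [msqrt_mulVec_eq_zero_iff h.posSemidef, h.null]
  exact ⟨a, rfl⟩

lemma IsLaplacian.sum_rmul_msqrt (h : IsLaplacian M) (X : Cols n d) :
    ∑ i, rmul X (msqrt M) i = 0 := by
  refine sum_eq_zero_of_row fun a => ?_
  rw [row_rmul]
  have h1 : ∑ i, ((msqrt M)ᵀ *ᵥ row X a) i = (fun _ => 1) ⬝ᵥ ((msqrt M)ᵀ *ᵥ row X a) := by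
    simp [dotProduct]
  rw [h1, dotProduct_mulVec, ← mulVec_transpose, transpose_transpose, h.msqrt_mulVec_const,
    zero_dotProduct]

/-- `X ↦ X √M` maps the matrices whose columns sum to zero onto themselves. -/
lemma IsLaplacian.exists_rmul_msqrt (h : IsLaplacian M) (hn : 2 ≤ n) {Y : Cols n d}
    (hY : ∑ i, Y i = 0) : ∃ X : Cols n d, ∑ i, X i = 0 ∧ rmul X (msqrt M) = Y := by
  choose u hu using fun a => h.exists_msqrt_mulVec (sum_row_eq_zero hY a)
  -- subtract the mean, which the square root annihilates
  let c : Fin d → ℝ := fun a => (∑ i, u a i) / n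
  have hn0 : (n : ℝ) ≠ 0 := by positivity
  let X : Cols n d := fun i => WithLp.toLp 2 fun a => u a i - c a
  have hrow : ∀ a, row X a = u a - fun _ => c a := fun a => rfl
  refine ⟨X, sum_eq_zero_of_row fun a => ?_, cols_ext fun a => ?_⟩
  · rw [hrow]
    simp only [Pi.sub_apply, Finset.sum_sub_distrib, Finset.sum_const, Finset.card_univ,
      Fintype.card_fin, nsmul_eq_mul, c]
    rw [mul_div_cancel₀ _ hn0, sub_self]
  · rw [row_rmul, msqrt_transpose, hrow, mulVec_sub, hu, h.msqrt_mulVec_const, sub_zero]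

/-- The Euclidean space `ℝ^{d×n}` with the Frobenius norm. -/
abbrev ColsVec (n d : ℕ) : Type := PiLp 2 fun _ : Fin n => Vec d

/-- A matrix given by its columns, as a vector of the Euclidean space `ℝ^{d×n}`. -/
def colsVec (X : Cols n d) : ColsVec n d := WithLp.toLp 2 X

lemma norm_colsVec_sq (X : Cols n d) : ‖colsVec X‖ ^ 2 = sqn X :=
  PiLp.norm_sq_eq_of_L2 _ _

lemma inner_colsVec (X Y : Cols n d) : inner ℝ (colsVec X) (colsVec Y) = ip X Y :=
  PiLp.inner_apply _ _

lemma sqn_sub_comm (X Y : Cols n d) : sqn (X - Y) = sqn (Y - X) := by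
  simp only [sqn, Pi.sub_apply, norm_sub_rev]

lemma sqn_sub_le (X Y Z : Cols n d) : sqn (X - Z) ≤ 2 * sqn (X - Y) + 2 * sqn (Y - Z) := by
  simp only [sqn, Pi.sub_apply, Finset.mul_sum]
  rw [← Finset.sum_add_distrib]
  refine Finset.sum_le_sum fun i _ => ?_
  have h1 := norm_sub_le_norm_sub_add_norm_sub (X i) (Y i) (Z i)
  nlinarith [norm_nonneg (X i - Z i), sq_nonneg (‖X i - Y i‖ - ‖Y i - Z i‖),
    norm_nonneg (X i - Y i), norm_nonneg (Y i - Z i)]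

end Rmul

/-! ### The dual problem -/

namespace Data

variable {n m d : ℕ} {p : Data n m d}

lemma continuous_conjCols (hm : 1 ≤ m) (hd : 1 ≤ d) (hf : p.SmoothStronglyConvex) :
    Continuous (conjCols p.F) := by
  have : conjCols p.F = fun Y => ∑ i, conj (p.fLocal i) (Y i) := funext (conjCols_F hm hd hf)
  rw [this]
  refine continuous_finsetSum _ fun i _ => ?_
  suffices hconj : Continuous (conj (p.fLocal i)) from hconj.comp (continuous_apply i)
  refine continuous_iff_continuousAt.2 fun y => ?_
  obtain ⟨x, rfl⟩ := exists_gradient_eq (hf i).1 (isLSmooth_fLocal hm hf i).1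
    (isStronglyConvex_fLocal hm hf i) y
  exact (hasGradientAt_conj (hf i).1 (L_pos hm hd hf i) (isLSmooth_fLocal hm hf i)
    (isStronglyConvex_fLocal hm hf i) x).continuousAt

/-- The conjugate `F^*` attains its minimum on the matrices whose columns sum to zero. -/
lemma exists_minimizer (hn : 2 ≤ n) (hm : 1 ≤ m) (hd : 1 ≤ d) (hf : p.SmoothStronglyConvex) :
    ∃ Y : Cols n d, ∑ i, Y i = 0 ∧ ∀ Y' : Cols n d, ∑ i, Y' i = 0 →
      conjCols p.F Y ≤ conjCols p.F Y' := by
  let ψ : ColsVec n d → ℝ := fun x => conjCols p.F x.ofLp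
  have hcont : Continuous ψ :=
    (continuous_conjCols hm hd hf).comp (PiLp.continuous_ofLp 2 _)
  have hclosed : IsClosed {x : ColsVec n d | ∑ i, x i = 0} :=
    isClosed_eq (by fun_prop) continuous_const
  have hL : 0 < p.Lmax := (muMin_pos hn hf).trans_le (muMin_le_Lmax hn hm hd hf)
  -- strong convexity makes the conjugate coercive
  have hev : ∀ᶠ x in Filter.cocompact (ColsVec n d), ψ 0 ≤ ψ x := by
    refine eventually_le_of_quadratic_lower_bound (μ := 1 / p.Lmax) (by positivity) (ψ 0)
      (colsVec (p.gradConj 0)) fun x => ?_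
    have h1 := conjCols_lower hm hd hf 0 x.ofLp
    rw [sub_zero] at h1
    have h2 : inner ℝ (colsVec (p.gradConj 0)) x = ip (p.gradConj 0) x.ofLp :=
      inner_colsVec _ x.ofLp
    have h3 : ‖x‖ ^ 2 = sqn x.ofLp := norm_colsVec_sq x.ofLp
    rw [h2, h3]
    have h4 : 1 / p.Lmax / 2 = 1 / (2 * p.Lmax) := by field_simp
    rw [h4]
    exact h1
  obtain ⟨x, hx, hmin⟩ := hcont.continuousOn.exists_isMinOn' hclosed
    (show (0 : ColsVec n d) ∈ {x : ColsVec n d | ∑ i, x i = 0} by simp)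
    (hev.filter_mono inf_le_left)
  exact ⟨x.ofLp, hx, fun Y' hY' => hmin
    (show colsVec Y' ∈ {x : ColsVec n d | ∑ i, x i = 0} from hY')⟩

end Data

/-! ### The parameters -/

lemma sum_pow_succ_le {x : ℝ} (hx : 0 ≤ x) (hx2 : x ≤ 1 / 2) (T : ℕ) :
    ∑ s ∈ Finset.range T, x ^ (s + 1) ≤ 2 * x := by
  have h : ∑ s ∈ Finset.range T, x ^ (s + 1) ≤ 2 * x - 2 * x ^ (T + 1) := by
    induction T with
    | zero => simp
    | succ T ih =>
      rw [Finset.sum_range_succ, pow_succ x (T + 1)]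
      have := pow_nonneg hx (T + 1)
      nlinarith
  have := pow_nonneg hx (T + 1)
  linarith

namespace Data

variable {n m d : ℕ} {p : Data n m d}

/-- `1 / √(10 κ')`, the contraction rate of the accelerated method. -/
noncomputable def rate (p : Data n m d) : ℝ := 1 / Real.sqrt (10 * p.kappa')

/-- The weight of the increment `s` iterations ago in the lazy condition, up to `3 / μ_min²`. -/
noncomputable def memWeight (p : Data n m d) (s : ℕ) : ℝ :=
  (if p.D < s then p.c ^ (s - p.D) else 0) + p.c ^ s + if s ≤ p.D then p.c + p.gamma else 0

lemma isLaplacian_PK (hn : 2 ≤ n) (hU : IsLaplacian p.U) : IsLaplacian p.PK :=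
  isLaplacian_chebGossip hU hn

lemma sigma_PK_pos (hn : 2 ≤ n) (hU : IsLaplacian p.U) :
    0 < sigma p.PK (n - 1) ∧ 0 < sigma p.PK 1 :=
  ⟨(isLaplacian_PK hn hU).sigma_pos hn,
    ((isLaplacian_PK hn hU).sigma_pos hn).trans_le ((isLaplacian_PK hn hU).sigma_le hn)⟩

lemma Lmax_pos (hn : 2 ≤ n) (hm : 1 ≤ m) (hd : 1 ≤ d) (hf : p.SmoothStronglyConvex) :
    0 < p.Lmax := (muMin_pos hn hf).trans_le (muMin_le_Lmax hn hm hd hf)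

lemma one_le_kappaF (hn : 2 ≤ n) (hm : 1 ≤ m) (hd : 1 ≤ d) (hf : p.SmoothStronglyConvex) :
    1 ≤ p.kappaF := (one_le_div (muMin_pos hn hf)).2 (muMin_le_Lmax hn hm hd hf)

lemma kappaF_le_kappa' (hn : 2 ≤ n) (hm : 1 ≤ m) (hd : 1 ≤ d) (hU : IsLaplacian p.U)
    (hf : p.SmoothStronglyConvex) : p.kappaF ≤ p.kappa' :=
  le_div_self (zero_le_one.trans (one_le_kappaF hn hm hd hf)) ((isLaplacian_PK hn hU).zeta_pos hn)
    ((isLaplacian_PK hn hU).zeta_le_one hn)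

lemma kappa'_le (hn : 2 ≤ n) (hm : 1 ≤ m) (hd : 1 ≤ d) (hU : IsLaplacian p.U)
    (hf : p.SmoothStronglyConvex) : p.kappa' ≤ 4 * p.kappaF := by
  have h1 := one_le_kappaF hn hm hd hf
  have h2 : 1 / 4 ≤ zeta p.PK := zeta_chebGossip hU hn
  rw [kappa', div_le_iff₀ ((isLaplacian_PK hn hU).zeta_pos hn)]
  nlinarith

lemma alpha_pos (hn : 2 ≤ n) (hm : 1 ≤ m) (hd : 1 ≤ d) (hU : IsLaplacian p.U)
    (hf : p.SmoothStronglyConvex) : 0 < p.alpha :=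
  div_pos (sigma_PK_pos hn hU).1 (Lmax_pos hn hm hd hf)

lemma beta_pos (hn : 2 ≤ n) (hU : IsLaplacian p.U)
    (hf : p.SmoothStronglyConvex) : 0 < p.beta :=
  div_pos (sigma_PK_pos hn hU).2 (muMin_pos hn hf)

lemma eta_pos (hn : 2 ≤ n) (hU : IsLaplacian p.U)
    (hf : p.SmoothStronglyConvex) : 0 < p.eta := by
  have := beta_pos hn hU hf
  rw [eta]; positivity

lemma beta_mul_eta (hn : 2 ≤ n) (hU : IsLaplacian p.U)
    (hf : p.SmoothStronglyConvex) : p.beta * p.eta = 2 / 15 := by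
  have := beta_pos hn hU hf
  rw [eta]; field_simp

lemma kappa'_mul_alpha (hn : 2 ≤ n) (hm : 1 ≤ m) (hd : 1 ≤ d) (hU : IsLaplacian p.U)
    (hf : p.SmoothStronglyConvex) : p.kappa' * p.alpha = p.beta := by
  have h1 := sigma_PK_pos hn hU
  have h2 := Lmax_pos hn hm hd hf
  have h3 := muMin_pos hn hf
  rw [kappa', alpha, beta, kappaF, zeta]
  field_simp [h1.1.ne', h1.2.ne']

lemma one_le_kappa' (hn : 2 ≤ n) (hm : 1 ≤ m) (hd : 1 ≤ d) (hU : IsLaplacian p.U)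
    (hf : p.SmoothStronglyConvex) : 1 ≤ p.kappa' :=
  (one_le_kappaF hn hm hd hf).trans (kappaF_le_kappa' hn hm hd hU hf)

lemma rate_pos (hn : 2 ≤ n) (hm : 1 ≤ m) (hd : 1 ≤ d) (hU : IsLaplacian p.U)
    (hf : p.SmoothStronglyConvex) : 0 < p.rate := by
  have := one_le_kappa' hn hm hd hU hf
  rw [rate]; positivity

lemma rate_sq (hn : 2 ≤ n) (hm : 1 ≤ m) (hd : 1 ≤ d) (hU : IsLaplacian p.U)
    (hf : p.SmoothStronglyConvex) : p.rate ^ 2 = 1 / (10 * p.kappa') := by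
  have := one_le_kappa' hn hm hd hU hf
  rw [rate, div_pow, one_pow, Real.sq_sqrt (by linarith)]

lemma rate_sq_eq (hn : 2 ≤ n) (hm : 1 ≤ m) (hd : 1 ≤ d) (hU : IsLaplacian p.U)
    (hf : p.SmoothStronglyConvex) : p.rate ^ 2 = 3 / 4 * (p.alpha * p.eta) := by
  have h1 := one_le_kappa' hn hm hd hU hf
  have h2 := alpha_pos hn hm hd hU hf
  rw [rate_sq hn hm hd hU hf, eta, ← kappa'_mul_alpha hn hm hd hU hf]
  field_simp
  norm_num

lemma rate_le (hn : 2 ≤ n) (hm : 1 ≤ m) (hd : 1 ≤ d) (hU : IsLaplacian p.U)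
    (hf : p.SmoothStronglyConvex) : p.rate ≤ 1 / 3 := by
  have h1 := one_le_kappa' hn hm hd hU hf
  have h2 := rate_sq hn hm hd hU hf
  have h3 : 1 / (10 * p.kappa') ≤ 1 / 10 := by
    apply one_div_le_one_div_of_le <;> linarith
  nlinarith [rate_pos hn hm hd hU hf]

lemma momentum_eq (hn : 2 ≤ n) (hm : 1 ≤ m) (hd : 1 ≤ d) (hU : IsLaplacian p.U)
    (hf : p.SmoothStronglyConvex) : p.momentum = (1 - p.rate) / (1 + p.rate) := by
  have h1 := one_le_kappa' hn hm hd hU hf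
  have h2 : 0 < Real.sqrt (10 * p.kappa') := Real.sqrt_pos.2 (by linarith)
  rw [momentum, rate]
  field_simp

/-- `α'β'μ_min² / ‖√P‖⁴ ≤ 1/κ'`, because the trace of `P` is at least `σ_1(P)`. -/
lemma alpha_beta_div_frobNorm (hn : 2 ≤ n) (hm : 1 ≤ m) (hd : 1 ≤ d) (hU : IsLaplacian p.U)
    (hf : p.SmoothStronglyConvex) : 0 < frobNorm (msqrt p.PK) ∧
    p.alpha * p.beta * p.muMin ^ 2 / frobNorm (msqrt p.PK) ^ 4 ≤ 1 / p.kappa' := by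
  have h1 := sigma_PK_pos hn hU
  have h2 := Lmax_pos hn hm hd hf
  have h3 := muMin_pos hn hf
  have hP := (isLaplacian_PK hn hU).posSemidef
  have htr : sigma p.PK 1 ≤ frobNorm (msqrt p.PK) ^ 2 := by
    rw [frobNorm_msqrt_sq hP]; exact sigma_one_le_trace hP (by omega)
  have hF0 : 0 ≤ frobNorm (msqrt p.PK) := Real.sqrt_nonneg _
  have hF : 0 < frobNorm (msqrt p.PK) := by
    rcases hF0.eq_or_lt with h | h
    · rw [← h] at htr; simp at htr; linarith [h1.2]
    · exact h
  refine ⟨hF, ?_⟩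
  have h4 : sigma p.PK 1 ^ 2 ≤ frobNorm (msqrt p.PK) ^ 4 := by
    calc sigma p.PK 1 ^ 2 ≤ (frobNorm (msqrt p.PK) ^ 2) ^ 2 := pow_le_pow_left₀ h1.2.le htr 2
      _ = _ := by ring
  have h5 : 1 / p.kappa' = sigma p.PK (n - 1) * p.muMin / (p.Lmax * sigma p.PK 1) := by
    rw [kappa', kappaF, zeta]
    have := h1.1.ne'
    have := h1.2.ne'
    field_simp
  have h6 : p.alpha * p.beta * p.muMin ^ 2
      = sigma p.PK (n - 1) * p.muMin / (p.Lmax * sigma p.PK 1) * sigma p.PK 1 ^ 2 := by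
    rw [alpha, beta]
    have := h1.2.ne'
    field_simp
  rw [div_le_iff₀ (by positivity), h5, h6]
  exact mul_le_mul_of_nonneg_left h4 (by have := h1.1; have := h1.2; positivity)

lemma c_pos (hn : 2 ≤ n) (hm : 1 ≤ m) (hd : 1 ≤ d) (hD : 1 ≤ p.D) (hU : IsLaplacian p.U)
    (hf : p.SmoothStronglyConvex) : 0 < p.c := by
  have h1 := alpha_pos hn hm hd hU hf
  have h2 := beta_pos hn hU hf
  have h3 := muMin_pos hn hf
  have h4 := (alpha_beta_div_frobNorm hn hm hd hU hf).1
  have h5 : (0 : ℝ) < p.D := by exact_mod_cast hD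
  rw [c]; positivity

lemma gamma_pos (hn : 2 ≤ n) (hm : 1 ≤ m) (hd : 1 ≤ d) (hD : 1 ≤ p.D) (hU : IsLaplacian p.U)
    (hf : p.SmoothStronglyConvex) : 0 < p.gamma := by
  have h1 := alpha_pos hn hm hd hU hf
  have h2 := beta_pos hn hU hf
  have h3 := muMin_pos hn hf
  have h4 := (alpha_beta_div_frobNorm hn hm hd hU hf).1
  have h5 : (0 : ℝ) < p.D := by exact_mod_cast hD
  rw [gamma]; positivity

lemma c_le (hn : 2 ≤ n) (hm : 1 ≤ m) (hd : 1 ≤ d) (hD : 1 ≤ p.D) (hU : IsLaplacian p.U)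
    (hf : p.SmoothStronglyConvex) :
    p.c ≤ 1 / (1200 * p.D * p.kappa') * Real.exp (-(2 * (p.D + 1) / Real.sqrt p.kappaF)) := by
  have h1 := (alpha_beta_div_frobNorm hn hm hd hU hf).2
  have h5 : (0 : ℝ) < p.D := by exact_mod_cast hD
  rw [c]
  refine mul_le_mul_of_nonneg_right ?_ (Real.exp_pos _).le
  calc p.alpha * p.beta * p.muMin ^ 2 / (1200 * p.D * frobNorm (msqrt p.PK) ^ 4)
      = 1 / (1200 * p.D) * (p.alpha * p.beta * p.muMin ^ 2 / frobNorm (msqrt p.PK) ^ 4) := by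
        rw [div_mul_div_comm, one_mul]
    _ ≤ 1 / (1200 * p.D) * (1 / p.kappa') := mul_le_mul_of_nonneg_left h1 (by positivity)
    _ = _ := by rw [div_mul_div_comm, one_mul]

lemma gamma_le (hn : 2 ≤ n) (hm : 1 ≤ m) (hd : 1 ≤ d) (hD : 1 ≤ p.D) (hU : IsLaplacian p.U)
    (hf : p.SmoothStronglyConvex) :
    p.gamma ≤ 1 / (288 * p.D * p.kappa') * Real.exp (-(2 * p.D / Real.sqrt p.kappaF)) := by
  have h1 := (alpha_beta_div_frobNorm hn hm hd hU hf).2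
  have h5 : (0 : ℝ) < p.D := by exact_mod_cast hD
  rw [gamma]
  refine mul_le_mul_of_nonneg_right ?_ (Real.exp_pos _).le
  calc p.alpha * p.beta * p.muMin ^ 2 / (288 * p.D * frobNorm (msqrt p.PK) ^ 4)
      = 1 / (288 * p.D) * (p.alpha * p.beta * p.muMin ^ 2 / frobNorm (msqrt p.PK) ^ 4) := by
        rw [div_mul_div_comm, one_mul]
    _ ≤ 1 / (288 * p.D) * (1 / p.kappa') := mul_le_mul_of_nonneg_left h1 (by positivity)
    _ = _ := by rw [div_mul_div_comm, one_mul]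

lemma c_le_const (hn : 2 ≤ n) (hm : 1 ≤ m) (hd : 1 ≤ d) (hD : 1 ≤ p.D) (hU : IsLaplacian p.U)
    (hf : p.SmoothStronglyConvex) : p.c ≤ 1 / 1200 := by
  have h1 := one_le_kappa' hn hm hd hU hf
  have h2 : (1 : ℝ) ≤ p.D := by exact_mod_cast hD
  have h3 : Real.exp (-(2 * (p.D + 1) / Real.sqrt p.kappaF)) ≤ 1 :=
    Real.exp_le_one_iff.2 (by rw [neg_nonpos]; positivity)
  have h4 : 1 / (1200 * p.D * p.kappa') ≤ 1 / 1200 :=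
    one_div_le_one_div_of_le (by norm_num) (by nlinarith)
  have h5 : 0 ≤ 1 / (1200 * p.D * p.kappa') := by positivity
  calc p.c ≤ _ := c_le hn hm hd hD hU hf
    _ ≤ 1 / (1200 * p.D * p.kappa') * 1 := mul_le_mul_of_nonneg_left h3 h5
    _ ≤ 1 / 1200 := by rw [mul_one]; exact h4

/-- The growth `(1 - t)^{-k}` is dominated by the exponential factors in `c` and `γ`. -/
lemma inv_one_sub_rate_pow_le (hn : 2 ≤ n) (hm : 1 ≤ m) (hd : 1 ≤ d) (hU : IsLaplacian p.U)
    (hf : p.SmoothStronglyConvex) (k : ℕ) :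
    (1 / (1 - p.rate)) ^ k ≤ Real.exp (2 * k / Real.sqrt p.kappaF) := by
  have h1 := rate_pos hn hm hd hU hf
  have h2 := rate_le hn hm hd hU hf
  have h3 : 1 / (1 - p.rate) ≤ Real.exp (2 * p.rate) := by
    refine le_trans ?_ (Real.add_one_le_exp _)
    rw [div_le_iff₀ (by linarith)]
    nlinarith
  have h4 : p.rate ≤ 1 / Real.sqrt p.kappaF := by
    have h5 := one_le_kappaF hn hm hd hf
    refine one_div_le_one_div_of_le (Real.sqrt_pos.2 (by linarith)) (Real.sqrt_le_sqrt ?_)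
    have := kappaF_le_kappa' hn hm hd hU hf
    linarith
  calc (1 / (1 - p.rate)) ^ k ≤ Real.exp (2 * p.rate) ^ k :=
        pow_le_pow_left₀ (by apply one_div_nonneg.2; linarith) h3 k
    _ = Real.exp (k * (2 * p.rate)) := (Real.exp_nat_mul _ _).symm
    _ ≤ _ := by
      refine Real.exp_le_exp.2 ?_
      have h6 : 2 * (k : ℝ) / Real.sqrt p.kappaF = k * (2 * (1 / Real.sqrt p.kappaF)) := by ring
      rw [h6]
      gcongr

/-- The mass of the memory, weighted with the growth of the Lyapunov function. -/
lemma sum_memWeight_le (hn : 2 ≤ n) (hm : 1 ≤ m) (hd : 1 ≤ d) (hD : 1 ≤ p.D)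
    (hU : IsLaplacian p.U) (hf : p.SmoothStronglyConvex) (T : ℕ) :
    ∑ s ∈ Finset.range T, (1 / (1 - p.rate)) ^ (s + 1) * p.memWeight (s + 1)
      ≤ 1 / (130 * p.kappa') := by
  set q := 1 / (1 - p.rate) with hq
  have hr0 := rate_pos hn hm hd hU hf
  have hr1 := rate_le hn hm hd hU hf
  have hq1 : 1 ≤ q := by rw [hq, one_le_div (by linarith)]; linarith
  have hq0 : 0 < q := by linarith
  have hc0 := c_pos hn hm hd hD hU hf
  have hg0 := gamma_pos hn hm hd hD hU hf
  have hk1 := one_le_kappa' hn hm hd hU hf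
  have hD1 : (1 : ℝ) ≤ p.D := by exact_mod_cast hD
  set X := 1 / (1200 * p.D * p.kappa') with hX
  have hX0 : 0 < X := by positivity
  have hXk : p.D * X = 1 / (1200 * p.kappa') := by rw [hX]; field_simp
  have hXle : X ≤ 1 / (1200 * p.kappa') := by rw [← hXk]; nlinarith
  have hX2 : X ≤ 1 / 2 := hXle.trans (one_div_le_one_div_of_le (by norm_num) (by linarith))
  have hcD : q ^ (p.D + 1) * p.c ≤ X := by
    have h1 := inv_one_sub_rate_pow_le hn hm hd hU hf (p.D + 1)
    push_cast at h1
    calc q ^ (p.D + 1) * p.c ≤ Real.exp (2 * (p.D + 1) / Real.sqrt p.kappaF) *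
          (X * Real.exp (-(2 * (p.D + 1) / Real.sqrt p.kappaF))) :=
        mul_le_mul h1 (c_le hn hm hd hD hU hf) hc0.le (Real.exp_pos _).le
      _ = X := by rw [mul_left_comm, ← Real.exp_add, add_neg_cancel, Real.exp_zero, mul_one]
  have hgD : p.D * (q ^ p.D * p.gamma) ≤ 1 / (288 * p.kappa') := by
    have h1 := inv_one_sub_rate_pow_le hn hm hd hU hf p.D
    have h2 : q ^ p.D * p.gamma ≤ 1 / (288 * p.D * p.kappa') := by
      calc q ^ p.D * p.gamma ≤ Real.exp (2 * p.D / Real.sqrt p.kappaF) *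
          (1 / (288 * p.D * p.kappa') * Real.exp (-(2 * p.D / Real.sqrt p.kappaF))) :=
          mul_le_mul h1 (gamma_le hn hm hd hD hU hf) hg0.le (Real.exp_pos _).le
        _ = _ := by rw [mul_left_comm, ← Real.exp_add, add_neg_cancel, Real.exp_zero, mul_one]
    calc p.D * (q ^ p.D * p.gamma) ≤ p.D * (1 / (288 * p.D * p.kappa')) :=
          mul_le_mul_of_nonneg_left h2 (by positivity)
      _ = _ := by field_simp
  have hqc0 : 0 ≤ q * p.c := by positivity
  have hqDc : q ^ p.D * (q * p.c) ≤ X := by rw [← mul_assoc, ← pow_succ]; exact hcD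
  have hqc : q * p.c ≤ X :=
    (le_mul_of_one_le_left hqc0 (one_le_pow₀ hq1)).trans hqDc
  have hqDc' : q ^ p.D * p.c ≤ X :=
    (mul_le_mul_of_nonneg_right (pow_le_pow_right₀ hq1 (Nat.le_succ _)) hc0.le).trans hcD
  -- the three parts of the memory
  have s1 : ∑ s ∈ Finset.range T, q ^ (s + 1) * (if p.D < s + 1 then p.c ^ (s + 1 - p.D) else 0)
      ≤ 2 * X := by
    have h1 : ∑ s ∈ Finset.range T,
        q ^ (s + 1) * (if p.D < s + 1 then p.c ^ (s + 1 - p.D) else 0)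
        = ∑ s ∈ Finset.Ico p.D T, q ^ (s + 1) * p.c ^ (s + 1 - p.D) := by
      simp only [mul_ite, mul_zero]
      rw [← Finset.sum_filter]
      refine Finset.sum_congr ?_ fun _ _ => rfl
      ext s
      simp only [Finset.mem_filter, Finset.mem_range, Finset.mem_Ico]
      omega
    rw [h1, Finset.sum_Ico_eq_sum_range]
    have h2 : ∀ i ∈ Finset.range (T - p.D), q ^ (p.D + i + 1) * p.c ^ (p.D + i + 1 - p.D)
        = q ^ p.D * (q * p.c) ^ (i + 1) := by
      intro i _
      rw [show p.D + i + 1 - p.D = i + 1 by omega, mul_pow, ← mul_assoc, ← pow_add, ← add_assoc]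
    rw [Finset.sum_congr rfl h2, ← Finset.mul_sum]
    calc q ^ p.D * ∑ i ∈ Finset.range (T - p.D), (q * p.c) ^ (i + 1)
        ≤ q ^ p.D * (2 * (q * p.c)) :=
          mul_le_mul_of_nonneg_left (sum_pow_succ_le hqc0 (hqc.trans hX2) _) (by positivity)
      _ ≤ 2 * X := by linarith
  have s2 : ∑ s ∈ Finset.range T, q ^ (s + 1) * p.c ^ (s + 1) ≤ 2 * X := by
    simp only [← mul_pow]
    exact (sum_pow_succ_le hqc0 (hqc.trans hX2) T).trans (by linarith)
  have s3 : ∑ s ∈ Finset.range T, q ^ (s + 1) * (if s + 1 ≤ p.D then p.c + p.gamma else 0)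
      ≤ 1 / (1200 * p.kappa') + 1 / (288 * p.kappa') := by
    simp only [mul_ite, mul_zero]
    rw [← Finset.sum_filter]
    calc ∑ s ∈ Finset.range T with s + 1 ≤ p.D, q ^ (s + 1) * (p.c + p.gamma)
        ≤ ∑ _s ∈ Finset.range p.D, q ^ p.D * (p.c + p.gamma) := by
          refine (Finset.sum_le_sum (g := fun _ => q ^ p.D * (p.c + p.gamma)) fun s hs => ?_).trans
            (Finset.sum_le_sum_of_subset_of_nonneg ?_ fun _ _ _ => by positivity)
          · exact mul_le_mul_of_nonneg_right
              (pow_le_pow_right₀ hq1 (Finset.mem_filter.1 hs).2) (by positivity)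
          · intro s hs
            have := (Finset.mem_filter.1 hs).2
            exact Finset.mem_range.2 (by omega)
      _ = p.D * (q ^ p.D * p.c) + p.D * (q ^ p.D * p.gamma) := by
          rw [Finset.sum_const, Finset.card_range, nsmul_eq_mul]; ring
      _ ≤ _ := by
          refine add_le_add ?_ hgD
          rw [← hXk]
          exact mul_le_mul_of_nonneg_left hqDc' (by positivity)
  have hsum : ∑ s ∈ Finset.range T, q ^ (s + 1) * p.memWeight (s + 1)
      = ∑ s ∈ Finset.range T, q ^ (s + 1) * (if p.D < s + 1 then p.c ^ (s + 1 - p.D) else 0)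
        + ∑ s ∈ Finset.range T, q ^ (s + 1) * p.c ^ (s + 1)
        + ∑ s ∈ Finset.range T, q ^ (s + 1) * (if s + 1 ≤ p.D then p.c + p.gamma else 0) := by
    simp only [memWeight, mul_add, Finset.sum_add_distrib]
  rw [hsum]
  have e1 : 1 / (1200 * p.kappa') = 1 / 1200 * (1 / p.kappa') := by rw [div_mul_div_comm, one_mul]
  have e2 : 1 / (288 * p.kappa') = 1 / 288 * (1 / p.kappa') := by rw [div_mul_div_comm, one_mul]
  have e3 : 1 / (130 * p.kappa') = 1 / 130 * (1 / p.kappa') := by rw [div_mul_div_comm, one_mul]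
  have e4 : 0 < 1 / p.kappa' := by positivity
  rw [e1] at hXle s3
  rw [e2] at s3
  rw [e3]
  -- `5 / 1200 + 1 / 288 ≤ 1 / 130`
  linarith

lemma one_le_log (hn : 2 ≤ n) (hm : 1 ≤ m) (hd : 1 ≤ d) (hD : 1 ≤ p.D) (hU : IsLaplacian p.U)
    (hf : p.SmoothStronglyConvex) : 1 ≤ Real.log (2 * p.kappaMax / p.c) := by
  have h1 := c_pos hn hm hd hD hU hf
  have h2 := c_le_const hn hm hd hD hU hf
  have h3 := one_le_kappaMax hn hm hd hf
  rw [Real.le_log_iff_exp_le (by positivity), le_div_iff₀ h1]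
  have := Real.exp_one_lt_d9
  nlinarith [Real.exp_pos 1]

/-- With the prescribed number of epochs, a call of Katyusha contracts the expected squared distance
to the minimizer by the factor `c / 2`. -/
lemma katyusha_factor_le (hn : 2 ≤ n) (hm : 1 ≤ m) (hd : 1 ≤ d) (hD : 1 ≤ p.D)
    (hU : IsLaplacian p.U) (hf : p.SmoothStronglyConvex) (i : Fin n) :
    2 * (4 * (p.L i / p.μ i) / (1 + katyushaTau m (p.L i) (p.μ i)) ^ p.epochs 16) ≤ p.c := by
  have hL := L_pos hm hd hf i
  have hμ := (hf i).1
  set τ := katyushaTau m (p.L i) (p.μ i) with hτ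
  have hτ0 : 0 < τ := katyushaTau_pos hm hμ hL
  have hτ2 : τ ≤ 1 / 2 := katyushaTau_le _ _ _
  have hc0 := c_pos hn hm hd hD hU hf
  have hc1 := c_le_const hn hm hd hD hU hf
  have hκ1 := one_le_kappaMax hn hm hd hf
  have hκi := p.le_kappaMax i
  have hm0 : (0 : ℝ) < m := by exact_mod_cast hm
  set κ := p.kappaMax with hκ
  set l := Real.log (2 * κ / p.c) with hl
  have hl1 : 1 ≤ l := one_le_log hn hm hd hD hU hf
  -- the number of epochs outweighs the rate of Katyusha
  have hτκ : 1 / 2 ≤ (1 + Real.sqrt (κ / m)) * τ := by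
    rcases min_choice (Real.sqrt (2 * m * p.μ i / (3 * p.L i))) (1 / 2) with h | h
    · have h1 : τ = Real.sqrt (2 * m * p.μ i / (3 * p.L i)) := h
      have h2 : Real.sqrt (1 / 4) ≤ Real.sqrt (κ / m) * τ := by
        rw [h1, ← Real.sqrt_mul (by positivity)]
        refine Real.sqrt_le_sqrt ?_
        have h3 : κ / m * (2 * m * p.μ i / (3 * p.L i)) = 2 / 3 * (κ / (p.L i / p.μ i)) := by
          field_simp
        rw [h3]
        have h4 : 1 ≤ κ / (p.L i / p.μ i) := (one_le_div (by positivity)).2 hκi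
        linarith
      have h5 : Real.sqrt (1 / 4) = 1 / 2 := by
        rw [show (1 / 4 : ℝ) = (1 / 2) ^ 2 by norm_num, Real.sqrt_sq (by norm_num)]
      rw [h5] at h2
      linarith
    · have h1 : τ = 1 / 2 := h
      have h2 : 0 ≤ Real.sqrt (κ / m) := Real.sqrt_nonneg _
      rw [h1]; linarith
  have hS : 16 * (1 + Real.sqrt (κ / m)) * l ≤ p.epochs 16 := Nat.le_ceil _
  have hlog : τ / 2 ≤ Real.log (1 + τ) := by
    have h1 := Real.one_sub_inv_le_log_of_pos (by linarith : 0 < 1 + τ)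
    have h2 : 1 - (1 + τ)⁻¹ = τ / (1 + τ) := by field_simp; ring
    rw [h2] at h1
    refine le_trans ?_ h1
    exact div_le_div_of_nonneg_left hτ0.le (by linarith) (by linarith)
  have hSl : 4 * l ≤ p.epochs 16 * Real.log (1 + τ) := by
    calc 4 * l = (16 * l) * (1 / 2) / 2 := by ring
      _ ≤ (16 * l) * ((1 + Real.sqrt (κ / m)) * τ) / 2 := by gcongr
      _ = (16 * (1 + Real.sqrt (κ / m)) * l) * (τ / 2) := by ring
      _ ≤ p.epochs 16 * Real.log (1 + τ) := by gcongr
  have hpow : (2 * κ / p.c) ^ 4 ≤ (1 + τ) ^ p.epochs 16 := by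
    rw [← Real.log_le_log_iff (by positivity) (by positivity), Real.log_pow, Real.log_pow]
    exact_mod_cast hSl
  have hx : 1 ≤ (2 * κ / p.c) := by rw [one_le_div hc0]; linarith
  have hκi0 : 0 < p.L i / p.μ i := by positivity
  rw [← mul_div_assoc, div_le_iff₀ (by positivity)]
  have h1 : 2 * (4 * (p.L i / p.μ i)) ≤ p.c * (2 * κ / p.c) ^ 2 := by
    have h2 : p.c * (2 * κ / p.c) ^ 2 = 4 * κ ^ 2 / p.c := by field_simp; ring
    rw [h2, le_div_iff₀ hc0]
    nlinarith
  refine h1.trans (mul_le_mul_of_nonneg_left (le_trans ?_ hpow) hc0.le)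
  exact pow_le_pow_right₀ hx (by norm_num)

end Data

/-! ### The run of the algorithm as a function of the samples -/

namespace Data

variable {n m d : ℕ}

/-- The run of MDLAG as a function of all samples, which are indexed by iteration, worker, epoch and
inner step. -/
noncomputable def runOf (p : Data n m d) (σ : ℕ × Fin n × ℕ × ℕ → Fin m) (k : ℕ) : State n d :=
  p.run 16 (fun k i s j => σ (k, i, s, j)) k

/-- The extrapolated point `x^k`. -/
noncomputable def xIter (p : Data n m d) (σ : ℕ × Fin n × ℕ × ℕ → Fin m) (k : ℕ) : Cols n d :=
  (p.runOf σ k).hist k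

/-- A finite set that contains all samples used in the first `k` iterations. -/
noncomputable def sampleSet (p : Data n m d) (k : ℕ) : Finset (ℕ × Fin n × ℕ × ℕ) :=
  Finset.range (k + 1) ×ˢ (Finset.univ ×ˢ (Finset.range (p.epochs 16) ×ˢ Finset.range (2 * m)))

/-- Points `u^k` and `v^k` with `x^k = u^k √P` and `y^k = v^k √P`. In terms of them the algorithm is
Nesterov's method for `u ↦ F^*(u √P)` with gradient estimates `Θ̂^k √P`. -/
noncomputable def lift (p : Data n m d) (σ : ℕ × Fin n × ℕ × ℕ → Fin m) :
    ℕ → Cols n d × Cols n d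
  | 0 => (0, 0)
  | k + 1 =>
    let v' := (p.lift σ k).1 - p.eta • rmul (p.runOf σ k).thetaHat (msqrt p.PK)
    (v' + p.momentum • (v' - (p.lift σ k).2), v')

variable {p : Data n m d} (σ : ℕ × Fin n × ℕ × ℕ → Fin m)

lemma hist_succ {j k : ℕ} (hj : j ≤ k) : (p.runOf σ (k + 1)).hist j = (p.runOf σ k).hist j := by
  change Function.update (p.runOf σ k).hist (k + 1) _ j = _
  exact Function.update_of_ne (by omega) _ _

lemma hist_eq {j k : ℕ} (hj : j ≤ k) : (p.runOf σ k).hist j = p.xIter σ j := by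
  induction k, hj using Nat.le_induction with
  | base => rfl
  | succ k hk ih => rw [hist_succ σ hk, ih]

lemma y_zero : (p.runOf σ 0).y = 0 := rfl

lemma y_succ (k : ℕ) : (p.runOf σ (k + 1)).y
    = p.xIter σ k - p.eta • rmul (p.runOf σ k).thetaHat p.PK := rfl

lemma xIter_succ (k : ℕ) : p.xIter σ (k + 1) = (p.runOf σ (k + 1)).y
    + p.momentum • ((p.runOf σ (k + 1)).y - (p.runOf σ k).y) := by
  change Function.update (p.runOf σ k).hist (k + 1) _ (k + 1) = _
  rw [Function.update_self]
  rfl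

lemma theta_zero : (p.runOf σ 0).theta = p.gradConj (p.xIter σ 0) := rfl

lemma thetaHat_zero : (p.runOf σ 0).thetaHat = (p.runOf σ 0).theta := rfl

lemma theta_succ (k : ℕ) (i : Fin n) : (p.runOf σ (k + 1)).theta i
    = (katyusha (p.f i) (p.L i) (p.μ i) (p.xIter σ (k + 1) i) (fun s j => σ (k + 1, i, s, j))
      ((p.runOf σ k).theta i) (p.epochs 16)).snap := by
  rw [xIter_succ]
  rfl

lemma evals_succ (k : ℕ) : (p.runOf σ (k + 1)).evals
    = (p.runOf σ k).evals + n * (p.epochs 16 * (5 * m)) := by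
  change (p.runOf σ k).evals + ∑ i, (katyusha (p.f i) (p.L i) (p.μ i) _ _ _ (p.epochs 16)).evals = _
  simp only [katyusha_evals, Finset.sum_const, Finset.card_univ, Fintype.card_fin, smul_eq_mul]

/-- The right-hand side of the lazy condition is a convolution with `memWeight`. -/
lemma lazy_rhs_eq (k : ℕ) (δ : ℕ → ℝ) :
    3 * ∑ j ∈ Finset.range (k - p.D), p.c ^ (k - p.D - j) / p.muMin ^ 2 * δ j
    + 3 * ∑ j ∈ Finset.range k, p.c ^ (k - j) / p.muMin ^ 2 * δ j
    + 3 * ∑ j ∈ Finset.Ico (k - p.D) k, p.c / p.muMin ^ 2 * δ j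
    + 3 * ∑ j ∈ Finset.Ico (k - p.D) k, p.gamma / p.muMin ^ 2 * δ j
      = 3 / p.muMin ^ 2 * ∑ j ∈ Finset.range k, p.memWeight (k - j) * δ j := by
  have h1 : ∑ j ∈ Finset.range (k - p.D), p.c ^ (k - p.D - j) / p.muMin ^ 2 * δ j
      = 1 / p.muMin ^ 2 * ∑ j ∈ Finset.range k,
        (if p.D < k - j then p.c ^ (k - j - p.D) else 0) * δ j := by
    simp only [ite_mul, zero_mul]
    rw [← Finset.sum_filter, Finset.mul_sum]
    refine Finset.sum_congr ?_ fun j _ => ?_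
    · ext j; simp only [Finset.mem_filter, Finset.mem_range]; omega
    · rw [show k - p.D - j = k - j - p.D by omega]; ring
  have h2 : ∀ a : ℝ, ∑ j ∈ Finset.Ico (k - p.D) k, a / p.muMin ^ 2 * δ j
      = 1 / p.muMin ^ 2 * ∑ j ∈ Finset.range k, (if k - j ≤ p.D then a else 0) * δ j := by
    intro a
    simp only [ite_mul, zero_mul]
    rw [← Finset.sum_filter, Finset.mul_sum]
    refine Finset.sum_congr ?_ fun j _ => by ring
    ext j; simp only [Finset.mem_filter, Finset.mem_range, Finset.mem_Ico]; omega
  have h3 : ∑ j ∈ Finset.range k, p.c ^ (k - j) / p.muMin ^ 2 * δ j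
      = 1 / p.muMin ^ 2 * ∑ j ∈ Finset.range k, p.c ^ (k - j) * δ j := by
    rw [Finset.mul_sum]; exact Finset.sum_congr rfl fun j _ => by ring
  have h4 : ∀ s, (if s ≤ p.D then p.c + p.gamma else 0)
      = (if s ≤ p.D then p.c else 0) + (if s ≤ p.D then p.gamma else 0) := by
    intro s; split_ifs <;> simp
  rw [h1, h2, h2, h3]
  simp only [memWeight, h4, add_mul, Finset.sum_add_distrib]
  ring

lemma memWeight_ge (hn : 2 ≤ n) (hm : 1 ≤ m) (hd : 1 ≤ d) (hD : 1 ≤ p.D)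
    (hU : IsLaplacian p.U) (hf : p.SmoothStronglyConvex) (s : ℕ) : p.c ^ s ≤ p.memWeight s := by
  have h1 := c_pos hn hm hd hD hU hf
  have h2 := gamma_pos hn hm hd hD hU hf
  rw [memWeight]
  have h3 : 0 ≤ if p.D < s then p.c ^ (s - p.D) else 0 := by split_ifs <;> positivity
  have h4 : 0 ≤ if s ≤ p.D then p.c + p.gamma else 0 := by split_ifs <;> positivity
  linarith

/-- Whether or not a worker communicates, its cache is close to its fresh vector. -/
lemma norm_thetaHat_sub_theta_le (hn : 2 ≤ n) (hm : 1 ≤ m) (hd : 1 ≤ d) (hD : 1 ≤ p.D)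
    (hU : IsLaplacian p.U) (hf : p.SmoothStronglyConvex) (k : ℕ) (i : Fin n) :
    ‖(p.runOf σ k).thetaHat i - (p.runOf σ k).theta i‖ ^ 2 ≤ 3 / p.muMin ^ 2 *
      ∑ j ∈ Finset.range k, p.memWeight (k - j) * ‖p.xIter σ j i - p.xIter σ (j + 1) i‖ ^ 2 := by
  have hw : ∀ s, 0 ≤ p.memWeight s := fun s =>
    (pow_pos (c_pos hn hm hd hD hU hf) s).le.trans (memWeight_ge hn hm hd hD hU hf s)
  have hnn : 0 ≤ 3 / p.muMin ^ 2 *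
      ∑ j ∈ Finset.range k, p.memWeight (k - j) * ‖p.xIter σ j i - p.xIter σ (j + 1) i‖ ^ 2 :=
    mul_nonneg (by positivity) (Finset.sum_nonneg fun j _ => mul_nonneg (hw _) (sq_nonneg _))
  rcases k with _ | k
  · rw [thetaHat_zero, sub_self]; simp
  · have hstep : (p.runOf σ (k + 1)).thetaHat i = (p.runOf σ (k + 1)).theta i ∨
        ((p.runOf σ (k + 1)).thetaHat i = (p.runOf σ k).thetaHat i ∧
          p.Lazy (k + 1) ((p.runOf σ k).thetaHat i) ((p.runOf σ (k + 1)).theta i)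
            fun j => (p.runOf σ (k + 1)).hist j i) := by
      change (p.step 16 k _ (p.runOf σ k)).thetaHat i = (p.step 16 k _ (p.runOf σ k)).theta i ∨
        ((p.step 16 k _ (p.runOf σ k)).thetaHat i = _ ∧
          p.Lazy (k + 1) _ ((p.step 16 k _ (p.runOf σ k)).theta i)
            fun j => (p.step 16 k _ (p.runOf σ k)).hist j i)
      simp only [step]
      split_ifs with h
      · exact Or.inl rfl
      · right
        rw [not_or, not_not] at h
        exact ⟨rfl, h.1⟩
    rcases hstep with h | ⟨h, hlazy⟩
    · rw [h, sub_self]; simpa using hnn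
    · rw [h]
      unfold Lazy at hlazy
      rw [lazy_rhs_eq] at hlazy
      refine hlazy.trans (le_of_eq ?_)
      congr 1
      refine Finset.sum_congr rfl fun j hj => ?_
      have := Finset.mem_range.1 hj
      simp only
      rw [hist_eq σ (show j ≤ k + 1 by omega), hist_eq σ (show j + 1 ≤ k + 1 by omega)]

lemma sqn_thetaHat_sub_theta_le (hn : 2 ≤ n) (hm : 1 ≤ m) (hd : 1 ≤ d) (hD : 1 ≤ p.D)
    (hU : IsLaplacian p.U) (hf : p.SmoothStronglyConvex) (k : ℕ) :
    sqn ((p.runOf σ k).thetaHat - (p.runOf σ k).theta) ≤ 3 / p.muMin ^ 2 *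
      ∑ j ∈ Finset.range k, p.memWeight (k - j) * sqn (p.xIter σ j - p.xIter σ (j + 1)) := by
  refine (Finset.sum_le_sum fun i _ =>
    norm_thetaHat_sub_theta_le σ hn hm hd hD hU hf k i).trans (le_of_eq ?_)
  rw [← Finset.mul_sum, Finset.sum_comm]
  simp only [sqn, Finset.mul_sum, Pi.sub_apply]

lemma rmul_lift (hn : 2 ≤ n) (hU : IsLaplacian p.U) (k : ℕ) :
    rmul (p.lift σ k).1 (msqrt p.PK) = p.xIter σ k ∧
      rmul (p.lift σ k).2 (msqrt p.PK) = (p.runOf σ k).y := by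
  induction k with
  | zero => exact ⟨rmul_zero _, rmul_zero _⟩
  | succ k ih =>
    have h2 : rmul (p.lift σ (k + 1)).2 (msqrt p.PK) = (p.runOf σ (k + 1)).y := by
      change rmul ((p.lift σ k).1 - p.eta • rmul (p.runOf σ k).thetaHat (msqrt p.PK)) _ = _
      rw [rmul_sub, rmul_smul, rmul_rmul, msqrt_mul_msqrt (isLaplacian_PK hn hU).posSemidef, ih.1,
        y_succ]
    refine ⟨?_, h2⟩
    change rmul ((p.lift σ (k + 1)).2 + p.momentum • ((p.lift σ (k + 1)).2 - (p.lift σ k).2)) _ = _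
    rw [rmul_add, rmul_smul, rmul_sub, h2, ih.2, xIter_succ]

lemma sum_lift (hn : 2 ≤ n) (hU : IsLaplacian p.U) (k : ℕ) :
    ∑ i, (p.lift σ k).1 i = 0 ∧ ∑ i, (p.lift σ k).2 i = 0 := by
  induction k with
  | zero => simp [lift]
  | succ k ih =>
    have h2 : ∑ i, (p.lift σ (k + 1)).2 i = 0 := by
      change ∑ i, ((p.lift σ k).1 - p.eta • rmul (p.runOf σ k).thetaHat (msqrt p.PK)) i = 0
      simp only [Pi.sub_apply, Pi.smul_apply, Finset.sum_sub_distrib, ← Finset.smul_sum]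
      rw [ih.1, (isLaplacian_PK hn hU).sum_rmul_msqrt, smul_zero, sub_zero]
    refine ⟨?_, h2⟩
    change ∑ i, ((p.lift σ (k + 1)).2 + p.momentum •
      ((p.lift σ (k + 1)).2 - (p.lift σ k).2)) i = 0
    simp only [Pi.add_apply, Pi.sub_apply, Pi.smul_apply, Finset.sum_add_distrib,
      Finset.sum_sub_distrib, ← Finset.smul_sum]
    rw [h2, ih.2, sub_zero, smul_zero, add_zero]

lemma sampleSet_mono {j k : ℕ} (h : j ≤ k) :
    (p.sampleSet j : Set (ℕ × Fin n × ℕ × ℕ)) ⊆ p.sampleSet k := by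
  intro q hq
  simp only [sampleSet, Finset.mem_coe, Finset.mem_product, Finset.mem_range, Finset.mem_univ,
    true_and] at hq ⊢
  exact ⟨by omega, hq.2⟩

lemma dependsOn_runOf (k : ℕ) : DependsOn (fun σ => p.runOf σ k)
    (p.sampleSet k : Set (ℕ × Fin n × ℕ × ℕ)) := by
  induction k with
  | zero => exact fun _ _ _ => rfl
  | succ k ih =>
    intro σ σ' hσ
    have h1 : p.runOf σ k = p.runOf σ' k := ih fun q hq => hσ q (sampleSet_mono (Nat.le_succ k) hq)
    change p.step 16 k (fun i s j => σ (k + 1, i, s, j)) (p.runOf σ k)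
      = p.step 16 k (fun i s j => σ' (k + 1, i, s, j)) (p.runOf σ' k)
    rw [h1]
    have h2 : ∀ i x θ, katyusha (p.f i) (p.L i) (p.μ i) x (fun s j => σ (k + 1, i, s, j)) θ
        (p.epochs 16) = katyusha (p.f i) (p.L i) (p.μ i) x (fun s j => σ' (k + 1, i, s, j)) θ
        (p.epochs 16) := by
      intro i x θ
      refine katyusha_congr _ _ fun e he j hj => hσ _ ?_
      simp only [sampleSet, Finset.mem_coe, Finset.mem_product, Finset.mem_range, Finset.mem_univ,
        true_and]
      exact ⟨by omega, he, hj⟩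
    have h3 : ∀ x θ : Cols n d,
        (fun i => katyusha (p.f i) (p.L i) (p.μ i) (x i) (fun s j => σ (k + 1, i, s, j)) (θ i)
          (p.epochs 16))
        = fun i => katyusha (p.f i) (p.L i) (p.μ i) (x i) (fun s j => σ' (k + 1, i, s, j)) (θ i)
          (p.epochs 16) := fun x θ => funext fun i => h2 i _ _
    unfold step
    extract_lets y' x' hist' kat send kat' send'
    have h4 : kat = kat' := h3 x' _
    clear_value kat kat'
    subst h4
    rfl

lemma dependsOn_lift (k : ℕ) : DependsOn (fun σ => p.lift σ k)
    (p.sampleSet k : Set (ℕ × Fin n × ℕ × ℕ)) := by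
  induction k with
  | zero => exact fun _ _ _ => rfl
  | succ k ih =>
    intro σ σ' hσ
    have hk : ∀ q ∈ (p.sampleSet k : Set (ℕ × Fin n × ℕ × ℕ)), σ q = σ' q := fun q hq =>
      hσ q (sampleSet_mono (Nat.le_succ k) hq)
    have h1 : p.runOf σ k = p.runOf σ' k := dependsOn_runOf k hk
    have h2 : p.lift σ k = p.lift σ' k := ih hk
    simp only [lift, h1, h2]

/-- `x^{k+1}` is determined by the samples of the first `k` iterations. -/
lemma dependsOn_xIter_succ (k : ℕ) : DependsOn (fun σ => p.xIter σ (k + 1))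
    (p.sampleSet k : Set (ℕ × Fin n × ℕ × ℕ)) := by
  intro σ σ' hσ
  have h1 : p.runOf σ k = p.runOf σ' k := dependsOn_runOf k hσ
  have h2 : p.xIter σ k = p.xIter σ' k := by simp only [xIter, h1]
  change p.xIter σ (k + 1) = p.xIter σ' (k + 1)
  rw [xIter_succ, xIter_succ, y_succ, y_succ, h1, h2]

end Data

/-! ### One iteration -/

namespace Data

variable {n m d : ℕ} {p : Data n m d} (σ : ℕ × Fin n × ℕ × ℕ → Fin m)

/-- The averaging sequence `w^k` of Nesterov's method, for which `(1 + t) u^k = v^k + t w^k`. -/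
noncomputable def avgSeq (p : Data n m d) (σ : ℕ × Fin n × ℕ × ℕ → Fin m) (k : ℕ) : Cols n d :=
  (1 / p.rate) • ((1 + p.rate) • (p.lift σ k).1 - (p.lift σ k).2)

/-- The error of the cached gradients, `‖Θ̂^k - ∇F^*(x^k)‖²`. -/
noncomputable def gradErr (p : Data n m d) (σ : ℕ × Fin n × ℕ × ℕ → Fin m) (k : ℕ) : ℝ :=
  sqn ((p.runOf σ k).thetaHat - p.gradConj (p.xIter σ k))

/-- The Lyapunov function of Nesterov's method for `u ↦ F^*(u √P)`, relative to a minimizer `ξ`. -/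
noncomputable def potential (p : Data n m d) (ξ : Cols n d) (σ : ℕ × Fin n × ℕ × ℕ → Fin m)
    (k : ℕ) : ℝ :=
  conjCols p.F (p.runOf σ k).y - conjCols p.F (rmul ξ (msqrt p.PK))
    + 3 * p.alpha / 8 * sqn (p.avgSeq σ k - ξ)

lemma lift_succ_snd (k : ℕ) : (p.lift σ (k + 1)).2
    = (p.lift σ k).1 - p.eta • rmul (p.runOf σ k).thetaHat (msqrt p.PK) := rfl

lemma lift_succ_fst (k : ℕ) : (p.lift σ (k + 1)).1
    = (p.lift σ (k + 1)).2 + p.momentum • ((p.lift σ (k + 1)).2 - (p.lift σ k).2) := rfl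

lemma avgSeq_succ (hn : 2 ≤ n) (hm : 1 ≤ m) (hd : 1 ≤ d) (hU : IsLaplacian p.U)
    (hf : p.SmoothStronglyConvex) (k : ℕ) : p.avgSeq σ (k + 1) = (1 - p.rate) • p.avgSeq σ k
      + p.rate • (p.lift σ k).1
      - (p.eta / p.rate) • rmul (p.runOf σ k).thetaHat (msqrt p.PK) := by
  have ht := rate_pos hn hm hd hU hf
  have h1 : (1 + p.rate) * p.momentum = 1 - p.rate := by
    rw [momentum_eq hn hm hd hU hf]; field_simp
  have h2 : (1 + p.rate) • (p.lift σ (k + 1)).1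
      = (2 : ℝ) • (p.lift σ (k + 1)).2 - (1 - p.rate) • (p.lift σ k).2 := by
    rw [lift_succ_fst, smul_add, smul_smul, h1]; module
  rw [avgSeq, h2, lift_succ_snd, avgSeq]
  match_scalars <;> field_simp <;> ring

/-- The decrease of the potential in one iteration: `u ↦ F^*(u √P)` is `β'`-smooth, and it is
`α'`-strongly convex on the matrices whose columns sum to zero, where the iterates stay. -/
lemma potential_succ_le (hn : 2 ≤ n) (hm : 1 ≤ m) (hd : 1 ≤ d) (hU : IsLaplacian p.U)
    (hf : p.SmoothStronglyConvex) {ξ : Cols n d} (hξ : ∑ i, ξ i = 0) (k : ℕ) :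
    p.potential ξ σ (k + 1) ≤ (1 - p.rate) * p.potential ξ σ k
      + 5 * (p.rate / p.alpha) * sigma p.PK 1 * p.gradErr σ k
      - 3 / 10 * p.eta * sqn (rmul (p.runOf σ k).thetaHat (msqrt p.PK))
      - (1 - p.rate) * (p.rate / (4 * p.eta)) * sqn ((p.lift σ k).1 - (p.lift σ k).2) := by
  set R := msqrt p.PK with hR
  have hP := isLaplacian_PK hn hU
  have ht := rate_pos hn hm hd hU hf
  have hα := alpha_pos hn hm hd hU hf
  have hμ := muMin_pos hn hf
  have hL := Lmax_pos hn hm hd hf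
  have hx := (rmul_lift σ hn hU k).1
  have hy := (rmul_lift σ hn hU k).2
  have hy' := (rmul_lift σ hn hU (k + 1)).2
  set u := (p.lift σ k).1
  set v := (p.lift σ k).2
  set v' := (p.lift σ (k + 1)).2 with hv'
  set g := p.gradConj (p.xIter σ k) with hg
  have hip : ∀ a b : Cols n d, ip g (rmul a R - rmul b R) = ip (rmul g R) (a - b) := fun a b => by
    rw [← rmul_sub, ip_rmul_msqrt]
  have hlow : ∀ a : Cols n d, ∑ i, a i = 0 →
      conjCols p.F (p.xIter σ k) + ip (rmul g R) (a - u) + p.alpha / 2 * sqn (a - u)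
        ≤ conjCols p.F (rmul a R) := by
    intro a ha
    have h1 := conjCols_lower hm hd hf (p.xIter σ k) (rmul a R)
    rw [← hg] at h1
    nth_rewrite 2 [← hx] at h1
    nth_rewrite 2 [← hx] at h1
    rw [hip] at h1
    have hs : ∑ i, (a - u) i = 0 := by
      simp only [Pi.sub_apply, Finset.sum_sub_distrib]
      rw [ha, (sum_lift σ hn hU k).1, sub_zero]
    have h2 := hP.le_sqn_rmul_msqrt hn hs
    rw [rmul_sub] at h2
    have h3 : p.alpha / 2 * sqn (a - u)
        = 1 / (2 * p.Lmax) * (sigma p.PK (n - 1) * sqn (a - u)) := by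
      rw [alpha]; field_simp
    have h4 := mul_le_mul_of_nonneg_left h2 (show 0 ≤ 1 / (2 * p.Lmax) by positivity)
    rw [h3]
    linarith
  have hup : conjCols p.F (p.runOf σ (k + 1)).y ≤ conjCols p.F (p.xIter σ k)
      + ip (rmul g R) (v' - u) + p.beta / 2 * sqn (v' - u) := by
    have h1 := conjCols_upper hn hm hd hf (p.xIter σ k) (rmul v' R)
    rw [← hg] at h1
    nth_rewrite 2 [← hx] at h1
    nth_rewrite 2 [← hx] at h1
    rw [hip, hy'] at h1
    have h2 := sqn_rmul_msqrt_le hP.posSemidef (v' - u)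
    rw [rmul_sub, hy'] at h2
    have h3 : p.beta / 2 * sqn (v' - u) = 1 / (2 * p.muMin) * (sigma p.PK 1 * sqn (v' - u)) := by
      rw [beta]; field_simp
    have h4 := mul_le_mul_of_nonneg_left h2 (show 0 ≤ 1 / (2 * p.muMin) by positivity)
    rw [h3]
    linarith
  have hlv : conjCols p.F (p.xIter σ k) + ip (rmul g R) (v - u) ≤ conjCols p.F (p.runOf σ k).y := by
    have h1 := hlow v (sum_lift σ hn hU k).2
    rw [hy] at h1
    have := mul_nonneg (show 0 ≤ p.alpha / 2 by positivity) (sqn_nonneg (v - u))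
    linarith
  have hu : (1 + p.rate) • u = v + p.rate • p.avgSeq σ k := by
    rw [avgSeq, smul_smul, mul_one_div_cancel ht.ne', one_smul]; abel
  have key := accelerated_step (E := ColsVec n d) (u := colsVec u) (v := colsVec v)
    (v' := colsVec v') (w := colsVec (p.avgSeq σ k)) (w' := colsVec (p.avgSeq σ (k + 1)))
    (ξ := colsVec ξ) (g := colsVec (rmul g R)) (gh := colsVec (rmul (p.runOf σ k).thetaHat R))
    (Hu := conjCols p.F (p.xIter σ k)) (Hv := conjCols p.F (p.runOf σ k).y)
    (Hv' := conjCols p.F (p.runOf σ (k + 1)).y) (Hξ := conjCols p.F (rmul ξ R))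
    hα (eta_pos hn hU hf) ht (rate_le hn hm hd hU hf) (beta_mul_eta hn hU hf)
    (rate_sq_eq hn hm hd hU hf)
    (by rw [← inner_colsVec, ← norm_colsVec_sq] at hup; exact hup)
    (by rw [← inner_colsVec] at hlv; exact hlv)
    (by have := hlow ξ hξ; rw [← inner_colsVec, ← norm_colsVec_sq] at this; exact this)
    (congrArg colsVec (lift_succ_snd σ k)) (congrArg colsVec hu)
    (congrArg colsVec (avgSeq_succ σ hn hm hd hU hf k))
  have hsub : ∀ a b : Cols n d, ‖colsVec a - colsVec b‖ ^ 2 = sqn (a - b) := fun a b =>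
    norm_colsVec_sq (a - b)
  simp only [hsub, norm_colsVec_sq] at key
  have herr := sqn_rmul_msqrt_le hP.posSemidef ((p.runOf σ k).thetaHat - g)
  rw [rmul_sub] at herr
  have herr' := mul_le_mul_of_nonneg_left herr
    (show 0 ≤ 5 * (p.rate / p.alpha) by positivity)
  rw [potential, potential, gradErr, ← hR, mul_assoc (5 * (p.rate / p.alpha))]
  linarith

/-- Initially the potential is at most three times the suboptimality. -/
lemma potential_zero_le (hn : 2 ≤ n) (hm : 1 ≤ m) (hd : 1 ≤ d) (hU : IsLaplacian p.U)
    (hf : p.SmoothStronglyConvex) {ξ : Cols n d} (hξ : ∑ i, ξ i = 0)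
    (hmin : ∀ Y : Cols n d, ∑ i, Y i = 0 → conjCols p.F (rmul ξ (msqrt p.PK)) ≤ conjCols p.F Y) :
    p.potential ξ σ 0 ≤ 3 * (conjCols p.F 0 - conjCols p.F (rmul ξ (msqrt p.PK))) := by
  set R := msqrt p.PK with hR
  have hP := isLaplacian_PK hn hU
  have hL := Lmax_pos hn hm hd hf
  -- quadratic growth, from strong convexity at the midpoint of `0` and the minimizer
  set Y := rmul ξ R with hY
  set Z := (1 / 2 : ℝ) • Y with hZ
  have h1 := conjCols_lower hm hd hf Z 0
  have h2 := conjCols_lower hm hd hf Z Y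
  have h3 : conjCols p.F Y ≤ conjCols p.F Z := by
    refine hmin _ ?_
    simp only [hZ, Pi.smul_apply, ← Finset.smul_sum]
    rw [hY, hP.sum_rmul_msqrt, smul_zero]
  have e1 : (0 : Cols n d) - Z = -Z := zero_sub Z
  have e2 : Y - Z = Z := by rw [hZ]; module
  have e3 : ip (p.gradConj Z) (-Z) = - ip (p.gradConj Z) Z := by
    simp [ip, inner_neg_right]
  have e4 : sqn (-Z) = sqn Z := by simp [sqn]
  have e5 : sqn Z = 1 / 4 * sqn Y := by
    simp only [sqn, hZ, Pi.smul_apply, norm_smul, mul_pow, ← Finset.mul_sum]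
    norm_num
  rw [e1, e3, e4] at h1
  rw [e2] at h2
  have h4 := hP.le_sqn_rmul_msqrt hn hξ
  have h5 : p.alpha * sqn ξ = 1 / p.Lmax * (sigma p.PK (n - 1) * sqn ξ) := by
    rw [alpha]; field_simp
  have h6 := mul_le_mul_of_nonneg_left h4 (show 0 ≤ 1 / p.Lmax by positivity)
  have h7 : 1 / (2 * p.Lmax) * sqn Z = 1 / 8 * (1 / p.Lmax * sqn Y) := by
    rw [e5]; field_simp; ring
  have h8 : p.avgSeq σ 0 = 0 := by simp [avgSeq, lift]
  have h9 : sqn (0 - ξ) = sqn ξ := by simp [sqn]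
  rw [potential, h8, h9, y_zero, ← hR, ← hY]
  rw [h7] at h1 h2
  rw [← hY, ← h5] at h6
  have h10 : 0 ≤ conjCols p.F 0 - conjCols p.F Y := by
    have := hmin 0 (by simp)
    linarith
  linarith

end Data

/-! ### Convergence in expectation -/

namespace Data

variable {n m d : ℕ} {p : Data n m d}

/-- The error of the fresh gradients, `‖Θ^k - ∇F^*(x^k)‖²`. -/
noncomputable def thetaErr (p : Data n m d) (σ : ℕ × Fin n × ℕ × ℕ → Fin m) (k : ℕ) : ℝ :=
  sqn ((p.runOf σ k).theta - p.gradConj (p.xIter σ k))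

/-- The squared increment `‖x^k - x^{k+1}‖²`. -/
noncomputable def incr (p : Data n m d) (σ : ℕ × Fin n × ℕ × ℕ → Fin m) (k : ℕ) : ℝ :=
  sqn (p.xIter σ k - p.xIter σ (k + 1))

/-- Whatever is determined by the first `k` iterations depends on finitely many samples only. -/
lemma dependsOn_of_eq {β : Type*} {X : (ℕ × Fin n × ℕ × ℕ → Fin m) → β} (k : ℕ)
    (hX : ∀ σ σ', (∀ j ≤ k, p.runOf σ j = p.runOf σ' j) → (∀ j ≤ k, p.lift σ j = p.lift σ' j) →
      X σ = X σ') : DependsOn X (p.sampleSet k : Set (ℕ × Fin n × ℕ × ℕ)) := fun σ σ' hσ =>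
  hX σ σ' (fun j hj => dependsOn_runOf j fun q hq => hσ q (sampleSet_mono hj hq))
    fun j hj => dependsOn_lift j fun q hq => hσ q (sampleSet_mono hj hq)

lemma dependsOn_incr {j k : ℕ} (hj : j < k) : DependsOn (fun σ => p.incr σ j)
    (p.sampleSet k : Set (ℕ × Fin n × ℕ × ℕ)) :=
  dependsOn_of_eq k fun σ σ' h _ => by
    simp only [incr, xIter, h j hj.le, h (j + 1) hj]

lemma dependsOn_thetaErr {j k : ℕ} (hj : j ≤ k) : DependsOn (fun σ => p.thetaErr σ j)
    (p.sampleSet k : Set (ℕ × Fin n × ℕ × ℕ)) :=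
  dependsOn_of_eq k fun σ σ' h _ => by simp only [thetaErr, xIter, h j hj]

lemma dependsOn_gradErr {j k : ℕ} (hj : j ≤ k) : DependsOn (fun σ => p.gradErr σ j)
    (p.sampleSet k : Set (ℕ × Fin n × ℕ × ℕ)) :=
  dependsOn_of_eq k fun σ σ' h _ => by simp only [gradErr, xIter, h j hj]

lemma dependsOn_potential (ξ : Cols n d) {j k : ℕ} (hj : j ≤ k) :
    DependsOn (fun σ => p.potential ξ σ j) (p.sampleSet k : Set (ℕ × Fin n × ℕ × ℕ)) :=
  dependsOn_of_eq k fun σ σ' h h' => by simp only [potential, avgSeq, h j hj, h' j hj]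

lemma dependsOn_step {j k : ℕ} (hj : j ≤ k) :
    DependsOn (fun σ => sqn (rmul (p.runOf σ j).thetaHat (msqrt p.PK)))
      (p.sampleSet k : Set (ℕ × Fin n × ℕ × ℕ)) :=
  dependsOn_of_eq k fun σ σ' h _ => by simp only [h j hj]

lemma dependsOn_lift_sub {j k : ℕ} (hj : j ≤ k) :
    DependsOn (fun σ => sqn ((p.lift σ j).1 - (p.lift σ j).2))
      (p.sampleSet k : Set (ℕ × Fin n × ℕ × ℕ)) :=
  dependsOn_of_eq k fun σ σ' _ h => by simp only [h j hj]

variable {Ω : Type*} [MeasurableSpace Ω] {P : Measure Ω} [IsProbabilityMeasure P]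
  {s : Ω → ℕ × Fin n × ℕ × ℕ → Fin m}

/-- A warm started call of Katyusha contracts the old error by the factor `c`; the motion of the
minimizer adds a multiple of the increment of `x`. -/
lemma expect_thetaErr_succ_le (h : IsUniformFamily P s) (hn : 2 ≤ n) (hm : 1 ≤ m) (hd : 1 ≤ d)
    (hD : 1 ≤ p.D) (hU : IsLaplacian p.U) (hf : p.SmoothStronglyConvex) (k : ℕ) :
    expect P s (fun σ => p.thetaErr σ (k + 1)) ≤ p.c * expect P s (fun σ => p.thetaErr σ k)
      + p.c / p.muMin ^ 2 * expect P s (fun σ => p.incr σ k) := by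
  have hc := c_pos hn hm hd hD hU hf
  have hμ := muMin_pos hn hf
  have hdep : ∀ i, DependsOn
      (fun σ => ‖(p.runOf σ k).theta i - p.gradConj (p.xIter σ (k + 1)) i‖ ^ 2)
      (p.sampleSet k : Set (ℕ × Fin n × ℕ × ℕ)) := fun i σ σ' hσ => by
    have h1 : p.runOf σ k = p.runOf σ' k := dependsOn_runOf k hσ
    have h2 : p.xIter σ (k + 1) = p.xIter σ' (k + 1) := dependsOn_xIter_succ k hσ
    simp only [h1, h2]
  have hkat : ∀ i, expect P s
      (fun σ => ‖(p.runOf σ (k + 1)).theta i - p.gradConj (p.xIter σ (k + 1)) i‖ ^ 2)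
      ≤ p.c / 2 * expect P s
        fun σ => ‖(p.runOf σ k).theta i - p.gradConj (p.xIter σ (k + 1)) i‖ ^ 2 := by
    intro i
    simp only [theta_succ]
    refine (katyusha_expect h hm (hf i).1 (L_pos hm hd hf i) (fun j => ((hf i).2 j).1)
      (fun j => ((hf i).2 j).2) (A := p.sampleSet k) (pv := fun σ => p.xIter σ (k + 1) i)
      (θs := fun σ => p.gradConj (p.xIter σ (k + 1)) i) (θ₀ := fun σ => (p.runOf σ k).theta i)
      (fun σ σ' hσ => ?_) (fun σ σ' hσ => ?_) (fun σ σ' hσ => ?_) (fun σ => ?_)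
      (q := fun e j => (k + 1, i, e, j)) (fun e j e' j' he => ?_) (fun e j => ?_)
      (p.epochs 16)).trans ?_
    · exact congrFun (dependsOn_xIter_succ k hσ : p.xIter σ (k + 1) = p.xIter σ' (k + 1)) i
    · have h2 : p.xIter σ (k + 1) = p.xIter σ' (k + 1) := dependsOn_xIter_succ k hσ
      simp only [h2]
    · have h1 : p.runOf σ k = p.runOf σ' k := dependsOn_runOf k hσ
      simp only [h1]
    · rw [← gradient_fLocal hf, gradient_fLocal_gradConj hm hd hf]
    · simpa using he
    · simp [sampleSet]
    · refine mul_le_mul_of_nonneg_right ?_ (expect_nonneg fun σ => sq_nonneg _)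
      linarith [katyusha_factor_le hn hm hd hD hU hf i]
  have hdep1 : ∀ i, DependsOn
      (fun σ => ‖(p.runOf σ (k + 1)).theta i - p.gradConj (p.xIter σ (k + 1)) i‖ ^ 2)
      (p.sampleSet (k + 1) : Set (ℕ × Fin n × ℕ × ℕ)) := fun i =>
    dependsOn_of_eq (k + 1) fun σ σ' h _ => by simp only [xIter, h (k + 1) le_rfl]
  have h1 : expect P s (fun σ => p.thetaErr σ (k + 1)) ≤ p.c / 2 * expect P s
      fun σ => sqn ((p.runOf σ k).theta - p.gradConj (p.xIter σ (k + 1))) := by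
    simp only [thetaErr, sqn, Pi.sub_apply]
    rw [h.expect_sum hm _ fun i _ => hdep1 i, h.expect_sum hm _ fun i _ => hdep i, Finset.mul_sum]
    exact Finset.sum_le_sum fun i _ => hkat i
  have h2 : expect P s (fun σ => sqn ((p.runOf σ k).theta - p.gradConj (p.xIter σ (k + 1))))
      ≤ expect P s fun σ => 2 * p.thetaErr σ k + 2 / p.muMin ^ 2 * p.incr σ k := by
    refine h.expect_mono hm (A := p.sampleSet (k + 1)) ?_ ?_ fun σ => ?_
    · exact dependsOn_of_eq (k + 1) fun σ σ' h _ => by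
        simp only [xIter, h (k + 1) le_rfl, h k (Nat.le_succ k)]
    · exact ((dependsOn_thetaErr (Nat.le_succ k)).const_mul _).add
        ((dependsOn_incr (Nat.lt_succ_self k)).const_mul _)
    · refine (sqn_sub_le _ (p.gradConj (p.xIter σ k)) _).trans ?_
      have h3 : sqn (p.gradConj (p.xIter σ k) - p.gradConj (p.xIter σ (k + 1)))
          ≤ 1 / p.muMin ^ 2 * p.incr σ k := by
        rw [incr, sqn, sqn, Finset.mul_sum]
        refine Finset.sum_le_sum fun i _ => ?_
        have h4 := pow_le_pow_left₀ (norm_nonneg _) (norm_gradConj_sub_le hn hm hd hf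
          (p.xIter σ k) (p.xIter σ (k + 1)) i) 2
        rw [div_pow] at h4
        simp only [Pi.sub_apply]
        rw [one_div_mul_eq_div]
        exact h4
      rw [thetaErr]
      have h5 : 2 / p.muMin ^ 2 * p.incr σ k = 2 * (1 / p.muMin ^ 2 * p.incr σ k) := by ring
      linarith
  rw [h.expect_add hm (A := p.sampleSet (k + 1))
    ((dependsOn_thetaErr (Nat.le_succ k)).const_mul _)
    ((dependsOn_incr (Nat.lt_succ_self k)).const_mul _), expect_const_mul, expect_const_mul] at h2
  refine h1.trans ((mul_le_mul_of_nonneg_left h2 (by positivity)).trans (le_of_eq ?_))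
  ring

lemma expect_thetaErr_le (h : IsUniformFamily P s) (hn : 2 ≤ n) (hm : 1 ≤ m) (hd : 1 ≤ d)
    (hD : 1 ≤ p.D) (hU : IsLaplacian p.U) (hf : p.SmoothStronglyConvex) (k : ℕ) :
    expect P s (fun σ => p.thetaErr σ k) ≤ 1 / p.muMin ^ 2 *
      ∑ j ∈ Finset.range k, p.c ^ (k - j) * expect P s fun σ => p.incr σ j := by
  induction k with
  | zero =>
    have : ∀ σ, p.thetaErr σ 0 = 0 := fun σ => by simp [thetaErr, theta_zero, sqn]
    simp [expect, this]
  | succ k ih =>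
    refine (expect_thetaErr_succ_le h hn hm hd hD hU hf k).trans ?_
    have hc := c_pos hn hm hd hD hU hf
    have h1 := mul_le_mul_of_nonneg_left ih hc.le
    have h2 : ∑ j ∈ Finset.range k, p.c ^ (k + 1 - j) * expect P s (fun σ => p.incr σ j)
        = p.c * ∑ j ∈ Finset.range k, p.c ^ (k - j) * expect P s (fun σ => p.incr σ j) := by
      rw [Finset.mul_sum]
      refine Finset.sum_congr rfl fun j hj => ?_
      rw [Nat.sub_add_comm (Finset.mem_range.1 hj).le, pow_succ]; ring
    rw [Finset.sum_range_succ, h2, Nat.add_sub_cancel_left, pow_one, mul_add]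
    have h3 : p.c / p.muMin ^ 2 = 1 / p.muMin ^ 2 * p.c := by ring
    rw [h3]
    linarith

/-- The expected error of the cached gradients is controlled by the past increments. -/
lemma expect_gradErr_le (h : IsUniformFamily P s) (hn : 2 ≤ n) (hm : 1 ≤ m) (hd : 1 ≤ d)
    (hD : 1 ≤ p.D) (hU : IsLaplacian p.U) (hf : p.SmoothStronglyConvex) (k : ℕ) :
    expect P s (fun σ => p.gradErr σ k) ≤ 8 / p.muMin ^ 2 *
      ∑ j ∈ Finset.range k, p.memWeight (k - j) * expect P s fun σ => p.incr σ j := by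
  have hc := c_pos hn hm hd hD hU hf
  have hμ := muMin_pos hn hf
  have hdep : ∀ j ∈ Finset.range k, DependsOn (fun σ => p.memWeight (k - j) * p.incr σ j)
      (p.sampleSet k : Set (ℕ × Fin n × ℕ × ℕ)) := fun j hj =>
    (dependsOn_incr (Finset.mem_range.1 hj)).const_mul _
  have hdepS := (DependsOn.sum hdep).const_mul (6 / p.muMin ^ 2)
  have hdepT := (dependsOn_thetaErr (p := p) (le_refl k)).const_mul 2
  have h1 : expect P s (fun σ => p.gradErr σ k) ≤ expect P s fun σ => 6 / p.muMin ^ 2 *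
      (∑ j ∈ Finset.range k, p.memWeight (k - j) * p.incr σ j) + 2 * p.thetaErr σ k := by
    refine h.expect_mono hm (dependsOn_gradErr le_rfl) (hdepS.add hdepT) fun σ => ?_
    have h2 := sqn_thetaHat_sub_theta_le σ hn hm hd hD hU hf k
    have h3 := sqn_sub_le (p.runOf σ k).thetaHat (p.runOf σ k).theta (p.gradConj (p.xIter σ k))
    have h4 : 6 / p.muMin ^ 2 * (∑ j ∈ Finset.range k, p.memWeight (k - j) * p.incr σ j)
        = 2 * (3 / p.muMin ^ 2 * ∑ j ∈ Finset.range k, p.memWeight (k - j) * p.incr σ j) := by ring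
    rw [h4]
    simp only [gradErr, thetaErr, incr] at *
    linarith
  rw [h.expect_add hm hdepS hdepT, expect_const_mul, expect_const_mul, h.expect_sum hm _ hdep] at h1
  simp only [expect_const_mul] at h1
  have h2 := expect_thetaErr_le h hn hm hd hD hU hf k
  have h3 : ∑ j ∈ Finset.range k, p.c ^ (k - j) * expect P s (fun σ => p.incr σ j)
      ≤ ∑ j ∈ Finset.range k, p.memWeight (k - j) * expect P s fun σ => p.incr σ j :=
    Finset.sum_le_sum fun j _ => mul_le_mul_of_nonneg_right (memWeight_ge hn hm hd hD hU hf _)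
      (expect_nonneg fun σ => sqn_nonneg _)
  have h4 := mul_le_mul_of_nonneg_left h3 (show 0 ≤ 1 / p.muMin ^ 2 by positivity)
  set T := ∑ j ∈ Finset.range k, p.memWeight (k - j) * expect P s fun σ => p.incr σ j
  have h5 : 8 / p.muMin ^ 2 * T = 6 / p.muMin ^ 2 * T + 2 * (1 / p.muMin ^ 2 * T) := by ring
  linarith

/-- The increments of `x` are dominated by the negative terms in `potential_succ_le`. -/
lemma incr_le (hn : 2 ≤ n) (hU : IsLaplacian p.U) (σ : ℕ × Fin n × ℕ × ℕ → Fin m) (j : ℕ) :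
    p.incr σ j ≤ sigma p.PK 1 * (2 * sqn ((p.lift σ (j + 1)).1 - (p.lift σ (j + 1)).2)
      + 2 * p.eta ^ 2 * sqn (rmul (p.runOf σ j).thetaHat (msqrt p.PK))) := by
  have hP := isLaplacian_PK hn hU
  rw [incr, ← (rmul_lift σ hn hU j).1, ← (rmul_lift σ hn hU (j + 1)).1, ← rmul_sub]
  refine (sqn_rmul_msqrt_le hP.posSemidef _).trans
    (mul_le_mul_of_nonneg_left ?_ (sigma_PK_pos hn hU).2.le)
  refine (sqn_sub_le _ (p.lift σ (j + 1)).2 _).trans ?_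
  have h1 : sqn ((p.lift σ j).1 - (p.lift σ (j + 1)).2)
      = p.eta ^ 2 * sqn (rmul (p.runOf σ j).thetaHat (msqrt p.PK)) := by
    rw [lift_succ_snd, sub_sub_cancel]
    simp only [sqn, Pi.smul_apply, norm_smul, mul_pow, Real.norm_eq_abs, sq_abs, Finset.mul_sum]
  rw [h1, sqn_sub_comm (p.lift σ (j + 1)).2]
  linarith

/-- The expected potential decreases by the factor `1 - t` per iteration in the long run: the
errors of the cached gradients are absorbed by the negative terms of earlier iterations. -/
lemma expect_potential_le (h : IsUniformFamily P s) (hn : 2 ≤ n) (hm : 1 ≤ m) (hd : 1 ≤ d)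
    (hD : 1 ≤ p.D) (hU : IsLaplacian p.U) (hf : p.SmoothStronglyConvex) {ξ : Cols n d}
    (hξ : ∑ i, ξ i = 0) (K : ℕ) : expect P s (fun σ => p.potential ξ σ K)
      ≤ (1 - p.rate) ^ K * expect P s (fun σ => p.potential ξ σ 0) := by
  have ht := rate_pos hn hm hd hU hf
  have ht3 := rate_le hn hm hd hU hf
  have hα := alpha_pos hn hm hd hU hf
  have hη := eta_pos hn hU hf
  have hμ := muMin_pos hn hf
  have hκ := one_le_kappa' hn hm hd hU hf
  have hσ := (sigma_PK_pos hn hU).2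
  -- the coefficient of the memory in the recursion of the potential
  set M := 5 * (p.rate / p.alpha) * sigma p.PK 1 * (8 / p.muMin ^ 2) with hM
  -- `16 / 195 = 2 * 5 * 8 / 130 * (2 / 15)`, with `β' η = 2 / 15`
  have hMW : 2 * M * (1 / (130 * p.kappa')) * sigma p.PK 1 = 16 / 195 * (p.rate / p.eta) := by
    have h1 := kappa'_mul_alpha hn hm hd hU hf
    have h2 := beta_mul_eta hn hU hf
    have h3 : sigma p.PK 1 = p.beta * p.muMin := by rw [beta]; field_simp
    have h4 : p.beta = 2 / 15 / p.eta := by rw [eq_div_iff hη.ne', h2]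
    have h5 : p.alpha = p.beta / p.kappa' := by rw [eq_div_iff (by linarith), ← h1]; ring
    rw [hM, h3, h5, h4]
    field_simp
    norm_num
  refine linear_convergence_of_memory (φ := fun k => expect P s fun σ => p.potential ξ σ k)
    (a := fun k => expect P s fun σ => sqn (rmul (p.runOf σ k).thetaHat (msqrt p.PK)))
    (b := fun k => expect P s fun σ => sqn ((p.lift σ k).1 - (p.lift σ k).2))
    (δ := fun k => expect P s fun σ => p.incr σ k) (wt := p.memWeight) (η := p.eta)
    (M := M) (W := 1 / (130 * p.kappa')) (s := sigma p.PK 1) (ca := 3 / 10 * p.eta)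
    (cb := (1 - p.rate) * (p.rate / (4 * p.eta))) ht (by linarith) (by positivity) hσ.le
    (by positivity) (fun k => expect_nonneg fun σ => sqn_nonneg _)
    (fun k => expect_nonneg fun σ => sqn_nonneg _) (fun k => expect_nonneg fun σ => sqn_nonneg _)
    (sum_memWeight_le hn hm hd hD hU hf) (fun k => ?_) (fun j => ?_) ?_ ?_ K
  · have d1 := (dependsOn_potential (p := p) ξ (Nat.le_succ k)).const_mul (1 - p.rate)
    have d2 := (dependsOn_gradErr (p := p) (Nat.le_succ k)).const_mul
      (5 * (p.rate / p.alpha) * sigma p.PK 1)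
    have d3 := (dependsOn_step (p := p) (Nat.le_succ k)).const_mul (-(3 / 10 * p.eta))
    have d4 := (dependsOn_lift_sub (p := p) (Nat.le_succ k)).const_mul
      (-((1 - p.rate) * (p.rate / (4 * p.eta))))
    have h1 : expect P s (fun σ => p.potential ξ σ (k + 1)) ≤ expect P s fun σ =>
        (1 - p.rate) * p.potential ξ σ k + 5 * (p.rate / p.alpha) * sigma p.PK 1 * p.gradErr σ k
          + -(3 / 10 * p.eta) * sqn (rmul (p.runOf σ k).thetaHat (msqrt p.PK))
          + -((1 - p.rate) * (p.rate / (4 * p.eta))) * sqn ((p.lift σ k).1 - (p.lift σ k).2) := by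
      refine h.expect_mono hm (dependsOn_potential ξ le_rfl) (((d1.add d2).add d3).add d4)
        fun σ => ?_
      linarith [potential_succ_le σ hn hm hd hU hf hξ k]
    rw [h.expect_add hm ((d1.add d2).add d3) d4, h.expect_add hm (d1.add d2) d3,
      h.expect_add hm d1 d2, expect_const_mul, expect_const_mul, expect_const_mul,
      expect_const_mul] at h1
    have h2 := mul_le_mul_of_nonneg_left (expect_gradErr_le h hn hm hd hD hU hf k)
      (show 0 ≤ 5 * (p.rate / p.alpha) * sigma p.PK 1 by positivity)
    rw [← mul_assoc] at h2
    simp only [hM]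
    linarith
  · have d1 := (dependsOn_lift_sub (p := p) (le_refl (j + 1))).const_mul 2
    have d2 := (dependsOn_step (p := p) (Nat.le_succ j)).const_mul (2 * p.eta ^ 2)
    have h1 := h.expect_mono hm (dependsOn_incr (Nat.lt_succ_self j))
      ((d1.add d2).const_mul (sigma p.PK 1)) fun σ => incr_le hn hU σ j
    rw [expect_const_mul, h.expect_add hm d1 d2, expect_const_mul, expect_const_mul] at h1
    exact h1
  · rw [hMW]
    have h1 : (1 - p.rate) * (p.rate / (4 * p.eta)) = (1 - p.rate) / 4 * (p.rate / p.eta) := by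
      field_simp
    rw [h1]
    exact mul_le_mul_of_nonneg_right (by linarith) (by positivity)
  · rw [hMW]
    have h1 : 16 / 195 * (p.rate / p.eta) * p.eta ^ 2 = 16 / 195 * p.rate * p.eta := by
      field_simp
    rw [h1]
    exact mul_le_mul_of_nonneg_right (by linarith) hη.le

/-- Linear convergence of the expected dual suboptimality. -/
lemma expect_conjCols_y_le (h : IsUniformFamily P s) (hn : 2 ≤ n) (hm : 1 ≤ m) (hd : 1 ≤ d)
    (hD : 1 ≤ p.D) (hU : IsLaplacian p.U) (hf : p.SmoothStronglyConvex) {Y : Cols n d}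
    (hY : ∑ i, Y i = 0)
    (hmin : ∀ Y' : Cols n d, ∑ i, Y' i = 0 → conjCols p.F Y ≤ conjCols p.F Y') (k : ℕ) :
    expect P s (fun σ => conjCols p.F (p.runOf σ k).y) ≤ conjCols p.F Y
      + 3 * (1 - p.rate) ^ k * (conjCols p.F 0 - conjCols p.F Y) := by
  obtain ⟨ξ, hξ, rfl⟩ := (isLaplacian_PK hn hU).exists_rmul_msqrt hn hY
  have ht3 := rate_le hn hm hd hU hf
  have hα := alpha_pos hn hm hd hU hf
  have hconst : ∀ a : ℝ, expect P s (fun _ => a) = a := fun a => by simp [expect]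
  have hdc : ∀ (a : ℝ) (A : Set (ℕ × Fin n × ℕ × ℕ)),
      DependsOn (fun _ : ℕ × Fin n × ℕ × ℕ → Fin m => a) A := fun a A _ _ _ => rfl
  set R := msqrt p.PK
  have h0 : expect P s (fun σ => p.potential ξ σ 0)
      ≤ 3 * (conjCols p.F 0 - conjCols p.F (rmul ξ R)) := by
    rw [← hconst (3 * (conjCols p.F 0 - conjCols p.F (rmul ξ R)))]
    exact h.expect_mono hm (dependsOn_potential ξ le_rfl) (hdc _ _)
      fun σ => potential_zero_le σ hn hm hd hU hf hξ hmin
  have h1 : expect P s (fun σ => conjCols p.F (p.runOf σ k).y)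
      ≤ expect P s fun σ => conjCols p.F (rmul ξ R) + p.potential ξ σ k := by
    refine h.expect_mono hm (A := p.sampleSet k)
      (dependsOn_of_eq k fun σ σ' h _ => by simp only [h k le_rfl])
      ((hdc _ _).add (dependsOn_potential ξ le_rfl)) fun σ => ?_
    rw [potential]
    have := mul_nonneg (show 0 ≤ 3 * p.alpha / 8 by positivity) (sqn_nonneg (p.avgSeq σ k - ξ))
    linarith
  rw [h.expect_add hm (hdc _ _) (dependsOn_potential ξ le_rfl), hconst] at h1
  have h2 := expect_potential_le h hn hm hd hD hU hf hξ k
  have h3 := mul_le_mul_of_nonneg_left h0 (pow_nonneg (show 0 ≤ 1 - p.rate by linarith) k)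
  linarith

end Data

/-! ### Complexity -/

namespace Data

variable {n m d : ℕ} {p : Data n m d}

/-- The number of stochastic gradients of one worker in one iteration. -/
lemma epochs_mul_le (hn : 2 ≤ n) (hm : 1 ≤ m) (hd : 1 ≤ d) (hD : 1 ≤ p.D) (hU : IsLaplacian p.U)
    (hf : p.SmoothStronglyConvex) : (p.epochs 16 : ℝ) * (5 * m) ≤
      85 * (((m : ℝ) + Real.sqrt (m * p.kappaMax)) * Real.log (2 * p.kappaMax / p.c)) := by
  have hl := one_le_log hn hm hd hD hU hf
  have hm0 : (0 : ℝ) < m := by positivity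
  set l := Real.log (2 * p.kappaMax / p.c)
  set q := Real.sqrt (p.kappaMax / m) with hq
  have hq0 : 0 ≤ q := Real.sqrt_nonneg _
  have h1 : (p.epochs 16 : ℝ) ≤ 17 * ((1 + q) * l) := by
    have h2 : (p.epochs 16 : ℝ) < 16 * (1 + q) * l + 1 := Nat.ceil_lt_add_one (by positivity)
    nlinarith
  have h3 : m * q = Real.sqrt (m * p.kappaMax) := by
    rw [hq, ← Real.sqrt_sq hm0.le, ← Real.sqrt_mul (sq_nonneg _), Real.sqrt_sq hm0.le]
    congr 1
    field_simp
  rw [← h3]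
  have := mul_le_mul_of_nonneg_right h1 (show 0 ≤ 5 * (m : ℝ) by positivity)
  linarith

lemma evals_le (hn : 2 ≤ n) (hm : 1 ≤ m) (hd : 1 ≤ d) (hD : 1 ≤ p.D) (hU : IsLaplacian p.U)
    (hf : p.SmoothStronglyConvex) (σ : ℕ × Fin n × ℕ × ℕ → Fin m) (k : ℕ) :
    ((p.runOf σ (k + 1)).evals : ℝ) ≤ (p.runOf σ k).evals + 85 * (n *
      (((m : ℝ) + Real.sqrt (m * p.kappaMax)) * Real.log (2 * p.kappaMax / p.c))) := by
  have := mul_le_mul_of_nonneg_left (epochs_mul_le hn hm hd hD hU hf) n.cast_nonneg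
  rw [evals_succ]
  push_cast
  linarith

lemma evals_le_mul (hn : 2 ≤ n) (hm : 1 ≤ m) (hd : 1 ≤ d) (hD : 1 ≤ p.D) (hU : IsLaplacian p.U)
    (hf : p.SmoothStronglyConvex) (σ : ℕ × Fin n × ℕ × ℕ → Fin m) (k : ℕ) :
    ((p.runOf σ k).evals : ℝ) ≤ 85 * (n *
      (((m : ℝ) + Real.sqrt (m * p.kappaMax)) * Real.log (2 * p.kappaMax / p.c))) * k := by
  induction k with
  | zero => simp [runOf, run, init]
  | succ k ih =>
    have := evals_le hn hm hd hD hU hf σ k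
    push_cast
    linarith

/-- The number of iterations after which a potential that contracts by `1 - t` is below `ε`. -/
lemma exists_iterations (hn : 2 ≤ n) (hm : 1 ≤ m) (hd : 1 ≤ d) (hU : IsLaplacian p.U)
    (hf : p.SmoothStronglyConvex) {Δ ε : ℝ} (hΔ : 0 ≤ Δ) (hε : 0 < ε) :
    ∃ N : ℕ, (N : ℝ) ≤ 16 * Real.sqrt p.kappaF * Real.log (2 + Δ / ε) ∧
      ∀ k, N ≤ k → 3 * (1 - p.rate) ^ k * Δ ≤ ε := by
  have hκ := one_le_kappaF hn hm hd hf
  have hκ' := one_le_kappa' hn hm hd hU hf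
  have ht := rate_pos hn hm hd hU hf
  have ht3 := rate_le hn hm hd hU hf
  set x := Δ / ε with hx
  have hx0 : 0 ≤ x := by positivity
  have hΔx : Δ = x * ε := by rw [hx]; field_simp
  set l := Real.log (2 + x) with hl
  have hl2 : 1 / 2 ≤ l := by
    have h1 := Real.log_two_gt_d9
    have h2 : Real.log 2 ≤ l := Real.log_le_log (by norm_num) (by linarith)
    linarith
  set r := Real.sqrt (10 * p.kappa') with hr
  have hr0 : 0 < r := Real.sqrt_pos.2 (by linarith)
  have hr7 : r ≤ 7 * Real.sqrt p.kappaF := by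
    rw [hr, Real.sqrt_le_left (by positivity), mul_pow, Real.sq_sqrt (by linarith)]
    linarith [kappa'_le hn hm hd hU hf]
  have hF1 : 1 ≤ Real.sqrt p.kappaF := Real.one_le_sqrt.2 hκ
  -- `exp (-2 l) = (2 + x)⁻²` and `3 x ≤ (2 + x)²`
  refine ⟨⌈2 * r * l⌉₊, ?_, fun k hk => ?_⟩
  · have h1 := Nat.ceil_lt_add_one (show 0 ≤ 2 * r * l by positivity)
    nlinarith
  · have h1 : 2 * r * l ≤ k := (Nat.le_ceil _).trans (by exact_mod_cast hk)
    have h2 : 2 * l ≤ p.rate * k := by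
      have h3 := mul_le_mul_of_nonneg_left h1 ht.le
      have h4 : p.rate * (2 * r * l) = 2 * l := by rw [rate, ← hr]; field_simp
      linarith
    have h3 : (1 - p.rate) ^ k ≤ Real.exp (-(2 * l)) := by
      have h4 : 1 - p.rate ≤ Real.exp (-p.rate) := by linarith [Real.add_one_le_exp (-p.rate)]
      refine (pow_le_pow_left₀ (by linarith) h4 k).trans ?_
      rw [← Real.exp_nat_mul, Real.exp_le_exp]
      linarith
    have h4 : Real.exp (-(2 * l)) * (2 + x) ^ 2 = 1 := by
      have h5 : Real.exp (2 * l) = (2 + x) ^ 2 := by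
        rw [show (2 : ℝ) * l = ((2 : ℕ) : ℝ) * l by norm_num, Real.exp_nat_mul, hl,
          Real.exp_log (by linarith)]
      rw [← h5, ← Real.exp_add, neg_add_cancel, Real.exp_zero]
    have h5 : Real.exp (-(2 * l)) * (3 * x) ≤ 1 := by
      rw [← h4]
      exact mul_le_mul_of_nonneg_left (by nlinarith) (Real.exp_pos _).le
    calc 3 * (1 - p.rate) ^ k * Δ ≤ 3 * Real.exp (-(2 * l)) * Δ := by gcongr
      _ = Real.exp (-(2 * l)) * (3 * x) * ε := by rw [hΔx]; ring
      _ ≤ 1 * ε := by gcongr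
      _ = ε := one_mul ε

end Data

lemma IsUniformSampling.isUniformFamily {Ω : Type*} [MeasurableSpace Ω] {P : Measure Ω} {n m : ℕ}
    {idx : ℕ → Fin n → ℕ → ℕ → Ω → Fin m} (h : IsUniformSampling P idx) :
    IsUniformFamily P fun ω (q : ℕ × Fin n × ℕ × ℕ) => idx q.1 q.2.1 q.2.2.1 q.2.2.2 ω :=
  ⟨fun _ => h.measurable _ _ _ _, h.indep, fun _ => h.uniform _ _ _ _⟩

end MDLAG

theorem mainTheorem2 :
    ∃ A : ℝ, 0 < A ∧ ∃ C : ℝ, 0 < C ∧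
    ∀ (n m d : ℕ) (_hn : 2 ≤ n) (_hm : 1 ≤ m) (_hd : 1 ≤ d)
      (p : MDLAG.Data n m d) (_hD : 1 ≤ p.D)
      (network : SimpleGraph (Fin n)) (_hW : MDLAG.IsGossip network p.W)
      (_hf : p.SmoothStronglyConvex)
      (Ω : Type*) [MeasurableSpace Ω] (P : MeasureTheory.Measure Ω)
      [MeasureTheory.IsProbabilityMeasure P]
      (idx : ℕ → Fin n → ℕ → ℕ → Ω → Fin m) (_hidx : MDLAG.IsUniformSampling P idx),
      -- the run of the algorithm, with `S` epochs in each call of Katyusha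
      let run : Ω → ℕ → MDLAG.State n d := fun ω => p.run A (fun k i s j => idx k i s j ω)
      -- budget of stochastic gradients per worker and iteration
      let B : ℝ := ((m : ℝ) + Real.sqrt (m * p.kappaMax)) * Real.log (2 * p.kappaMax / p.c)
      (1 / 4 ≤ MDLAG.zeta p.PK) ∧ (0 < p.c ∧ p.c < 1) ∧
      -- each iteration costs at most `C n B` stochastic gradients
      (∀ ω k, ((run ω (k + 1)).evals : ℝ) ≤ (run ω k).evals + C * (n * B)) ∧
      ∃ ξ : MDLAG.Cols n d, (∀ ξ', p.dual ξ ≤ p.dual ξ') ∧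
      ∃ dualIter : ℕ → Ω → MDLAG.Cols n d,
        (∀ k ω, MDLAG.rmul (dualIter k ω) (MDLAG.msqrt p.U) = (run ω k).y) ∧
        (∀ k, MeasureTheory.Integrable (fun ω => p.dual (dualIter k ω)) P) ∧
        ∀ ε : ℝ, 0 < ε →
          let logFactor : ℝ := Real.log (2 + (p.dual 0 - p.dual ξ) / ε)
          ∃ N : ℕ, (N : ℝ) ≤ C * Real.sqrt p.kappaF * logFactor ∧
            (∀ k, N ≤ k → ∫ ω, p.dual (dualIter k ω) ∂P ≤ p.dual ξ + ε) ∧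
            ∀ ω, ((run ω N).evals : ℝ) ≤ C * n * B * Real.sqrt p.kappaF * logFactor := by
  -- 85 stochastic gradients per unit of the budget, times 16 for the number of iterations
  refine ⟨16, by norm_num, 1360, by norm_num, ?_⟩
  intro n m d hn hm hd p hD network hW hf Ω _ P _ idx hidx run B
  have hU : MDLAG.IsLaplacian p.U := hW.isLaplacian
  have hB : 0 ≤ B := mul_nonneg (by positivity)
    (zero_le_one.trans (MDLAG.Data.one_le_log hn hm hd hD hU hf))
  let s : Ω → ℕ × Fin n × ℕ × ℕ → Fin m := fun ω q => idx q.1 q.2.1 q.2.2.1 q.2.2.2 ω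
  have h : MDLAG.IsUniformFamily P s := hidx.isUniformFamily
  have hrun : ∀ ω k, run ω k = p.runOf (s ω) k := fun _ _ => rfl
  clear_value run s
  have hc := MDLAG.Data.c_le_const hn hm hd hD hU hf
  refine ⟨MDLAG.zeta_chebGossip hU hn, ⟨MDLAG.Data.c_pos hn hm hd hD hU hf, by linarith⟩,
    fun ω k => ?_, ?_⟩
  · rw [hrun, hrun]
    refine (MDLAG.Data.evals_le hn hm hd hD hU hf (s ω) k).trans ?_
    have := mul_nonneg (n.cast_nonneg : (0 : ℝ) ≤ n) hB
    linarith
  obtain ⟨Y, hY, hmin⟩ := MDLAG.Data.exists_minimizer hn hm hd hf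
  -- `pre Z` is a preimage of `Z` under `X ↦ X √U`
  choose pre hpre using fun (Z : MDLAG.Cols n d) (hZ : ∑ i, Z i = 0) =>
    hU.exists_rmul_msqrt hn hZ
  have hy : ∀ k ω, ∑ i, (run ω k).y i = 0 := fun k ω => by
    rw [hrun, ← (MDLAG.Data.rmul_lift (s ω) hn hU k).2]
    exact (MDLAG.Data.isLaplacian_PK hn hU).sum_rmul_msqrt _
  have hdual : ∀ (Z : MDLAG.Cols n d) (hZ : ∑ i, Z i = 0),
      p.dual (pre Z hZ) = MDLAG.conjCols p.F Z := fun Z hZ => by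
    rw [MDLAG.Data.dual, (hpre Z hZ).2]
  have hdual0 : p.dual 0 = MDLAG.conjCols p.F 0 := by rw [MDLAG.Data.dual, MDLAG.rmul_zero]
  have hΔ : 0 ≤ MDLAG.conjCols p.F 0 - MDLAG.conjCols p.F Y := sub_nonneg.2 (hmin 0 (by simp))
  refine ⟨pre Y hY, fun ξ' => ?_, fun k ω => pre (run ω k).y (hy k ω),
    fun k ω => (hpre _ _).2, fun k => ?_, fun ε hε => ?_⟩
  · rw [hdual]
    exact hmin _ (hU.sum_rmul_msqrt ξ')
  · simp only [hdual, hrun]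
    exact h.integrable hm (X := fun σ => MDLAG.conjCols p.F (p.runOf σ k).y)
      (A := p.sampleSet k) (MDLAG.Data.dependsOn_of_eq k fun σ σ' hσ _ => by
        simp only [hσ k le_rfl])
  · simp only [hdual, hdual0, hrun]
    obtain ⟨N, hN, hconv⟩ := MDLAG.Data.exists_iterations hn hm hd hU hf hΔ hε
    have hl : 0 ≤ Real.sqrt p.kappaF *
        Real.log (2 + (MDLAG.conjCols p.F 0 - MDLAG.conjCols p.F Y) / ε) :=
      mul_nonneg (Real.sqrt_nonneg _) (Real.log_nonneg (by
        have := div_nonneg hΔ hε.le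
        linarith))
    refine ⟨N, by linarith, fun k hk => ?_, fun ω => ?_⟩
    · have h1 := MDLAG.Data.expect_conjCols_y_le h hn hm hd hD hU hf hY hmin k
      exact h1.trans (add_le_add le_rfl (hconv k hk))
    · have h1 : ((p.runOf (s ω) N).evals : ℝ) ≤ 85 * (n * B) * N :=
        MDLAG.Data.evals_le_mul hn hm hd hD hU hf (s ω) N
      have h2 := mul_le_mul_of_nonneg_left hN (show 0 ≤ 85 * (n * B) by positivity)
      refine h1.trans (h2.trans (le_of_eq ?_))
      ring
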